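/- Let $X$ be a smooth effective orbifold of dimension $n$: a Hausdorff space covered by open sets with uniformizing systems $(V,G,\pi)$, where $V\subseteq\mathbb R^n$ is open and connected, $G$ is a finite group acting smoothly and effectively on $V$, and $\pi$ induces a homeomorphism of $V/G$ onto an open subset of $X$; any two uniformizing systems are locally related by transition maps (diffeomorphisms between open subsets of the $V$'s covering the identity of $X$). A representing system $\sigma=(\{I_i\},\{U_i\},\{\gamma_i\},\{\xi_{ji}\})$ of a smooth free loop in $X$ consists of a finite cover of $S^1=\mathbb R/\mathbb Z$ by connected open sets $I_i$, uniformizing systems $(V_i,G_i,\pi_i)$ of open sets $U_i$, smooth maps $\gamma_i:I_i\to V_i$, and, for each component of $I_i\cap I_j$, a transition map $\xi_{ji}$ from $V_i$ to $V_j$, defined near the image of that component under $\gamma_i$, such that $\gamma_j=\xi_{ji}\circ\gamma_i$ on $I_i\cap I_j$ and $\xi_{kj}\circ\xi_{ji}=\xi_{ki}$ along triple intersections. A smooth free loop is a class of representing systems, two systems being equivalent if they have a common refinement (up to isomorphism). The space $\mathcal LX$ of smooth free loops carries the $C^\infty$ topology: a basic neighbourhood of the loop of $\sigma$ consists of the loops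 that have a representing system with the same uniformizing systems $U_i$, with the same transition maps over the overlaps of given compact sets $K_i\subseteq I_i$ that cover $S^1$, and with maps that are close to $\gamma_i$ on $K_i$ together with their derivatives up to a given finite order. For a representing system $\sigma$ let $E_\sigma=\bigcup_i\gamma_i^*TV_i/\!\sim$ be the pull-back tangent bundle over $S^1$, glued by the differentials of the $\xi_{ji}$; let $\bar\sigma:E_\sigma\to TX$ be the natural map, let $\Gamma(E_\sigma)$ be the space of smooth sections of $E_\sigma$ with the $C^\infty$ topology, and let $G_\sigma$ be the group of smooth vector bundle automorphisms $\theta$ of $E_\sigma$ over the identity of $S^1$ with $\bar\sigma\circ\theta=\bar\sigma$. A pre-Hilbert orbifold structure on a Hausdorff space $L$ is a family of uniformizing systems $(O,G,\pi)$ that cover $L$, where $O$ is a connected open subset of a locally convex topological vector space equipped with a continuous inner product, $G$ is a finite group acting smoothly and effectively on $O$, and $\pi$ induces a homeomorphism of $O/G$ onto an open subset of $L$; any two of them are compatible, i.e. points of two such $O$'s with the same image in $L$ have neighbourhoods that correspond under a diffeomorphism over $L$ which is equivariant with respect to an isomorphism of the stabilizers. (Smoothness is meant in the sense of Michal and Bastiani.)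 **Theorem.** The space $\mathcal LX$ of smooth free loops of the orbifold $X$ has a pre-Hilbert orbifold structure such that for every smooth free loop $\tilde\gamma$ and every representing system $\sigma$ of $\tilde\gamma$, a neighbourhood of $\tilde\gamma$ is uniformized by a system $(\mathcal O(\Gamma(E_\sigma)),G_\sigma,\pi_\sigma)$ of the structure. Here $\mathcal O(\Gamma(E_\sigma))$ is a $G_\sigma$-invariant open neighbourhood of the zero section in $\Gamma(E_\sigma)$, $G_\sigma$ (in particular a finite group) acts by $(\theta s)(t)=\theta_t(s(t))$, $\pi_\sigma(0)=\tilde\gamma$, and the inner product on $\Gamma(E_\sigma)$ is $\langle s,s'\rangle=\int_{S^1}h_t(s(t),s'(t))\,dt$ for a smooth $G_\sigma$-invariant Euclidean metric $h$ on $E_\sigma$. Moreover, on open sets $J_i\subseteq I_i$ that still cover $S^1$ there are smooth families of maps $e_i(t,\cdot)$, defined on a fixed ball of $\mathbb R^n$ about $0$, with $e_i(t,0)=\gamma_i(t)$ and $\partial_v e_i(t,0)=\mathrm{id}$, such that every section $s=\{s_i\}$ in $\mathcal O(\Gamma(E_\sigma))$ takes values in this ball over each $J_i$ and $\pi_\sigma(s)$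 is represented by $(\{J_i\},\{U_i\},\{e_i(t,s_i(t))\},\{\xi_{ji}\})$. -/

import Mathlib

open Set Filter Topology MeasureTheory
open scoped ContDiff

noncomputable section

namespace OrbifoldLoops

/-! ### Finite-dimensional orbifolds -/

/-- The model space of an `n`-dimensional orbifold. -/
abbrev Model (n : ℕ) : Type := EuclideanSpace ℝ (Fin n)

/-- A uniformizing system `(V, G, π)` of an open subset of `X`: a connected open set `V ⊆ ℝⁿ`, a
finite group `G` acting on `V` smoothly and effectively, and a continuous map `π : V → X` that is
open and whose fibres are the `G`-orbits (so that `π` induces a homeomorphism of `V / G` onto the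
open set `π(V)`). Values of `act` and `proj` outside `V` are irrelevant. -/
structure OrbifoldChart (n : ℕ) (X : Type*) [TopologicalSpace X] where
  V : Set (Model n)
  isOpen_V : IsOpen V
  isConnected_V : IsConnected V
  G : Type
  [group : Group G]
  [finite : Finite G]
  act : G → Model n → Model n
  act_mem : ∀ g, ∀ x ∈ V, act g x ∈ V
  act_one : ∀ x ∈ V, act 1 x = x
  act_mul : ∀ g h, ∀ x ∈ V, act (g * h) x = act g (act h x)
  act_smooth : ∀ g, ContDiffOn ℝ ∞ (act g) V
  act_effective : ∀ g, (∀ x ∈ V, act g x = x) → g = 1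
  proj : Model n → X
  proj_continuousOn : ContinuousOn proj V
  proj_isOpen : ∀ W ⊆ V, IsOpen W → IsOpen (proj '' W)
  proj_eq_iff : ∀ x ∈ V, ∀ y ∈ V, proj x = proj y ↔ ∃ g, act g x = y

attribute [instance] OrbifoldChart.group OrbifoldChart.finite

/-- `φ` is a transition map from the uniformizing system `a` to the uniformizing system `b`: a
diffeomorphism from an open subset of `V_a` onto an open subset of `V_b` that covers the identity
of `X`. -/
structure IsTransition {n : ℕ} {X : Type*} [TopologicalSpace X] (a b : OrbifoldChart n X)
    (φ : OpenPartialHomeomorph (Model n) (Model n)) : Prop where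
  source_subset : φ.source ⊆ a.V
  target_subset : φ.target ⊆ b.V
  smooth : ContDiffOn ℝ ∞ φ φ.source
  smooth_symm : ContDiffOn ℝ ∞ φ.symm φ.target
  proj_apply : ∀ x ∈ φ.source, b.proj (φ x) = a.proj x

/-- A smooth (effective) orbifold structure of dimension `n` on `X`: a covering by uniformized
open sets, any two of which are locally related by transition maps. -/
structure Orbifold (n : ℕ) (X : Type*) [TopologicalSpace X] where
  Index : Type*
  chart : Index → OrbifoldChart n X
  cover : ∀ p : X, ∃ a, ∃ x ∈ (chart a).V, (chart a).proj x = p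
  compatible : ∀ a b, ∀ x ∈ (chart a).V, ∀ y ∈ (chart b).V,
    (chart a).proj x = (chart b).proj y →
    ∃ φ, IsTransition (chart a) (chart b) φ ∧ x ∈ φ.source ∧ φ x = y

section Tangent

variable {n : ℕ} {X : Type*} [TopologicalSpace X]

/-- The disjoint union of the tangent bundles `T V_a` of the uniformizing systems. -/
structure LocalTangent (𝒪 : Orbifold n X) where
  a : 𝒪.Index
  pt : Model n
  mem : pt ∈ (𝒪.chart a).V
  vec : Model n

/-- Two tangent vectors of uniformizing systems are identified when the differential of a
transition map takes one to the other. -/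
def LocalTangent.Rel {𝒪 : Orbifold n X} (v w : LocalTangent 𝒪) : Prop :=
  ∃ φ, IsTransition (𝒪.chart v.a) (𝒪.chart w.a) φ ∧ v.pt ∈ φ.source ∧ φ v.pt = w.pt ∧
    fderiv ℝ φ v.pt v.vec = w.vec

/-- The tangent orbibundle `TX` (as a set). -/
def TangentOrbibundle (𝒪 : Orbifold n X) : Type _ :=
  Quot (LocalTangent.Rel (𝒪 := 𝒪))

end Tangent

/-! ### Smooth free loops -/

/-- The part of `ℝ` lying over a subset `I` of the circle `S¹ = ℝ / ℤ`. Functions on `I` are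
differentiated as functions on this set. -/
def lift (I : Set UnitAddCircle) : Set ℝ := {r : ℝ | (r : UnitAddCircle) ∈ I}

/-- A function on the open subset `I` of the circle is smooth. -/
def SmoothOnCircle {F : Type*} [NormedAddCommGroup F] [NormedSpace ℝ F]
    (f : UnitAddCircle → F) (I : Set UnitAddCircle) : Prop :=
  ContDiffOn ℝ ∞ (fun r : ℝ => f (r : UnitAddCircle)) (lift I)

/-- The `p`-th derivative of a function on the circle, as a function on `ℝ`. -/
def circleDeriv {F : Type*} [NormedAddCommGroup F] [NormedSpace ℝ F]
    (p : ℕ) (f : UnitAddCircle → F) : ℝ → F :=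
  iteratedDeriv p (fun r : ℝ => f (r : UnitAddCircle))

section Loops

variable {n : ℕ} {X : Type*} [TopologicalSpace X]

/-- A representing system `({I_i}, {U_i}, {γ_i}, {ξ_ji})` of a smooth morphism from the circle into
the orbifold: a finite cover of the circle by connected open sets `I_i`, uniformizing systems
indexed by `U i`, smooth maps `γ_i : I_i → V_{U i}`, and, for every connected component of
`I_i ∩ I_j`, a transition map `ξ i j t` from `U i` to `U j` (`t` any point of the component), such
that `γ_j = ξ_ji ∘ γ_i` on `I_i ∩ I_j`, and `ξ_kj ∘ ξ_ji = ξ_ki` on triple intersections. An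
assignment to the components of `I_i ∩ I_j` is written as a locally constant function of `t`. -/
structure LoopSystem (𝒪 : Orbifold n X) (m : ℕ) where
  I : Fin m → Set UnitAddCircle
  isOpen_I : ∀ i, IsOpen (I i)
  isConnected_I : ∀ i, IsConnected (I i)
  cover : ∀ t, ∃ i, t ∈ I i
  U : Fin m → 𝒪.Index
  γ : Fin m → UnitAddCircle → Model n
  γ_mem : ∀ i, ∀ t ∈ I i, γ i t ∈ (𝒪.chart (U i)).V
  γ_smooth : ∀ i, SmoothOnCircle (γ i) (I i)
  ξ : Fin m → Fin m → UnitAddCircle → OpenPartialHomeomorph (Model n) (Model n)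
  ξ_transition : ∀ i j, ∀ t ∈ I i ∩ I j, IsTransition (𝒪.chart (U i)) (𝒪.chart (U j)) (ξ i j t)
  ξ_locConst : ∀ i j, ∀ t ∈ I i ∩ I j, ∀ᶠ t' in 𝓝 t, ξ i j t' = ξ i j t
  ξ_source : ∀ i j, ∀ t ∈ I i ∩ I j, γ i t ∈ (ξ i j t).source
  ξ_apply : ∀ i j, ∀ t ∈ I i ∩ I j, ξ i j t (γ i t) = γ j t
  ξ_cocycle : ∀ i j k, ∀ t ∈ I i ∩ I j ∩ I k,
    ∀ᶠ x in 𝓝 (γ i t), ξ j k t (ξ i j t x) = ξ i k t x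

/-- `τ` is a refinement of `σ`: for an index map `θ` with `J_k ⊆ I_{θ k}` and transition maps `ι_k`
from the chart of `τ` to the one of `σ`, the maps `γ` correspond under `ι_k`, and the transition
maps correspond under conjugation by the `ι_k`. (For `J = I`, `θ = id` and automorphisms `ι_k` of
the uniformizing systems, this says that `σ` and `τ` are isomorphic systems.) -/
def LoopSystem.Refines {𝒪 : Orbifold n X} {m' m : ℕ} (τ : LoopSystem 𝒪 m') (σ : LoopSystem 𝒪 m) :
    Prop :=
  ∃ (θ : Fin m' → Fin m) (ι : Fin m' → OpenPartialHomeomorph (Model n) (Model n)),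
    (∀ k, τ.I k ⊆ σ.I (θ k)) ∧
    (∀ k, IsTransition (𝒪.chart (τ.U k)) (𝒪.chart (σ.U (θ k))) (ι k)) ∧
    (∀ k, ∀ t ∈ τ.I k, τ.γ k t ∈ (ι k).source ∧ ι k (τ.γ k t) = σ.γ (θ k) t) ∧
    ∀ k l, ∀ t ∈ τ.I k ∩ τ.I l, ∀ᶠ x in 𝓝 (τ.γ k t),
      σ.ξ (θ k) (θ l) t (ι k x) = ι l (τ.ξ k l t x)

/-- Two representing systems are equivalent when they have a common refinement. -/
def LoopSystem.Equivalent {𝒪 : Orbifold n X} (σ τ : Σ m, LoopSystem 𝒪 m) : Prop :=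
  ∃ (m : ℕ) (ρ : LoopSystem 𝒪 m), ρ.Refines σ.2 ∧ ρ.Refines τ.2

/-- The space of smooth free loops of the orbifold: equivalence classes of representing systems. -/
def SmoothLoop (𝒪 : Orbifold n X) : Type _ :=
  Quot (LoopSystem.Equivalent (𝒪 := 𝒪))

/-- The free loop represented by a system. -/
def LoopSystem.loop {𝒪 : Orbifold n X} {m : ℕ} (σ : LoopSystem 𝒪 m) : SmoothLoop 𝒪 :=
  Quot.mk _ ⟨m, σ⟩

/-- The loops that have a representing system `τ` in the same uniformizing systems as `σ`, with the
same transition maps over `K_i ∩ K_j`, and whose maps are on each `K_i` closer than `ε` to those of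
`σ`, together with all derivatives up to order `k`. -/
def LoopSystem.nhd {𝒪 : Orbifold n X} {m : ℕ} (σ : LoopSystem 𝒪 m)
    (K : Fin m → Set UnitAddCircle) (k : ℕ) (ε : ℝ) : Set (SmoothLoop 𝒪) :=
  {l | ∃ τ : LoopSystem 𝒪 m, τ.loop = l ∧ τ.U = σ.U ∧ (∀ i, K i ⊆ τ.I i) ∧
    (∀ i j, ∀ t ∈ K i ∩ K j, τ.γ i t ∈ (σ.ξ i j t).source ∧
      ∀ᶠ x in 𝓝 (τ.γ i t), τ.ξ i j t x = σ.ξ i j t x) ∧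
    ∀ i, ∀ r ∈ lift (K i), ∀ p ≤ k, ‖circleDeriv p (τ.γ i) r - circleDeriv p (σ.γ i) r‖ < ε}

/-- The `C^∞` topology on the space of smooth free loops. -/
instance (𝒪 : Orbifold n X) : TopologicalSpace (SmoothLoop 𝒪) :=
  TopologicalSpace.generateFrom
    {N | ∃ (m : ℕ) (σ : LoopSystem 𝒪 m) (K : Fin m → Set UnitAddCircle) (k : ℕ) (ε : ℝ),
      0 < ε ∧ (∀ i, IsCompact (K i)) ∧ (∀ i, K i ⊆ σ.I i) ∧ (∀ t, ∃ i, t ∈ K i) ∧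
      N = σ.nhd K k ε}

/-! ### The pull-back tangent bundle, its sections, and the isotropy group -/

namespace LoopSystem

variable {𝒪 : Orbifold n X} {m : ℕ} (σ : LoopSystem 𝒪 m)

/-- The pull-back bundle `E_σ` over the circle is glued from the trivial bundles
`γ_i^* T V_{U i} = I_i × ℝⁿ` by these transition functions, the differentials of the transition
maps `ξ_ji` along `γ_i`. -/
def coordChange (i j : Fin m) (t : UnitAddCircle) : Model n →L[ℝ] Model n :=
  fderiv ℝ (σ.ξ i j t) (σ.γ i t)

/-- The space of smooth sections of `E_σ`, as a space of families of functions: a section is given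
by its components `s_i : I_i → ℝⁿ`, extended by zero outside `I_i`. -/
def sections : Submodule ℝ (Fin m → UnitAddCircle → Model n) where
  carrier := {s | (∀ i, ∀ t ∉ σ.I i, s i t = 0) ∧ (∀ i, SmoothOnCircle (s i) (σ.I i)) ∧
    ∀ i j, ∀ t ∈ σ.I i ∩ σ.I j, s j t = σ.coordChange i j t (s i t)}
  add_mem' := by
    rintro s s' ⟨h0, h1, h2⟩ ⟨h0', h1', h2'⟩
    refine ⟨fun i t ht => ?_, fun i => ?_, fun i j t ht => ?_⟩
    · simp [h0 i t ht, h0' i t ht]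
    · exact (h1 i).add (h1' i)
    · simp [h2 i j t ht, h2' i j t ht]
  zero_mem' := ⟨fun _ _ _ => rfl, fun _ => contDiffOn_const, fun _ _ _ _ => by simp⟩
  smul_mem' := by
    rintro c s ⟨h0, h1, h2⟩
    refine ⟨fun i t ht => ?_, fun i => ?_, fun i j t ht => ?_⟩
    · simp [h0 i t ht]
    · exact ContDiffOn.const_smul c (h1 i)
    · simp [h2 i j t ht]

/-- The vector space `Γ(E_σ)` of smooth sections of `E_σ`. -/
def Section : Type := σ.sections

instance : AddCommGroup σ.Section := inferInstanceAs (AddCommGroup σ.sections)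

instance : Module ℝ σ.Section := inferInstanceAs (Module ℝ σ.sections)

/-- The component `s_i` of a section. -/
def Section.comp {σ : LoopSystem 𝒪 m} (s : σ.Section) (i : Fin m) : UnitAddCircle → Model n :=
  s.1 i

/-- The `C^∞` topology on `Γ(E_σ)`: uniform convergence of all derivatives of the components on the
compact subsets of (the preimage in `ℝ` of) `I_i`. -/
instance : TopologicalSpace σ.Section :=
  ⨅ (i : Fin m) (p : ℕ), TopologicalSpace.induced
    (fun s : σ.Section =>
      UniformOnFun.ofFun {K : Set ℝ | IsCompact K ∧ K ⊆ lift (σ.I i)} (circleDeriv p (s.comp i)))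
    inferInstance

/-- The natural map `σ̄ : E_σ → TX` covering the loop, on the fibre over `t` written in the
trivialization over `I_i`. -/
def toTangent (i : Fin m) (t : UnitAddCircle) (ht : t ∈ σ.I i) (v : Model n) :
    TangentOrbibundle 𝒪 :=
  Quot.mk _ ⟨σ.U i, σ.γ i t, σ.γ_mem i t ht, v⟩

/-- The group `G_σ` of the smooth vector bundle automorphisms `θ` of `E_σ` (over the identity of the
circle) with `σ̄ ∘ θ = σ̄`. An automorphism is given by its components `θ_i : I_i → GL(ℝⁿ)`, extended
by the identity outside `I_i`. -/
def isotropy : Subgroup (Fin m → UnitAddCircle → (Model n ≃L[ℝ] Model n)) where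
  carrier := {θ | (∀ i, ∀ t ∉ σ.I i, θ i t = 1) ∧
    (∀ i, SmoothOnCircle (fun t => (θ i t : Model n →L[ℝ] Model n)) (σ.I i)) ∧
    (∀ i j, ∀ t ∈ σ.I i ∩ σ.I j, ∀ v,
      θ j t (σ.coordChange i j t v) = σ.coordChange i j t (θ i t v)) ∧
    ∀ i t, ∀ ht : t ∈ σ.I i, ∀ v, σ.toTangent i t ht (θ i t v) = σ.toTangent i t ht v}
  mul_mem' := by
    rintro θ θ' ⟨h0, h1, h2, h3⟩ ⟨h0', h1', h2', h3'⟩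
    refine ⟨fun i t ht => ?_, fun i => ?_, fun i j t ht v => ?_, fun i t ht v => ?_⟩
    · simp [h0 i t ht, h0' i t ht]
    · exact (h1 i).clm_comp (h1' i)
    · change θ j t (θ' j t _) = σ.coordChange i j t (θ i t (θ' i t v))
      rw [h2' i j t ht, h2 i j t ht]
    · change σ.toTangent i t ht (θ i t (θ' i t v)) = _
      rw [h3 i t ht, h3' i t ht]
  one_mem' := ⟨fun _ _ _ => rfl,
    fun _ => contDiffOn_const (c := ContinuousLinearMap.id ℝ (Model n)),
    fun _ _ _ _ _ => rfl, fun _ _ _ _ => rfl⟩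
  inv_mem' := by
    rintro θ ⟨h0, h1, h2, h3⟩
    refine ⟨fun i t ht => ?_, fun i => ?_, fun i j t ht v => ?_, fun i t ht v => ?_⟩
    · simp [h0 i t ht]
    · intro r hr
      have := (contDiffAt_map_inverse (𝕜 := ℝ) (n := ∞) (θ i (r : UnitAddCircle))).comp_contDiffWithinAt
        r (h1 i r hr)
      refine this.congr (fun y _ => ?_) ?_ <;>
      · change _ = ContinuousLinearMap.inverse _
        rw [ContinuousLinearMap.inverse_equiv]
        rfl
    · have key := h2 i j t ht ((θ i t)⁻¹ v)
      change (θ j t).symm _ = σ.coordChange i j t ((θ i t).symm v)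
      rw [ContinuousLinearEquiv.symm_apply_eq]
      change _ = θ j t (σ.coordChange i j t ((θ i t)⁻¹ v))
      rw [key]
      change _ = σ.coordChange i j t ((θ i t) ((θ i t).symm v))
      simp
    · have key := h3 i t ht ((θ i t).symm v)
      rw [ContinuousLinearEquiv.apply_symm_apply] at key
      exact key.symm

/-- A smooth Euclidean metric on the vector bundle `E_σ` that is invariant under `G_σ`. -/
structure InvariantMetric where
  h : Fin m → UnitAddCircle → Model n →L[ℝ] Model n →L[ℝ] ℝ
  smooth : ∀ i, SmoothOnCircle (h i) (σ.I i)
  symm : ∀ i, ∀ t ∈ σ.I i, ∀ v w, h i t v w = h i t w v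
  pos : ∀ i, ∀ t ∈ σ.I i, ∀ v, v ≠ 0 → 0 < h i t v v
  compatible : ∀ i j, ∀ t ∈ σ.I i ∩ σ.I j, ∀ v w,
    h j t (σ.coordChange i j t v) (σ.coordChange i j t w) = h i t v w
  invariant : ∀ θ ∈ σ.isotropy, ∀ i, ∀ t ∈ σ.I i, ∀ v w, h i t (θ i t v) (θ i t w) = h i t v w

/-- An index of a trivialization over the point `t` of the circle. -/
def indexAt (t : UnitAddCircle) : Fin m := (σ.cover t).choose

/-- The `L²` inner product `∫_{S¹} h_t(s(t), s'(t)) dt` of two sections of `E_σ`. -/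
def InvariantMetric.l2 {σ : LoopSystem 𝒪 m} (h : σ.InvariantMetric) (s s' : σ.Section) : ℝ :=
  ∫ t : UnitAddCircle, h.h (σ.indexAt t) t (s.comp (σ.indexAt t) t) (s'.comp (σ.indexAt t) t)

/-- The map `P` from a set `O` of sections of `E_σ` to loops has the pointwise form
`P(s) = [({J_i}, {U_i}, {e_i(t, s_i(t))}, {ξ_ji})]`, where the `J_i ⊆ I_i` still cover the circle
and `e_i` is a smooth family of maps on small vectors (such as an exponential map along `γ_i`)
with `e_i(t, 0) = γ_i(t)` and with fibre derivative at zero the identity. -/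
def IsFibrewiseExp (O : Set σ.Section) (P : σ.Section → SmoothLoop 𝒪) : Prop :=
  ∃ (J : Fin m → Set UnitAddCircle) (r : ℝ) (e : Fin m → UnitAddCircle → Model n → Model n),
    0 < r ∧ (∀ i, J i ⊆ σ.I i) ∧
    (∀ i, ContDiffOn ℝ ∞ (fun p : ℝ × Model n => e i (p.1 : UnitAddCircle) p.2)
      (lift (J i) ×ˢ Metric.ball 0 r)) ∧
    (∀ i, ∀ t ∈ J i, e i t 0 = σ.γ i t ∧
      HasFDerivAt (e i t) (ContinuousLinearMap.id ℝ (Model n)) 0) ∧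
    ∀ s ∈ O, ∃ τ : LoopSystem 𝒪 m, τ.loop = P s ∧ τ.I = J ∧ τ.U = σ.U ∧
      (∀ i, ∀ t ∈ J i, ‖s.comp i t‖ < r ∧ τ.γ i t = e i t (s.comp i t)) ∧
      ∀ i j, ∀ t ∈ J i ∩ J j, τ.γ i t ∈ (σ.ξ i j t).source ∧
        ∀ᶠ x in 𝓝 (τ.γ i t), τ.ξ i j t x = σ.ξ i j t x

end LoopSystem

end Loops

/-! ### Pre-Hilbert orbifolds -/

/-- `f` is of class `C^k` (in the sense of Michal and Bastiani) on the open subset `O` of a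
topological vector space: continuous, and for `k + 1` such that all directional derivatives
`df(x; v)` at points of `O` exist and `df : O × H → F` is of class `C^k`. -/
def CkOn {F : Type} [AddCommGroup F] [Module ℝ F] [TopologicalSpace F] :
    (k : ℕ) → {H : Type} → [AddCommGroup H] → [Module ℝ H] → [TopologicalSpace H] →
      (H → F) → Set H → Prop
  | 0, _, _, _, _, f, O => ContinuousOn f O
  | k + 1, H, _, _, _, f, O => ContinuousOn f O ∧ ∃ df : H × H → F,
      (∀ x ∈ O, ∀ v, Tendsto (fun ε : ℝ => ε⁻¹ • (f (x + ε • v) - f x)) (𝓝[≠] 0) (𝓝 (df (x, v)))) ∧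
      CkOn k df (O ×ˢ univ)

/-- `f` is smooth on the open subset `O` of a topological vector space. -/
def SmoothOn {H F : Type} [AddCommGroup H] [Module ℝ H] [TopologicalSpace H]
    [AddCommGroup F] [Module ℝ F] [TopologicalSpace F] (f : H → F) (O : Set H) : Prop :=
  ∀ k, CkOn k f O

/-- A uniformizing system `(O, G, π)` of an open subset of `L` modelled on the pre-Hilbert space `H`:
here `H` is a locally convex topological vector space with a continuous inner product, `O` is a
connected open subset of `H`, the finite group `G` acts on `O` smoothly and effectively, and
`π : O → L` is a continuous open map whose fibres are the `G`-orbits (so that `π` induces a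
homeomorphism of `O / G` onto the open set `π(O)`). -/
structure PreHilbertChart (H G : Type) (L : Type*) [AddCommGroup H] [Module ℝ H]
    [TopologicalSpace H] [Group G] [TopologicalSpace L] where
  isTopologicalAddGroup : IsTopologicalAddGroup H
  continuousSMul : ContinuousSMul ℝ H
  locallyConvex : LocallyConvexSpace ℝ H
  core : InnerProductSpace.Core ℝ H
  inner_continuous : Continuous fun p : H × H => core.inner p.1 p.2
  O : Set H
  isOpen_O : IsOpen O
  isConnected_O : IsConnected O
  finite : Finite G
  act : G → H → H
  act_mem : ∀ g, ∀ x ∈ O, act g x ∈ O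
  act_one : ∀ x ∈ O, act 1 x = x
  act_mul : ∀ g h, ∀ x ∈ O, act (g * h) x = act g (act h x)
  act_smooth : ∀ g, SmoothOn (act g) O
  act_effective : ∀ g, (∀ x ∈ O, act g x = x) → g = 1
  proj : H → L
  proj_continuousOn : ContinuousOn proj O
  proj_isOpen : ∀ W ⊆ O, IsOpen W → IsOpen (proj '' W)
  proj_eq_iff : ∀ x ∈ O, ∀ y ∈ O, proj x = proj y ↔ ∃ g, act g x = y

section PreHilbert

variable {H G H' G' : Type} {L : Type*} [AddCommGroup H] [Module ℝ H]
    [TopologicalSpace H] [Group G] [AddCommGroup H'] [Module ℝ H']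
    [TopologicalSpace H'] [Group G'] [TopologicalSpace L]

/-- The stabilizer in `G` of a point of `O`. -/
def PreHilbertChart.stabilizer (c : PreHilbertChart H G L) (x : H) (hx : x ∈ c.O) : Subgroup G where
  carrier := {g | c.act g x = x}
  mul_mem' := by
    intro g h hg hh
    change c.act (g * h) x = x
    rw [c.act_mul g h x hx, show c.act h x = x from hh, show c.act g x = x from hg]
  one_mem' := c.act_one x hx
  inv_mem' := by
    intro g hg
    change c.act g⁻¹ x = x
    have h := c.act_mul g⁻¹ g x hx
    rw [inv_mul_cancel, c.act_one x hx, show c.act g x = x from hg] at h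
    exact h.symm

/-- Two uniformizing systems are compatible: any two points with the same image in `L` have
neighbourhoods that correspond under a diffeomorphism `φ` over `L`, equivariant with respect to an
isomorphism of the stabilizers. -/
def PreHilbertChart.Compatible (c : PreHilbertChart H G L) (c' : PreHilbertChart H' G' L) : Prop :=
  ∀ x, ∀ hx : x ∈ c.O, ∀ x', ∀ hx' : x' ∈ c'.O, c.proj x = c'.proj x' →
    ∃ (φ : OpenPartialHomeomorph H H') (κ : c.stabilizer x hx ≃* c'.stabilizer x' hx'),
      φ.source ⊆ c.O ∧ φ.target ⊆ c'.O ∧ x ∈ φ.source ∧ φ x = x' ∧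
      SmoothOn φ φ.source ∧ SmoothOn φ.symm φ.target ∧
      (∀ y ∈ φ.source, c'.proj (φ y) = c.proj y) ∧
      ∀ g : c.stabilizer x hx, ∀ y ∈ φ.source,
        c.act g y ∈ φ.source ∧ φ (c.act g y) = c'.act (κ g) (φ y)

end PreHilbert

/-- A uniformizing system together with its model space and group. -/
structure PreHilbertUniformizer (L : Type*) [TopologicalSpace L] where
  H : Type
  G : Type
  [addCommGroup : AddCommGroup H]
  [module : Module ℝ H]
  [topologicalSpace : TopologicalSpace H]
  [group : Group G]
  chart : PreHilbertChart H G L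

attribute [instance] PreHilbertUniformizer.addCommGroup PreHilbertUniformizer.module
  PreHilbertUniformizer.topologicalSpace PreHilbertUniformizer.group

/-- A pre-Hilbert orbifold structure on `L`: `L` is Hausdorff, and is covered by the open sets
uniformized by a family of pairwise compatible uniformizing systems modelled on pre-Hilbert
spaces. -/
structure PreHilbertOrbifold (L : Type*) [TopologicalSpace L] where
  t2 : T2Space L
  charts : Set (PreHilbertUniformizer L)
  cover : ∀ l : L, ∃ c ∈ charts, ∃ x ∈ c.chart.O, c.chart.proj x = l
  compatible : ∀ c ∈ charts, ∀ c' ∈ charts, c.chart.Compatible c'.chart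

end OrbifoldLoops

end

open OrbifoldLoops

noncomputable section

namespace OrbifoldLoops

/-! ### Rigidity of transition maps: a transition map is determined by its one-jet at a point. -/

section

/-! The foundation is rigidity. Since the local groups are finite and act effectively on connected
sets, a group element fixing a point with identity differential is trivial (`eq_one_of_fderiv`), a
transition map of a chart to itself is locally a group element (`exists_germ_act`), and two
transition maps with the same one-jet at a point have the same germ there (`germ_of_jet`). Equality
of germs then propagates along connected sets (`germ_of_preconnected`).

Two representing systems give the same loop exactly when they are isomorphic, that is, linked by a
locally constant family of germs of transition maps compatible with both cocycles (`loop_eq_iff`).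
Every automorphism in the isotropy group is, over each `I i`, the differential along the curve of
one group element (`isotropy_exists`). Hence the isotropy group is finite, and it acts near the
curve by maps commuting with the cocycle.

Geodesics are replaced by a fibrewise logarithm: the differences of `x` and the curve in all
trivializations, averaged over the isotropy group and a partition of unity. It is equivariant,
respects the transition maps, vanishes on the curve and has identity differential there. Compactness
and a quantitative inverse function argument give exponential maps on tubes of fixed radius over
slightly smaller sets (`exists_expData`). Exponentiating small sections, with the old transition
maps, defines the projection to the loop space. Its domain is cut out by an invariant metric, so
that it is invariant and star-shaped.

If two exponentiated systems are isomorphic, the isomorphism is one group element over each `J i`.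
The tube is so thin that this element must fix the central curve; by rigidity it commutes with the
cocycle along that curve too, and so comes from the isotropy group. Hence the fibres of the
projection are the orbits (`loop_eq_iff_act`).

For compatibility of two such charts at sections with the same loop, an isomorphism of the
exponentiated systems is represented by finitely many transition maps `β c`, and nearby sections are
transferred by logarithm after `β c` after exponential (`exists_transfer`). Such an operator
composes sections with smooth fibrewise functions. Its difference quotients converge with all
derivatives to an operator of the same kind, which gives smoothness of every order
(`IsLocalOperator.smoothOn`). Equivariance follows by conjugating automorphisms with the patches and
applying the description of the fibres again.

Continuity and openness of the projection are reduced by these transfers to the zero section of a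
system recentred at the loop in question (`continuousOn_proj`, `isOpen_image_proj`). There, small
sections exponentiate to nearby systems, and the logarithm turns a nearby system into a small
section.

The loop space is Hausdorff because a limit of pairs of isomorphic systems is a pair of isomorphic
systems: on finitely many patches the isomorphisms differ from fixed transition maps by elements of
finite groups, so one choice recurs and survives in the limit (`sysHom_of_tendsto`). -/

theorem _root_.ContinuousAt.eventually_ne_of_ne {α β : Type*} [TopologicalSpace α]
    [TopologicalSpace β] [T2Space β] {f g : α → β} {x : α} (hf : ContinuousAt f x)
    (hg : ContinuousAt g x) (h : f x ≠ g x) : ∀ᶠ y in 𝓝 x, f y ≠ g y :=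
  (hf.prodMk hg).eventually (isClosed_diagonal.isOpen_compl.mem_nhds h)

/-- Continuation principle: the good points form a clopen subset of `W`. Closedness is phrased with
"frequently" because it will be verified by passing to limits of one-jets. -/
theorem _root_.IsPreconnected.forall_of_clopen {α : Type*} [TopologicalSpace α] {W : Set α}
    (hW : IsPreconnected W) {P : α → Prop}
    (ho : ∀ x ∈ W, P x → ∀ᶠ y in 𝓝[W] x, P y)
    (hc : ∀ x ∈ W, (∃ᶠ y in 𝓝[W] x, P y) → P x) {x₀ : α} (hx₀ : x₀ ∈ W) (h₀ : P x₀) :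
    ∀ x ∈ W, P x := by
  have := isPreconnected_iff_preconnectedSpace.1 hW
  have hcl : IsClopen {w : W | P w} := by
    constructor
    · rw [isClosed_iff_frequently]
      intro w hw
      refine hc w w.2 ?_
      rw [← map_nhds_subtype_val]
      exact (frequently_map.2 hw)
    · rw [isOpen_iff_eventually]
      intro w hw
      have := ho w w.2 hw
      rw [← map_nhds_subtype_val] at this
      exact eventually_map.1 this
  have := hcl.eq_univ ⟨⟨x₀, hx₀⟩, h₀⟩
  intro x hx
  have h : (⟨x, hx⟩ : W) ∈ {w : W | P w} := by rw [this]; trivial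
  exact h

variable {n : ℕ} {X : Type*} [TopologicalSpace X]

namespace OrbifoldChart

variable (c : OrbifoldChart n X)

theorem act_contDiffAt (g : c.G) {x : Model n} (hx : x ∈ c.V) : ContDiffAt ℝ ∞ (c.act g) x :=
  (c.act_smooth g).contDiffAt (c.isOpen_V.mem_nhds hx)

theorem act_differentiableAt (g : c.G) {x : Model n} (hx : x ∈ c.V) :
    DifferentiableAt ℝ (c.act g) x :=
  (c.act_contDiffAt g hx).differentiableAt (by simp)

theorem act_inv_act (g : c.G) {x : Model n} (hx : x ∈ c.V) : c.act g⁻¹ (c.act g x) = x := by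
  rw [← c.act_mul _ _ _ hx, inv_mul_cancel, c.act_one _ hx]

theorem act_act_inv (g : c.G) {x : Model n} (hx : x ∈ c.V) : c.act g (c.act g⁻¹ x) = x := by
  rw [← c.act_mul _ _ _ hx, mul_inv_cancel, c.act_one _ hx]

theorem fderiv_act_one {x : Model n} (hx : x ∈ c.V) :
    fderiv ℝ (c.act 1) x = ContinuousLinearMap.id ℝ (Model n) := by
  have : c.act 1 =ᶠ[𝓝 x] id := by
    filter_upwards [c.isOpen_V.mem_nhds hx] with y hy using c.act_one y hy
  rw [this.fderiv_eq]; exact fderiv_id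

theorem fderiv_act_mul (g h : c.G) {x : Model n} (hx : x ∈ c.V) :
    fderiv ℝ (c.act (g * h)) x = (fderiv ℝ (c.act g) (c.act h x)).comp (fderiv ℝ (c.act h) x) := by
  have : c.act (g * h) =ᶠ[𝓝 x] c.act g ∘ c.act h := by
    filter_upwards [c.isOpen_V.mem_nhds hx] with y hy using c.act_mul g h y hy
  rw [this.fderiv_eq]
  exact fderiv_comp _ (c.act_differentiableAt g (c.act_mem h x hx)) (c.act_differentiableAt h hx)

/-- The action of a group element as a partial homeomorphism of `V`. -/
def actHomeo (g : c.G) : OpenPartialHomeomorph (Model n) (Model n) where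
  toFun := c.act g
  invFun := c.act g⁻¹
  source := c.V
  target := c.V
  map_source' := fun x hx => c.act_mem g x hx
  map_target' := fun x hx => c.act_mem g⁻¹ x hx
  left_inv' := fun _ hx => c.act_inv_act g hx
  right_inv' := fun _ hx => c.act_act_inv g hx
  open_source := c.isOpen_V
  open_target := c.isOpen_V
  continuousOn_toFun := (c.act_smooth g).continuousOn
  continuousOn_invFun := (c.act_smooth g⁻¹).continuousOn

@[simp] theorem actHomeo_coe (g : c.G) : (c.actHomeo g : Model n → Model n) = c.act g := rfl
@[simp] theorem actHomeo_source (g : c.G) : (c.actHomeo g).source = c.V := rfl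

theorem proj_act (g : c.G) {x : Model n} (hx : x ∈ c.V) : c.proj (c.act g x) = c.proj x :=
  ((c.proj_eq_iff x hx _ (c.act_mem g x hx)).2 ⟨g, rfl⟩).symm

theorem isTransition_actHomeo (g : c.G) : IsTransition c c (c.actHomeo g) where
  source_subset := subset_rfl
  target_subset := subset_rfl
  smooth := c.act_smooth g
  smooth_symm := c.act_smooth g⁻¹
  proj_apply := fun _ hx => c.proj_act g hx

/-- By the chain rule at the fixed point; it prepares the average over the cyclic group generated by
`g`. -/
theorem hasFDerivAt_act_pow {g : c.G} {x : Model n} (hx : x ∈ c.V) (hgx : c.act g x = x)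
    (hd : fderiv ℝ (c.act g) x = ContinuousLinearMap.id ℝ (Model n)) (k : ℕ) :
    c.act (g ^ k) x = x ∧ fderiv ℝ (c.act (g ^ k)) x = ContinuousLinearMap.id ℝ (Model n) := by
  induction k with
  | zero => simpa using ⟨c.act_one x hx, c.fderiv_act_one hx⟩
  | succ k ih =>
    rw [pow_succ, c.act_mul _ _ _ hx, c.fderiv_act_mul _ _ hx, hgx, hd]
    exact ⟨ih.1, by rw [ih.2]; rfl⟩

/-- A group element that fixes a point with identity differential is the identity near it. -/
theorem eventually_act_eq_self {g : c.G} {x : Model n} (hx : x ∈ c.V) (hgx : c.act g x = x)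
    (hd : fderiv ℝ (c.act g) x = ContinuousLinearMap.id ℝ (Model n)) :
    ∀ᶠ y in 𝓝 x, c.act g y = y := by
  set N := orderOf g with hN
  have hNpos : 0 < N := orderOf_pos g
  -- The sum over the cyclic group of `g` is `g`-invariant and has strict derivative `N • id` at
  -- `x`. It is therefore injective near `x`, while it takes the same value at `y` and at its image
  -- under `g`.
  let A : Model n → Model n := fun y => ∑ k ∈ Finset.range N, c.act (g ^ k) y
  have hA : HasStrictFDerivAt A ((N : ℝ) • ContinuousLinearMap.id ℝ (Model n)) x := by
    have h1 : ∀ k ∈ Finset.range N, HasStrictFDerivAt (c.act (g ^ k))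
        (ContinuousLinearMap.id ℝ (Model n)) x := by
      intro k _
      have := (c.act_contDiffAt (g ^ k) hx).hasStrictFDerivAt (by simp)
      rwa [(c.hasFDerivAt_act_pow hx hgx hd k).2] at this
    have := HasStrictFDerivAt.fun_sum h1
    simpa only [Finset.sum_const, Finset.card_range, ← Nat.cast_smul_eq_nsmul ℝ] using this
  have hinv : ∀ y ∈ c.V, A (c.act g y) = A y := by
    intro y hy
    have e1 : A (c.act g y) = ∑ k ∈ Finset.range N, c.act (g ^ (k + 1)) y := by
      refine Finset.sum_congr rfl fun k _ => ?_
      rw [pow_succ, c.act_mul _ _ _ hy]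
    have e2 := Finset.sum_range_succ (fun k => c.act (g ^ k) y) N
    have e3 := Finset.sum_range_succ' (fun k => c.act (g ^ k) y) N
    rw [e1]
    have e4 : c.act (g ^ N) y = c.act (g ^ 0) y := by rw [hN, pow_orderOf_eq_one, pow_zero]
    rw [e3, e4] at e2
    exact add_right_cancel e2
  -- Applied to the image of `y` under `g` and to `y` itself, the estimate becomes `N * d ≤ d / 2`
  -- for the displacement `d`; as `1 ≤ N`, any constant below `1` forces `d = 0`.
  have hlo := hA.isLittleO.def (show (0 : ℝ) < 1 / 2 by norm_num)
  have hc : Tendsto (fun y => (c.act g y, y)) (𝓝 x) (𝓝 (x, x)) := by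
    have := (c.act_contDiffAt g hx).continuousAt.tendsto
    rw [hgx] at this
    exact this.prodMk_nhds tendsto_id
  filter_upwards [hc.eventually hlo, c.isOpen_V.mem_nhds hx] with y hy hyV
  simp only [hinv y hyV, sub_self, zero_sub, norm_neg, smul_apply,
    ContinuousLinearMap.id_apply, norm_smul, Real.norm_natCast] at hy
  have h1 : (1 : ℝ) ≤ N := by exact_mod_cast hNpos
  have h2 : ‖c.act g y - y‖ = 0 := by
    nlinarith [norm_nonneg (c.act g y - y)]
  exact sub_eq_zero.1 (norm_eq_zero.1 h2)

/-- The points fixed with identity differential form a closed set by continuity of the one-jet and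
an open set by the averaging argument. They fill the connected set `V`, and the action is effective.
-/
theorem eq_one_of_fderiv {g : c.G} {x : Model n} (hx : x ∈ c.V) (hgx : c.act g x = x)
    (hd : fderiv ℝ (c.act g) x = ContinuousLinearMap.id ℝ (Model n)) : g = 1 := by
  have key := c.isConnected_V.isPreconnected.forall_of_clopen
    (P := fun y => c.act g y = y ∧ fderiv ℝ (c.act g) y = ContinuousLinearMap.id ℝ (Model n))
    (fun y hy h => ?_) (fun y hy h => ?_) hx ⟨hgx, hd⟩
  · exact c.act_effective g fun y hy => (key y hy).1
  · have h1 := c.eventually_act_eq_self hy h.1 h.2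
    refine nhdsWithin_le_nhds ?_
    filter_upwards [h1.eventually_nhds] with z hz
    refine ⟨hz.self_of_nhds, ?_⟩
    have : c.act g =ᶠ[𝓝 z] id := hz
    rw [this.fderiv_eq]; exact fderiv_id
  · have hc1 : ContinuousAt (c.act g) y := (c.act_contDiffAt g hy).continuousAt
    have hc2 : ContinuousAt (fderiv ℝ (c.act g)) y :=
      ((c.act_contDiffAt g hy).fderiv_right (m := 0) (by simp)).continuousAt
    replace h := h.filter_mono nhdsWithin_le_nhds
    constructor
    · by_contra hne
      have hh : ∀ᶠ z in 𝓝 y, c.act g z ≠ z := hc1.eventually_ne_of_ne continuousAt_id hne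
      exact h (hh.mono fun z hz hz' => hz hz'.1)
    · by_contra hne
      have hh : ∀ᶠ z in 𝓝 y, fderiv ℝ (c.act g) z ≠ ContinuousLinearMap.id ℝ (Model n) :=
        hc2.eventually_ne_of_ne continuousAt_const hne
      exact h (hh.mono fun z hz hz' => hz hz'.2)

/-- A group element is determined by its value and differential at one point. -/
theorem act_injective_jet {g h : c.G} {x : Model n} (hx : x ∈ c.V) (hgx : c.act g x = c.act h x)
    (hd : fderiv ℝ (c.act g) x = fderiv ℝ (c.act h) x) : g = h := by
  have h1 : c.act (h⁻¹ * g) x = x := by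
    rw [c.act_mul _ _ _ hx, hgx, c.act_inv_act h hx]
  have h2 : fderiv ℝ (c.act (h⁻¹ * g)) x = ContinuousLinearMap.id ℝ (Model n) := by
    rw [c.fderiv_act_mul _ _ hx, hd, hgx, ← c.fderiv_act_mul _ _ hx, inv_mul_cancel,
      c.fderiv_act_one hx]
  have := c.eq_one_of_fderiv hx h1 h2
  exact (inv_mul_eq_one.1 this).symm

theorem act_injective_germ {g h : c.G} {x : Model n} (hx : x ∈ c.V)
    (hgh : c.act g =ᶠ[𝓝 x] c.act h) : g = h :=
  c.act_injective_jet hx hgh.self_of_nhds hgh.fderiv_eq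

end OrbifoldChart

namespace IsTransition

variable {a b d : OrbifoldChart n X} {φ ψ : OpenPartialHomeomorph (Model n) (Model n)}

theorem contDiffAt (h : IsTransition a b φ) {x : Model n} (hx : x ∈ φ.source) :
    ContDiffAt ℝ ∞ φ x := h.smooth.contDiffAt (φ.open_source.mem_nhds hx)

theorem differentiableAt (h : IsTransition a b φ) {x : Model n} (hx : x ∈ φ.source) :
    DifferentiableAt ℝ φ x := (h.contDiffAt hx).differentiableAt (by simp)

theorem mem_target (h : IsTransition a b φ) {x : Model n} (hx : x ∈ φ.source) : φ x ∈ b.V :=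
  h.target_subset (φ.map_source hx)

theorem symm (h : IsTransition a b φ) : IsTransition b a φ.symm where
  source_subset := h.target_subset
  target_subset := h.source_subset
  smooth := h.smooth_symm
  smooth_symm := h.smooth
  proj_apply := fun x hx => by
    have := h.proj_apply (φ.symm x) (φ.map_target hx)
    rw [φ.right_inv hx] at this
    exact this.symm

theorem trans (h : IsTransition a b φ) (h' : IsTransition b d ψ) :
    IsTransition a d (φ.trans ψ) where
  source_subset := fun x hx => h.source_subset (by simp at hx; exact hx.1)
  target_subset := fun x hx => h'.target_subset (by simp at hx; exact hx.1)
  smooth := fun x hx => by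
    simp only [OpenPartialHomeomorph.trans_source, mem_inter_iff, mem_preimage] at hx
    exact ((h'.contDiffAt hx.2).comp x (h.contDiffAt hx.1)).contDiffWithinAt
  smooth_symm := fun x hx => by
    simp only [OpenPartialHomeomorph.trans_target, mem_inter_iff, mem_preimage] at hx
    exact ((h.symm.contDiffAt hx.2).comp x (h'.symm.contDiffAt hx.1)).contDiffWithinAt
  proj_apply := fun x hx => by
    simp only [OpenPartialHomeomorph.trans_source, mem_inter_iff, mem_preimage] at hx
    exact (h'.proj_apply _ hx.2).trans (h.proj_apply _ hx.1)

theorem ofSet (a : OrbifoldChart n X) :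
    IsTransition a a (OpenPartialHomeomorph.ofSet a.V a.isOpen_V) where
  source_subset := subset_rfl
  target_subset := subset_rfl
  smooth := contDiffOn_id
  smooth_symm := contDiffOn_id
  proj_apply := fun _ _ => rfl

theorem fderiv_symm_comp (h : IsTransition a b φ) {x : Model n} (hx : x ∈ φ.source) :
    (fderiv ℝ φ.symm (φ x)).comp (fderiv ℝ φ x) = ContinuousLinearMap.id ℝ (Model n) := by
  have h1 : φ.symm ∘ φ =ᶠ[𝓝 x] id := φ.eventually_left_inverse hx
  rw [← fderiv_comp _ (h.symm.differentiableAt (φ.map_source hx)) (h.differentiableAt hx),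
    h1.fderiv_eq]
  exact fderiv_id

theorem fderiv_comp_symm (h : IsTransition a b φ) {x : Model n} (hx : x ∈ φ.source) :
    (fderiv ℝ φ x).comp (fderiv ℝ φ.symm (φ x)) = ContinuousLinearMap.id ℝ (Model n) := by
  have := h.symm.fderiv_symm_comp (φ.map_source hx)
  simpa [φ.left_inv hx] using this

/-- Baire category: both `y` and `φ y` lie over the same point of `X`, so finitely many closed sets,
one for each group element agreeing with `φ`, cover the source, and their interiors are dense. Some
`g` therefore has the same germ as `φ` at points arbitrarily close to `x`, and the one-jets agree in
the limit. -/
theorem exists_jet (h : IsTransition a a φ) {x : Model n} (hx : x ∈ φ.source) :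
    ∃ g, φ x = a.act g x ∧ fderiv ℝ φ x = fderiv ℝ (a.act g) x := by
  -- The implication puts all points outside the source into every `A g`, which makes `A g` closed
  -- in the whole (complete) model space.
  let A : a.G → Set (Model n) := fun g => {y | y ∈ φ.source → φ y = a.act g y}
  have hAc : ∀ g, IsClosed (A g) := by
    intro g
    rw [← isOpen_compl_iff, isOpen_iff_eventually]
    intro y hy
    have hy' : y ∈ φ.source ∧ φ y ≠ a.act g y := by simpa [A] using hy
    have c1 := (h.contDiffAt hy'.1).continuousAt
    have c2 := (a.act_contDiffAt g (h.source_subset hy'.1)).continuousAt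
    filter_upwards [c1.eventually_ne_of_ne c2 hy'.2, φ.open_source.mem_nhds hy'.1] with z hz hz'
    simpa [A] using ⟨hz', hz⟩
  have hU : ⋃ g, A g = univ := by
    refine eq_univ_of_forall fun y => ?_
    rw [mem_iUnion]
    by_cases hy : y ∈ φ.source
    · have h1 := h.source_subset hy
      obtain ⟨g, hg⟩ := (a.proj_eq_iff y h1 (φ y) (h.mem_target hy)).1 (h.proj_apply y hy).symm
      exact ⟨g, fun _ => hg.symm⟩
    · exact ⟨1, fun hy' => absurd hy' hy⟩
  have hdense := dense_iUnion_interior_of_closed hAc hU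
  have hfr : ∃ᶠ y in 𝓝 x, ∃ g, y ∈ interior (A g) ∩ φ.source := by
    have h1 : ∃ᶠ y in 𝓝 x, y ∈ ⋃ g, interior (A g) := mem_closure_iff_frequently.1 (hdense x)
    refine (h1.and_eventually (φ.open_source.mem_nhds hx)).mono ?_
    rintro y ⟨hy, hy'⟩
    obtain ⟨g, hg⟩ := mem_iUnion.1 hy
    exact ⟨g, hg, hy'⟩
  obtain ⟨g, hg⟩ : ∃ g, ∃ᶠ y in 𝓝 x, y ∈ interior (A g) ∩ φ.source := by
    by_contra hcon
    push Not at hcon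
    exact hfr ((eventually_all.2 hcon).mono fun y hy hy' => by
      obtain ⟨g, hg⟩ := hy'; exact hy g hg)
  have hxV := h.source_subset hx
  have hg' : ∃ᶠ y in 𝓝 x, φ =ᶠ[𝓝 y] a.act g := by
    refine hg.mono fun y hy => ?_
    filter_upwards [isOpen_interior.mem_nhds hy.1, φ.open_source.mem_nhds hy.2] with z hz hz'
    exact interior_subset hz hz'
  refine ⟨g, ?_, ?_⟩
  · by_contra hne
    have hh := (h.contDiffAt hx).continuousAt.eventually_ne_of_ne
      (a.act_contDiffAt g hxV).continuousAt hne
    exact hg' (hh.mono fun z hz hz' => hz hz'.self_of_nhds)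
  · by_contra hne
    have hh := ((h.contDiffAt hx).fderiv_right (m := 0) (by simp)).continuousAt.eventually_ne_of_ne
      ((a.act_contDiffAt g hxV).fderiv_right (m := 0) (by simp)).continuousAt hne
    exact hg' (hh.mono fun z hz hz' => hz hz'.fderiv_eq)

/-- One-jets are continuous, so their agreement is a closed condition. -/
theorem frequently_jet_closed (h : IsTransition a b φ) (h' : IsTransition a b ψ) {x : Model n}
    (hx : x ∈ φ.source) (hx' : x ∈ ψ.source)
    (hf : ∃ᶠ y in 𝓝 x, φ y = ψ y ∧ fderiv ℝ φ y = fderiv ℝ ψ y) :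
    φ x = ψ x ∧ fderiv ℝ φ x = fderiv ℝ ψ x := by
  constructor
  · by_contra hne
    have hh := (h.contDiffAt hx).continuousAt.eventually_ne_of_ne
      (h'.contDiffAt hx').continuousAt hne
    exact hf (hh.mono fun z hz hz' => hz hz'.1)
  · by_contra hne
    have hh := ((h.contDiffAt hx).fderiv_right (m := 0) (by simp)).continuousAt.eventually_ne_of_ne
      ((h'.contDiffAt hx').fderiv_right (m := 0) (by simp)).continuousAt hne
    exact hf (hh.mono fun z hz hz' => hz hz'.2)

/-- On a connected open subset, a transition map of a uniformizing system to itself is given by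
the action of a group element. -/
theorem exists_eqOn_act (h : IsTransition a a φ) {W : Set (Model n)} (hW : IsPreconnected W)
    (hWo : IsOpen W) (hWs : W ⊆ φ.source) {x : Model n} (hx : x ∈ W) :
    ∃ g, EqOn φ (a.act g) W := by
  obtain ⟨g, hg⟩ := h.exists_jet (hWs hx)
  refine ⟨g, fun y hy => ?_⟩
  have key := hW.forall_of_clopen
    (P := fun y => φ y = a.act g y ∧ fderiv ℝ φ y = fderiv ℝ (a.act g) y)
    (fun y hy hy' => ?_) (fun y hy hy' => ?_) hx hg
  · exact (key y hy).1
  · rw [hWo.nhdsWithin_eq hy]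
    -- If the jets stopped agreeing with `g` arbitrarily close to `y`, finiteness would give one `k
    -- ≠ g` whose jets agree there instead. In the limit `g` and `k` would have the same jet at `y`.
    by_contra hne
    have hne : ∃ᶠ z in 𝓝 y, ¬ (φ z = a.act g z ∧ fderiv ℝ φ z = fderiv ℝ (a.act g) z) :=
      not_eventually.1 hne
    have h2 : ∃ᶠ z in 𝓝 y, ∃ k : a.G, k ≠ g ∧
        (φ z = a.act k z ∧ fderiv ℝ φ z = fderiv ℝ (a.act k) z) := by
      refine (hne.and_eventually (φ.open_source.mem_nhds (hWs hy))).mono ?_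
      rintro z ⟨hz, hz'⟩
      obtain ⟨k, hk⟩ := h.exists_jet hz'
      exact ⟨k, fun e => hz (e ▸ hk), hk⟩
    obtain ⟨k, hk⟩ : ∃ k : a.G, ∃ᶠ z in 𝓝 y, k ≠ g ∧
        (φ z = a.act k z ∧ fderiv ℝ φ z = fderiv ℝ (a.act k) z) := by
      by_contra hcon
      push Not at hcon
      exact h2 ((eventually_all.2 fun k => hcon k).mono fun z hz hz' => by
        obtain ⟨k, hk1, hk2, hk3⟩ := hz'; exact hz k hk1 hk2 hk3)
    have hkg : k ≠ g := (hk.exists.choose_spec).1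
    have hyV := h.source_subset (hWs hy)
    have := h.frequently_jet_closed (a.isTransition_actHomeo k) (hWs hy) hyV
      (hk.mono fun z hz => hz.2)
    exact hkg (a.act_injective_jet hyV (this.1.symm.trans hy'.1) (this.2.symm.trans hy'.2))
  · exact h.frequently_jet_closed (a.isTransition_actHomeo g) (hWs hy)
      (h.source_subset (hWs hy)) (hy'.filter_mono nhdsWithin_le_nhds)

theorem exists_germ_act (h : IsTransition a a φ) {x : Model n} (hx : x ∈ φ.source) :
    ∃ g, φ =ᶠ[𝓝 x] a.act g := by
  obtain ⟨ε, hε, hb⟩ := Metric.isOpen_iff.1 φ.open_source x hx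
  obtain ⟨g, hg⟩ := h.exists_eqOn_act (convex_ball x ε).isPreconnected Metric.isOpen_ball hb
    (Metric.mem_ball_self hε)
  exact ⟨g, hg.eventuallyEq_of_mem (Metric.ball_mem_nhds x hε)⟩

/-- A transition map is determined near a point by its one-jet. -/
theorem germ_of_jet (h : IsTransition a b φ) (h' : IsTransition a b ψ) {x : Model n}
    (hx : x ∈ φ.source) (hx' : x ∈ ψ.source) (hv : φ x = ψ x)
    (hd : fderiv ℝ φ x = fderiv ℝ ψ x) : φ =ᶠ[𝓝 x] ψ := by
  -- The self-transition "`φ`, then the inverse of `ψ`" is locally a group element. That element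
  -- fixes `x` with identity differential, hence is `1`.
  have ht : IsTransition a a (φ.trans ψ.symm) := h.trans h'.symm
  have hxs : x ∈ (φ.trans ψ.symm).source := by
    simp only [OpenPartialHomeomorph.trans_source, mem_inter_iff, mem_preimage]
    exact ⟨hx, by rw [hv]; exact ψ.map_source hx'⟩
  obtain ⟨g, hg⟩ := ht.exists_germ_act hxs
  have e1 : a.act g x = x := by
    rw [← hg.self_of_nhds]
    simp [hv, ψ.left_inv hx']
  have e2 : fderiv ℝ (a.act g) x = ContinuousLinearMap.id ℝ (Model n) := by
    rw [← hg.fderiv_eq, OpenPartialHomeomorph.coe_trans, fderiv_comp _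
      (h'.symm.differentiableAt (by rw [hv]; exact ψ.map_source hx')) (h.differentiableAt hx),
      hd, hv, h'.fderiv_symm_comp hx']
  have hg1 := a.eq_one_of_fderiv (h.source_subset hx) e1 e2
  subst hg1
  have hmem : ∀ᶠ y in 𝓝 x, y ∈ (φ.trans ψ.symm).source :=
    (φ.trans ψ.symm).open_source.mem_nhds hxs
  filter_upwards [hg, hmem] with y hy hy'
  simp only [OpenPartialHomeomorph.trans_source, mem_inter_iff, mem_preimage] at hy'
  rw [a.act_one y (h.source_subset hy'.1)] at hy
  have h3 : ψ (ψ.symm (φ y)) = φ y := ψ.right_inv hy'.2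
  have hy2 : ψ.symm (φ y) = y := hy
  rw [hy2] at h3
  exact h3.symm

/-- Equality of germs is an open condition by nature, and a closed one because it amounts to
equality of one-jets. -/
theorem germ_of_preconnected (h : IsTransition a b φ) (h' : IsTransition a b ψ)
    {W : Set (Model n)} (hW : IsPreconnected W) (hφ : W ⊆ φ.source) (hψ : W ⊆ ψ.source)
    {x y : Model n} (hx : x ∈ W) (hy : y ∈ W) (hxy : φ =ᶠ[𝓝 x] ψ) : φ =ᶠ[𝓝 y] ψ := by
  refine hW.forall_of_clopen (P := fun y => φ =ᶠ[𝓝 y] ψ) (fun z hz hz' => ?_)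
    (fun z hz hz' => ?_) hx hxy y hy
  · exact nhdsWithin_le_nhds (hz'.eventuallyEq_nhds)
  · have := h.frequently_jet_closed h' (hφ hz) (hψ hz)
      ((hz'.filter_mono nhdsWithin_le_nhds).mono fun w hw => ⟨hw.self_of_nhds, hw.fderiv_eq⟩)
    exact h.germ_of_jet h' (hφ hz) (hψ hz) this.1 this.2

end IsTransition

end

section

/-! ### The circle -/

/-- The covering of the circle by the line is continuous and open, so local statements on the circle
can be checked on the line, where derivatives live. -/
theorem map_coe_nhds (r : ℝ) : map ((↑) : ℝ → UnitAddCircle) (𝓝 r) = 𝓝 (r : UnitAddCircle) :=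
  le_antisymm (continuous_quotient_mk'.tendsto r)
    ((QuotientAddGroup.isOpenMap_coe (N := AddSubgroup.zmultiples (1 : ℝ))).nhds_le r)

theorem eventually_coe {P : UnitAddCircle → Prop} {r : ℝ} :
    (∀ᶠ t in 𝓝 (r : UnitAddCircle), P t) ↔ ∀ᶠ r' in 𝓝 r, P (r' : ℝ) := by
  rw [← map_coe_nhds, eventually_map]

theorem continuous_circle_coe : Continuous ((↑) : ℝ → UnitAddCircle) := continuous_quotient_mk'

theorem isOpen_lift {I : Set UnitAddCircle} (hI : IsOpen I) : IsOpen (lift I) :=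
  hI.preimage continuous_circle_coe

theorem continuousAt_coe_iff {E : Type*} [TopologicalSpace E] {f : UnitAddCircle → E} {r : ℝ} :
    ContinuousAt f (r : UnitAddCircle) ↔ ContinuousAt (fun r : ℝ => f r) r := by
  rw [ContinuousAt, ContinuousAt, ← map_coe_nhds, tendsto_map'_iff]; rfl

theorem exists_coe_eq (t : UnitAddCircle) : ∃ r : ℝ, (r : UnitAddCircle) = t :=
  QuotientAddGroup.mk_surjective t

theorem exists_connected_nhd {I : Set UnitAddCircle} (hI : IsOpen I) {t : UnitAddCircle}
    (ht : t ∈ I) : ∃ N, IsOpen N ∧ IsConnected N ∧ t ∈ N ∧ closure N ⊆ I := by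
  obtain ⟨r, rfl⟩ := exists_coe_eq t
  obtain ⟨ε, hε, hb⟩ := Metric.isOpen_iff.1 (isOpen_lift hI) r ht
  refine ⟨(↑) '' Metric.ball r (ε / 2), QuotientAddGroup.isOpenMap_coe _ Metric.isOpen_ball,
    ((convex_ball r (ε / 2)).isConnected ⟨r, Metric.mem_ball_self (by positivity)⟩).image _
      continuous_circle_coe.continuousOn,
    ⟨r, Metric.mem_ball_self (by positivity), rfl⟩, ?_⟩
  have h1 : IsClosed (((↑) : ℝ → UnitAddCircle) '' Metric.closedBall r (ε / 2)) :=
    ((isCompact_closedBall r (ε / 2)).image continuous_circle_coe).isClosed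
  refine (closure_minimal (image_mono Metric.ball_subset_closedBall) h1).trans ?_
  rintro _ ⟨x, hx, rfl⟩
  exact hb (Metric.closedBall_subset_ball (by linarith) hx)

/-- The points that a connected open set with closure in `I` joins to a base point form a clopen
subset of `I`. Finitely many of these sets cover `K`, and their union is connected through the base
point. -/
theorem exists_connected_between {I K : Set UnitAddCircle} (hI : IsOpen I) (hIc : IsConnected I)
    (hK : IsCompact K) (hKI : K ⊆ I) :
    ∃ J, IsOpen J ∧ IsConnected J ∧ K ⊆ J ∧ closure J ⊆ I := by
  obtain ⟨t₀, ht₀⟩ := hIc.nonempty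
  have key : ∀ t ∈ I, ∃ J, IsOpen J ∧ IsConnected J ∧ t₀ ∈ J ∧ t ∈ J ∧ closure J ⊆ I := by
    refine hIc.isPreconnected.forall_of_clopen (fun t ht h => ?_) (fun t ht h => ?_) ht₀ ?_
    · obtain ⟨J, h1, h2, h3, h4, h5⟩ := h
      refine nhdsWithin_le_nhds ?_
      filter_upwards [h1.mem_nhds h4] with t' ht' using ⟨J, h1, h2, h3, ht', h5⟩
    · obtain ⟨N, n1, n2, n3, n4⟩ := exists_connected_nhd hI ht
      obtain ⟨t', ⟨J, h1, h2, h3, h4, h5⟩, ht'⟩ :=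
        ((h.filter_mono nhdsWithin_le_nhds).and_eventually (n1.mem_nhds n3)).exists
      exact ⟨J ∪ N, h1.union n1, h2.union ⟨t', h4, ht'⟩ n2, Or.inl h3, Or.inr n3, by
        rw [closure_union]; exact union_subset h5 n4⟩
    · obtain ⟨N, n1, n2, n3, n4⟩ := exists_connected_nhd hI ht₀
      exact ⟨N, n1, n2, n3, n3, n4⟩
  choose! J h1 h2 h3 h4 h5 using key
  obtain ⟨F, hF, hKF⟩ := hK.elim_nhds_subcover J (fun t ht => (h1 t (hKI ht)).mem_nhds (h4 t (hKI ht)))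
  refine ⟨⋃ t ∈ insert t₀ F, J t, ?_, ?_, ?_, ?_⟩
  · refine isOpen_biUnion fun t ht => h1 t ?_
    rcases Finset.mem_insert.1 ht with rfl | ht
    · exact ht₀
    · exact hKI (hF t ht)
  · refine ⟨⟨t₀, mem_biUnion (Finset.mem_insert_self _ _) (h3 t₀ ht₀)⟩, ?_⟩
    refine isPreconnected_of_forall t₀ ?_
    intro y hy
    obtain ⟨t, ht, hyt⟩ := mem_iUnion₂.1 hy
    have htI : t ∈ I := by
      rcases Finset.mem_insert.1 ht with rfl | ht
      · exact ht₀
      · exact hKI (hF t ht)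
    exact ⟨J t, subset_biUnion_of_mem (u := J) ht, h3 t htI, hyt, (h2 t htI).isPreconnected⟩
  · refine hKF.trans (biUnion_subset_biUnion_left fun t ht => Finset.mem_insert_of_mem ht)
  · rw [Finset.closure_biUnion]
    refine iUnion₂_subset fun t ht => h5 t ?_
    rcases Finset.mem_insert.1 ht with rfl | ht
    · exact ht₀
    · exact hKI (hF t ht)

theorem exists_compact_cover {m : ℕ} {I : Fin m → Set UnitAddCircle} (hI : ∀ i, IsOpen (I i))
    (hc : ∀ t, ∃ i, t ∈ I i) :
    ∃ K : Fin m → Set UnitAddCircle, (∀ i, IsCompact (K i)) ∧ (∀ i, K i ⊆ I i) ∧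
      ∀ t, ∃ i, t ∈ interior (K i) := by
  obtain ⟨v, hv1, hv2, hv3⟩ := exists_iUnion_eq_closure_subset hI (fun _ => toFinite _)
    (eq_univ_of_forall fun t => mem_iUnion.2 (hc t))
  refine ⟨fun i => closure (v i), fun i => isClosed_closure.isCompact, hv3, fun t => ?_⟩
  have : t ∈ ⋃ i, v i := by rw [hv1]; trivial
  obtain ⟨i, hi⟩ := mem_iUnion.1 this
  exact ⟨i, interior_maximal subset_closure (hv2 i) hi⟩

/-- The tube lemma for filters. All later uniformity over compact parts of the circle comes from it.
-/
theorem _root_.IsCompact.eventually_forall_prod {α β : Type*} [TopologicalSpace β] {𝓕 : Filter α}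
    {K : Set β} (hK : IsCompact K) {P : α → β → Prop}
    (h : ∀ t ∈ K, ∀ᶠ y in 𝓕 ×ˢ 𝓝 t, P y.1 y.2) : ∀ᶠ a in 𝓕, ∀ t ∈ K, P a t := by
  refine hK.induction_on (p := fun K => ∀ᶠ a in 𝓕, ∀ t ∈ K, P a t) (by simp)
    (fun s t hst ht => ht.mono fun a ha x hx => ha x (hst hx))
    (fun s t hs ht => (hs.and ht).mono fun a ha x hx => hx.elim (ha.1 x) (ha.2 x))
    (fun t ht => ?_)
  obtain ⟨A, hA, B, hB, hAB⟩ := eventually_prod_iff.1 (h t ht)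
  exact ⟨{x | B x}, mem_nhdsWithin_of_mem_nhds hB, hA.mono fun a ha x hx => hAB ha hx⟩

/-- Compactness of the graph of `γ` over `K` turns open conditions near its points into conditions
on a tube of one fixed radius. -/
theorem exists_tube {T E : Type*} [TopologicalSpace T] [PseudoMetricSpace E] {K : Set T}
    (hK : IsCompact K) {γ : T → E} (hγ : ∀ t ∈ K, ContinuousAt γ t) {P : T → E → Prop}
    (h : ∀ t ∈ K, ∀ᶠ q in 𝓝 (t, γ t), P q.1 q.2) :
    ∃ δ > 0, ∀ t ∈ K, ∀ x, dist x (γ t) < δ → P t x := by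
  have key : ∀ᶠ δ in 𝓝[>] (0 : ℝ), ∀ t ∈ K, ∀ x, dist x (γ t) < δ → P t x := by
    refine hK.eventually_forall_prod (P := fun δ t => ∀ x, dist x (γ t) < δ → P t x) fun t ht => ?_
    have h1 := h t ht
    rw [nhds_prod_eq] at h1
    obtain ⟨A, hA, B, hB, hAB⟩ := eventually_prod_iff.1 h1
    obtain ⟨η, hη, hηB⟩ := Metric.eventually_nhds_iff.1 hB
    have h2 : ∀ᶠ t' in 𝓝 t, dist (γ t') (γ t) < η / 2 :=
      (hγ t ht).tendsto.eventually (Metric.ball_mem_nhds _ (by positivity))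
    have h3 : ∀ᶠ δ in 𝓝[>] (0 : ℝ), δ < η / 2 :=
      nhdsWithin_le_nhds (gt_mem_nhds (by positivity))
    filter_upwards [h3.prod_mk (hA.and h2)] with y hy x hx
    refine hAB hy.2.1 (hηB ?_)
    calc dist x (γ t) ≤ dist x (γ y.2) + dist (γ y.2) (γ t) := dist_triangle _ _ _
      _ < η := by linarith [hy.1, hy.2.2]
  obtain ⟨δ, hδ, hδ'⟩ := (key.and self_mem_nhdsWithin).exists
  exact ⟨δ, hδ', hδ⟩

open scoped Manifold in
/-- Smooth partitions of unity on the circle. -/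
theorem exists_circle_partition {m : ℕ} {I : Fin m → Set UnitAddCircle} (hI : ∀ i, IsOpen (I i))
    (hc : ∀ t, ∃ i, t ∈ I i) :
    ∃ ρ : Fin m → UnitAddCircle → ℝ, (∀ k, ContDiff ℝ ∞ fun r : ℝ => ρ k r) ∧
      (∀ k t, 0 ≤ ρ k t) ∧ (∀ t, ∑ k, ρ k t = 1) ∧ ∀ k, tsupport (ρ k) ⊆ I k := by
  -- The partition of unity is taken in the plane, on the image of the embedded circle, and pulled
  -- back.
  let j : UnitAddCircle → ℂ := fun t => (AddCircle.toCircle t : ℂ)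
  have hjc : Continuous j := continuous_subtype_val.comp AddCircle.continuous_toCircle
  have hji : Function.Injective j :=
    Subtype.coe_injective.comp (AddCircle.injective_toCircle one_ne_zero)
  have hje := hjc.isClosedEmbedding hji
  have hU : ∀ i, ∃ U : Set ℂ, IsOpen U ∧ j ⁻¹' U = I i := fun i =>
    hje.isInducing.isOpen_iff.1 (hI i)
  choose U hUo hUI using hU
  obtain ⟨f, hf⟩ := SmoothPartitionOfUnity.exists_isSubordinate 𝓘(ℝ, ℂ) hje.isClosed_range U hUo (by
    rintro _ ⟨t, rfl⟩
    obtain ⟨i, hi⟩ := hc t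
    exact mem_iUnion.2 ⟨i, by rw [← hUI i] at hi; exact hi⟩)
  refine ⟨fun k t => f k (j t), fun k => ?_, fun k t => f.nonneg k _, fun t => ?_, fun k => ?_⟩
  · have h1 : ContDiff ℝ ∞ (f k) := (f k).contMDiff.contDiff
    refine h1.comp ?_
    have : (fun r : ℝ => j r) = fun r : ℝ => Complex.exp ((2 * Real.pi / 1 * r : ℝ) * Complex.I) := by
      funext r
      simp only [j, AddCircle.toCircle_apply_mk, Circle.coe_exp]
    rw [this]
    have hof : ContDiff ℝ ∞ (Complex.ofRealCLM : ℝ → ℂ) := Complex.ofRealCLM.contDiff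
    exact Complex.contDiff_exp.comp ((hof.comp (contDiff_const.mul contDiff_id)).mul contDiff_const)
  · rw [← finsum_eq_sum_of_fintype]
    exact f.sum_eq_one ⟨t, rfl⟩
  · intro t ht
    rw [← hUI k]
    refine hf k ?_
    exact (tsupport_comp_subset_preimage (f k) hjc) ht

/-! ### Smooth convergence of families of curves -/

section SmoothTendsto

variable {α : Type*} {E F G : Type*} [NormedAddCommGroup E] [NormedSpace ℝ E]
  [NormedAddCommGroup F] [NormedSpace ℝ F] [NormedAddCommGroup G] [NormedSpace ℝ G]

/-- The curves `u a` converge to `u₀` along `𝓕` with all derivatives, uniformly near `r`. -/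
structure SmoothTendsto (𝓕 : Filter α) (u : α → ℝ → E) (u₀ : ℝ → E) (r : ℝ) : Prop where
  smooth : ∀ᶠ y in 𝓕 ×ˢ 𝓝 r, ContDiffAt ℝ ∞ (u y.1) y.2
  smooth₀ : ∀ᶠ r' in 𝓝 r, ContDiffAt ℝ ∞ u₀ r'
  tendsto : ∀ p, Tendsto (fun y : α × ℝ => iteratedDeriv p (u y.1) y.2) (𝓕 ×ˢ 𝓝 r)
    (𝓝 (iteratedDeriv p u₀ r))

/-- A derivative sees a whole neighbourhood; this allows an identity between curves that holds
eventually to be differentiated. -/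
theorem eventually_prod_eventually_nhds {T : Type*} [TopologicalSpace T] {𝓕 : Filter α} {r : T}
    {P : α → T → Prop}
    (h : ∀ᶠ y in 𝓕 ×ˢ 𝓝 r, P y.1 y.2) : ∀ᶠ y in 𝓕 ×ˢ 𝓝 r, ∀ᶠ r' in 𝓝 y.2, P y.1 r' := by
  obtain ⟨A, hA, B, hB, hAB⟩ := eventually_prod_iff.1 h
  exact eventually_prod_iff.2 ⟨A, hA, fun x => ∀ᶠ x' in 𝓝 x, B x', hB.eventually_nhds,
    fun ha _ hb => hb.mono fun _ hx => hAB ha hx⟩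

theorem _root_.ContDiffAt.deriv_top {f : ℝ → E} {r : ℝ} (hf : ContDiffAt ℝ ∞ f r) :
    ContDiffAt ℝ ∞ (deriv f) r := by
  have := (hf.fderiv_right (m := ∞) (by simp)).clm_apply (contDiffAt_const (c := (1 : ℝ)))
  simpa using this

theorem iteratedDeriv_prodMk {f : ℝ → E} {g : ℝ → F} {p : ℕ} {r : ℝ}
    (hf : ∀ᶠ r' in 𝓝 r, ContDiffAt ℝ ∞ f r') (hg : ∀ᶠ r' in 𝓝 r, ContDiffAt ℝ ∞ g r') :
    iteratedDeriv p (fun r => (f r, g r)) r = (iteratedDeriv p f r, iteratedDeriv p g r) := by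
  induction p generalizing f g with
  | zero => simp
  | succ p ih =>
    rw [iteratedDeriv_succ', iteratedDeriv_succ', iteratedDeriv_succ']
    have : deriv (fun r => (f r, g r)) =ᶠ[𝓝 r] fun r => (deriv f r, deriv g r) := by
      filter_upwards [hf, hg] with r' h1 h2
      exact ((h1.differentiableAt (by simp)).hasDerivAt.prodMk
        (h2.differentiableAt (by simp)).hasDerivAt).deriv
    rw [this.iteratedDeriv_eq, ih]
    · exact hf.mono fun r' h => h.deriv_top
    · exact hg.mono fun r' h => h.deriv_top

namespace SmoothTendsto

variable {𝓕 : Filter α} {u : α → ℝ → E} {u₀ : ℝ → E} {r : ℝ}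

theorem tendsto_zero (h : SmoothTendsto 𝓕 u u₀ r) :
    Tendsto (fun y : α × ℝ => u y.1 y.2) (𝓕 ×ˢ 𝓝 r) (𝓝 (u₀ r)) := by
  simpa using h.tendsto 0

theorem tendsto_prodMk_zero (h : SmoothTendsto 𝓕 u u₀ r) :
    Tendsto (fun y : α × ℝ => (y.2, u y.1 y.2)) (𝓕 ×ˢ 𝓝 r) (𝓝 (r, u₀ r)) :=
  tendsto_snd.prodMk_nhds h.tendsto_zero

theorem deriv_curve (h : SmoothTendsto 𝓕 u u₀ r) :
    SmoothTendsto 𝓕 (fun a => deriv (u a)) (deriv u₀) r where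
  smooth := h.smooth.mono fun _ hy => hy.deriv_top
  smooth₀ := h.smooth₀.mono fun _ hy => hy.deriv_top
  tendsto p := by simpa only [iteratedDeriv_succ'] using h.tendsto (p + 1)

theorem prodMk {v : α → ℝ → F} {v₀ : ℝ → F} (h : SmoothTendsto 𝓕 u u₀ r)
    (h' : SmoothTendsto 𝓕 v v₀ r) :
    SmoothTendsto 𝓕 (fun a r => (u a r, v a r)) (fun r => (u₀ r, v₀ r)) r where
  smooth := by filter_upwards [h.smooth, h'.smooth] with y h1 h2 using h1.prodMk h2
  smooth₀ := by filter_upwards [h.smooth₀, h'.smooth₀] with y h1 h2 using h1.prodMk h2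
  tendsto p := by
    rw [iteratedDeriv_prodMk h.smooth₀ h'.smooth₀]
    refine ((h.tendsto p).prodMk_nhds (h'.tendsto p)).congr' ?_
    filter_upwards [eventually_prod_eventually_nhds (P := fun a r => ContDiffAt ℝ ∞ (u a) r) h.smooth,
      eventually_prod_eventually_nhds (P := fun a r => ContDiffAt ℝ ∞ (v a) r) h'.smooth] with y h1 h2
    exact (iteratedDeriv_prodMk h1 h2).symm

theorem const {u : ℝ → E} (h : ∀ᶠ r' in 𝓝 r, ContDiffAt ℝ ∞ u r') :
    SmoothTendsto 𝓕 (fun _ => u) u r where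
  smooth := h.prod_inr _
  smooth₀ := h
  tendsto p := by
    have : ContinuousAt (iteratedDeriv p u) r := by
      have h1 : ∀ p : ℕ, ∀ u : ℝ → E, (∀ᶠ r' in 𝓝 r, ContDiffAt ℝ ∞ u r') →
          ContinuousAt (iteratedDeriv p u) r := by
        intro p
        induction p with
        | zero => intro u h; simpa using h.self_of_nhds.continuousAt
        | succ p ih =>
          intro u h
          rw [iteratedDeriv_succ']
          exact ih _ (h.mono fun _ h => h.deriv_top)
      exact h1 p u h
    exact this.tendsto.comp tendsto_snd

theorem congr {v : α → ℝ → E} {v₀ : ℝ → E} (h : SmoothTendsto 𝓕 u u₀ r)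
    (huv : ∀ᶠ y in 𝓕 ×ˢ 𝓝 r, u y.1 y.2 = v y.1 y.2) (h₀ : ∀ᶠ r' in 𝓝 r, u₀ r' = v₀ r') :
    SmoothTendsto 𝓕 v v₀ r where
  smooth := by
    filter_upwards [h.smooth, eventually_prod_eventually_nhds (P := fun a r => u a r = v a r) huv] with y h1 h2
    exact h1.congr_of_eventuallyEq (h2.mono fun _ h => h.symm)
  smooth₀ := by
    filter_upwards [h.smooth₀, h₀.eventually_nhds] with y h1 h2
    exact h1.congr_of_eventuallyEq (h2.mono fun _ h => h.symm)
  tendsto p := by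
    rw [← Filter.EventuallyEq.iteratedDeriv_eq p (f := u₀) h₀]
    refine (h.tendsto p).congr' ?_
    filter_upwards [eventually_prod_eventually_nhds (P := fun a r => u a r = v a r) huv] with y hy
    exact Filter.EventuallyEq.iteratedDeriv_eq p hy

theorem comp_tendsto {β : Type*} {𝓖 : Filter β} {f : β → α} (h : SmoothTendsto 𝓕 u u₀ r)
    (hf : Tendsto f 𝓖 𝓕) : SmoothTendsto 𝓖 (fun b => u (f b)) u₀ r where
  smooth := (hf.prodMap tendsto_id).eventually h.smooth
  smooth₀ := h.smooth₀
  tendsto p := (h.tendsto p).comp (hf.prodMap tendsto_id)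

end SmoothTendsto

/-- The function whose composition with the jet `(r, (u r, u' r))` is the derivative of
`r ↦ Φ (r, u r)`. -/
def jetDeriv (Φ : ℝ × E → F) : ℝ × (E × E) → F :=
  fun q => fderiv ℝ Φ (q.1, q.2.1) (1, q.2.2)

theorem hasDerivAt_comp_graph {Φ : ℝ × E → F} {u : ℝ → E} {r : ℝ}
    (hΦ : ContDiffAt ℝ ∞ Φ (r, u r)) (hu : ContDiffAt ℝ ∞ u r) :
    HasDerivAt (fun r => Φ (r, u r)) (jetDeriv Φ (r, (u r, deriv u r))) r := by
  have h1 := (hasDerivAt_id r).prodMk (hu.differentiableAt (by simp)).hasDerivAt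
  exact HasFDerivAt.comp_hasDerivAt (f := fun r => (id r, u r)) r
    (hΦ.differentiableAt (by simp)).hasFDerivAt h1

theorem contDiffAt_jetDeriv {Φ : ℝ × E → F} {q : ℝ × (E × E)}
    (hΦ : ContDiffAt ℝ ∞ Φ (q.1, q.2.1)) : ContDiffAt ℝ ∞ (jetDeriv Φ) q := by
  have h1 : ContDiffAt ℝ ∞ (fun q : ℝ × (E × E) => fderiv ℝ Φ (q.1, q.2.1)) q :=
    ContDiffAt.comp q (hΦ.fderiv_right (m := ∞) (by simp))
      (contDiffAt_fst.prodMk (contDiffAt_fst.comp q contDiffAt_snd))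
  exact h1.clm_apply (contDiffAt_const.prodMk (contDiffAt_snd.comp q contDiffAt_snd))

theorem eventually_contDiffAt_jetDeriv {Φ : ℝ × E → F} {q : ℝ × (E × E)}
    (hΦ : ∀ᶠ p in 𝓝 (q.1, q.2.1), ContDiffAt ℝ ∞ Φ p) :
    ∀ᶠ p in 𝓝 q, ContDiffAt ℝ ∞ (jetDeriv Φ) p := by
  have : Tendsto (fun q : ℝ × (E × E) => (q.1, q.2.1)) (𝓝 q) (𝓝 (q.1, q.2.1)) :=
    Continuous.tendsto (by fun_prop) q
  exact (this.eventually hΦ).mono fun p hp => contDiffAt_jetDeriv hp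

/-- The derivative of `r ↦ Φ (r, u r)` has the same form, with `jetDeriv Φ` in place of `Φ` and the
curve `(u, u')` in place of `u`. The space `E` is quantified inside the induction because it doubles
at each step. -/
theorem tendsto_iteratedDeriv_comp {𝓕 : Filter α} {r : ℝ} (p : ℕ) :
    ∀ {E : Type _} [NormedAddCommGroup E] [NormedSpace ℝ E] {u : α → ℝ → E} {u₀ : ℝ → E}
      {Φ : ℝ × E → F}, SmoothTendsto 𝓕 u u₀ r → (∀ᶠ q in 𝓝 (r, u₀ r), ContDiffAt ℝ ∞ Φ q) →
      Tendsto (fun y : α × ℝ => iteratedDeriv p (fun r => Φ (r, u y.1 r)) y.2) (𝓕 ×ˢ 𝓝 r)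
        (𝓝 (iteratedDeriv p (fun r => Φ (r, u₀ r)) r)) := by
  induction p with
  | zero =>
    intro E _ _ u u₀ Φ h hΦ
    simp only [iteratedDeriv_zero]
    exact hΦ.self_of_nhds.continuousAt.tendsto.comp h.tendsto_prodMk_zero
  | succ p ih =>
    intro E _ _ u u₀ Φ h hΦ
    have h2 := ih (h.prodMk h.deriv_curve) (Φ := jetDeriv Φ) (eventually_contDiffAt_jetDeriv hΦ)
    have hg : Tendsto (fun r' => (r', u₀ r')) (𝓝 r) (𝓝 (r, u₀ r)) :=
      tendsto_id.prodMk_nhds h.smooth₀.self_of_nhds.continuousAt.tendsto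
    have e0 : deriv (fun r => Φ (r, u₀ r)) =ᶠ[𝓝 r] fun r => jetDeriv Φ (r, (u₀ r, deriv u₀ r)) := by
      filter_upwards [h.smooth₀, hg.eventually hΦ] with r' h1 h2
      exact (hasDerivAt_comp_graph h2 h1).deriv
    rw [iteratedDeriv_succ', e0.iteratedDeriv_eq]
    refine h2.congr' ?_
    have e1 : ∀ᶠ y in 𝓕 ×ˢ 𝓝 r, deriv (fun r => Φ (r, u y.1 r)) y.2 =
        jetDeriv Φ (y.2, (u y.1 y.2, deriv (u y.1) y.2)) := by
      filter_upwards [h.smooth, h.tendsto_prodMk_zero.eventually hΦ] with y h1 h2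
      exact (hasDerivAt_comp_graph h2 h1).deriv
    filter_upwards [eventually_prod_eventually_nhds (P := fun a r' => deriv (fun r => Φ (r, u a r)) r' =
        jetDeriv Φ (r', (u a r', deriv (u a) r'))) e1] with y hy
    rw [iteratedDeriv_succ']
    exact (Filter.EventuallyEq.iteratedDeriv_eq p hy).symm

/-- Composition with a smooth function is continuous for smooth convergence. -/
theorem SmoothTendsto.comp {𝓕 : Filter α} {u : α → ℝ → E} {u₀ : ℝ → E} {r : ℝ} {Φ : ℝ × E → F}
    (h : SmoothTendsto 𝓕 u u₀ r) (hΦ : ∀ᶠ q in 𝓝 (r, u₀ r), ContDiffAt ℝ ∞ Φ q) :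
    SmoothTendsto 𝓕 (fun a r => Φ (r, u a r)) (fun r => Φ (r, u₀ r)) r where
  smooth := by
    filter_upwards [h.smooth, h.tendsto_prodMk_zero.eventually hΦ] with y h1 h2
    exact ContDiffAt.comp (f := fun r => (r, u y.1 r)) y.2 h2 (contDiffAt_id.prodMk h1)
  smooth₀ := by
    have hg : Tendsto (fun r' => (r', u₀ r')) (𝓝 r) (𝓝 (r, u₀ r)) :=
      tendsto_id.prodMk_nhds h.smooth₀.self_of_nhds.continuousAt.tendsto
    filter_upwards [h.smooth₀, hg.eventually hΦ] with r' h1 h2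
    exact ContDiffAt.comp (f := fun r => (r, u₀ r)) r' h2 (contDiffAt_id.prodMk h1)
  tendsto p := tendsto_iteratedDeriv_comp p h hΦ

/-- The derivative of `Φ` in the direction of the fibre. -/
def fibreDeriv (Φ : ℝ × E → F) : ℝ × (E × E) → F :=
  fun q => fderiv ℝ Φ (q.1, q.2.1) (0, q.2.2)

theorem contDiffAt_fibreDeriv {Φ : ℝ × E → F} {q : ℝ × (E × E)}
    (hΦ : ContDiffAt ℝ ∞ Φ (q.1, q.2.1)) : ContDiffAt ℝ ∞ (fibreDeriv Φ) q := by
  have h1 : ContDiffAt ℝ ∞ (fun q : ℝ × (E × E) => fderiv ℝ Φ (q.1, q.2.1)) q :=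
    ContDiffAt.comp q (hΦ.fderiv_right (m := ∞) (by simp))
      (contDiffAt_fst.prodMk (contDiffAt_fst.comp q contDiffAt_snd))
  exact h1.clm_apply (contDiffAt_const.prodMk (contDiffAt_snd.comp q contDiffAt_snd))

/-- Differentiation along the curve commutes with differentiation in the fibre, because the second
derivative of `Φ` is symmetric. -/
theorem hasDerivAt_fibreDeriv {Φ : ℝ × E → F} {u w : ℝ → E} {r : ℝ}
    (hΦ : ContDiffAt ℝ ∞ Φ (r, u r)) (hu : ContDiffAt ℝ ∞ u r) (hw : ContDiffAt ℝ ∞ w r) :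
    HasDerivAt (fun r => fibreDeriv Φ (r, (u r, w r)))
      (fibreDeriv (jetDeriv Φ) (r, ((u r, deriv u r), (w r, deriv w r)))) r := by
  have hD : HasFDerivAt (fderiv ℝ Φ) (fderiv ℝ (fderiv ℝ Φ) (r, u r)) (r, u r) :=
    ((hΦ.fderiv_right (m := ∞) (by simp)).differentiableAt (by simp)).hasFDerivAt
  have hu' := (hasDerivAt_id r).prodMk (hu.differentiableAt (by simp)).hasDerivAt
  have hw' := (hasDerivAt_const r (0 : ℝ)).prodMk (hw.differentiableAt (by simp)).hasDerivAt
  have h1 : HasDerivAt (fun r => fderiv ℝ Φ (r, u r)) _ r :=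
    HasFDerivAt.comp_hasDerivAt (f := fun r => (id r, u r)) r hD hu'
  have h2 := h1.clm_apply hw'
  have h3 : HasFDerivAt (fun q : ℝ × (E × E) => fderiv ℝ Φ (q.1, q.2.1)) _
      (r, (u r, deriv u r)) :=
    HasFDerivAt.comp (f := fun q : ℝ × (E × E) => (q.1, q.2.1)) (r, (u r, deriv u r)) hD
      (hasFDerivAt_fst.prodMk ((ContinuousLinearMap.fst ℝ E E).comp
        (ContinuousLinearMap.snd ℝ ℝ (E × E))).hasFDerivAt)
  have h4 : HasFDerivAt (fun q : ℝ × (E × E) => ((1 : ℝ), q.2.2)) _ (r, (u r, deriv u r)) :=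
    (hasFDerivAt_const (1 : ℝ) _).prodMk ((ContinuousLinearMap.snd ℝ E E).comp
      (ContinuousLinearMap.snd ℝ ℝ (E × E))).hasFDerivAt
  have h5 : HasFDerivAt (jetDeriv Φ) _ (r, (u r, deriv u r)) := h3.clm_apply h4
  have hs : IsSymmSndFDerivAt ℝ Φ (r, u r) := hΦ.isSymmSndFDerivAt (by
    rw [minSmoothness_of_isRCLikeNormedField]; exact WithTop.coe_le_coe.2 le_top)
  refine HasDerivAt.congr_deriv (f := fun r => fibreDeriv Φ (r, (u r, w r))) h2 ?_
  symm
  change fderiv ℝ (jetDeriv Φ) (r, (u r, deriv u r)) (0, (w r, deriv w r)) = _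
  rw [h5.fderiv]
  simp only [add_apply, ContinuousLinearMap.comp_apply,
    ContinuousLinearMap.flip_apply, ContinuousLinearMap.prod_apply]
  simp
  rw [hs.eq, add_comm]

/-- The derivative of a difference quotient of `Φ` is a difference quotient of `jetDeriv Φ` for
doubled curves, so only order zero needs analysis. There both points of evaluation move, which is
why strict differentiability is used. -/
theorem tendsto_iteratedDeriv_quotient {r : ℝ} (p : ℕ) :
    ∀ {E : Type _} [NormedAddCommGroup E] [NormedSpace ℝ E] {u w : ℝ → E}
      {Φ : ℝ × E → F}, (∀ᶠ r' in 𝓝 r, ContDiffAt ℝ ∞ u r') → (∀ᶠ r' in 𝓝 r, ContDiffAt ℝ ∞ w r') →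
      (∀ᶠ q in 𝓝 (r, u r), ContDiffAt ℝ ∞ Φ q) →
      Tendsto (fun y : ℝ × ℝ => iteratedDeriv p
          (fun r => y.1⁻¹ • (Φ (r, u r + y.1 • w r) - Φ (r, u r))) y.2) (𝓝[≠] 0 ×ˢ 𝓝 r)
        (𝓝 (iteratedDeriv p (fun r => fibreDeriv Φ (r, (u r, w r))) r)) := by
  induction p with
  | zero =>
    intro E _ _ u w Φ hu hw hΦ
    simp only [iteratedDeriv_zero]
    have hst := hΦ.self_of_nhds.hasStrictFDerivAt (n := ∞) (by simp)
    have hcu := hu.self_of_nhds.continuousAt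
    have hcw := hw.self_of_nhds.continuousAt
    have t0 : Tendsto (fun y : ℝ × ℝ => y.2) (𝓝[≠] 0 ×ˢ 𝓝 r) (𝓝 r) := tendsto_snd
    have te : Tendsto (fun y : ℝ × ℝ => y.1) (𝓝[≠] 0 ×ˢ 𝓝 r) (𝓝 0) :=
      (tendsto_fst).mono_right nhdsWithin_le_nhds
    have tu := hcu.tendsto.comp t0
    have tw := hcw.tendsto.comp t0
    have t1 : Tendsto (fun y : ℝ × ℝ => (y.2, u y.2)) (𝓝[≠] 0 ×ˢ 𝓝 r) (𝓝 (r, u r)) :=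
      t0.prodMk_nhds tu
    have t2 : Tendsto (fun y : ℝ × ℝ => (y.2, u y.2 + y.1 • w y.2)) (𝓝[≠] 0 ×ˢ 𝓝 r)
        (𝓝 (r, u r)) := by
      have := tu.add (te.smul tw)
      simp only [zero_smul, add_zero] at this
      exact t0.prodMk_nhds this
    have hlo := hst.isLittleO.comp_tendsto (t2.prodMk_nhds t1)
    -- The two points of evaluation differ by the parameter times `(0, w)`, and `w` is bounded near
    -- `r`; the error of strict differentiability thus survives division by the parameter.
    have hO : (fun y : ℝ × ℝ => ((y.2, u y.2 + y.1 • w y.2) : ℝ × E) - (y.2, u y.2))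
        =O[𝓝[≠] 0 ×ˢ 𝓝 r] fun y => y.1 := by
      have hw1 := tw.isBigO_one ℝ
      have := (Asymptotics.isBigO_refl (fun y : ℝ × ℝ => y.1) (𝓝[≠] 0 ×ˢ 𝓝 r)).smul hw1
      simp only [smul_eq_mul, mul_one] at this
      refine Asymptotics.IsBigO.trans (Asymptotics.isBigO_of_le _ fun y => ?_) this
      simp [Prod.norm_def]
    have h1 := (hlo.trans_isBigO hO).tendsto_inv_smul_nhds_zero
    have h2 : Tendsto (fun y : ℝ × ℝ => fderiv ℝ Φ (r, u r) (0, w y.2)) (𝓝[≠] 0 ×ˢ 𝓝 r)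
        (𝓝 (fibreDeriv Φ (r, (u r, w r)))) :=
      ((fderiv ℝ Φ (r, u r)).continuous.tendsto _).comp (tendsto_const_nhds.prodMk_nhds tw)
    have h3 := h1.add h2
    rw [zero_add] at h3
    refine h3.congr' ?_
    have hne : ∀ᶠ y : ℝ × ℝ in 𝓝[≠] 0 ×ˢ 𝓝 r, y.1 ≠ 0 :=
      tendsto_fst.eventually (self_mem_nhdsWithin)
    filter_upwards [hne] with y hy
    have e : ((y.2, u y.2 + y.1 • w y.2) : ℝ × E) - (y.2, u y.2) = y.1 • (0, w y.2) := by simp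
    simp only [Function.comp, e, map_smul, smul_sub, smul_smul, inv_mul_cancel₀ hy, one_smul]
    abel
  | succ p ih =>
    intro E _ _ u w Φ hu hw hΦ
    have hu2 : ∀ᶠ r' in 𝓝 r, ContDiffAt ℝ ∞ (fun r => (u r, deriv u r)) r' :=
      hu.mono fun _ h => h.prodMk h.deriv_top
    have hw2 : ∀ᶠ r' in 𝓝 r, ContDiffAt ℝ ∞ (fun r => (w r, deriv w r)) r' :=
      hw.mono fun _ h => h.prodMk h.deriv_top
    have h2 := ih hu2 hw2 (Φ := jetDeriv Φ) (eventually_contDiffAt_jetDeriv hΦ)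
    have hg : Tendsto (fun r' => (r', u r')) (𝓝 r) (𝓝 (r, u r)) :=
      tendsto_id.prodMk_nhds hu.self_of_nhds.continuousAt.tendsto
    have e0 : deriv (fun r => fibreDeriv Φ (r, (u r, w r))) =ᶠ[𝓝 r]
        fun r => fibreDeriv (jetDeriv Φ) (r, ((u r, deriv u r), (w r, deriv w r))) := by
      filter_upwards [hu, hw, hg.eventually hΦ] with r' h1 h2 h3
      exact (hasDerivAt_fibreDeriv h3 h1 h2).deriv
    rw [iteratedDeriv_succ', e0.iteratedDeriv_eq]
    refine h2.congr' ?_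
    have t2 : Tendsto (fun y : ℝ × ℝ => (y.2, u y.2 + y.1 • w y.2)) (𝓝[≠] 0 ×ˢ 𝓝 r)
        (𝓝 (r, u r)) := by
      have t0 : Tendsto (fun y : ℝ × ℝ => y.2) (𝓝[≠] 0 ×ˢ 𝓝 r) (𝓝 r) := tendsto_snd
      have te : Tendsto (fun y : ℝ × ℝ => y.1) (𝓝[≠] 0 ×ˢ 𝓝 r) (𝓝 0) :=
        (tendsto_fst).mono_right nhdsWithin_le_nhds
      have := (hu.self_of_nhds.continuousAt.tendsto.comp t0).add
        (te.smul (hw.self_of_nhds.continuousAt.tendsto.comp t0))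
      simp only [zero_smul, add_zero] at this
      exact t0.prodMk_nhds this
    have e1 : ∀ᶠ y : ℝ × ℝ in 𝓝[≠] 0 ×ˢ 𝓝 r,
        deriv (fun r => y.1⁻¹ • (Φ (r, u r + y.1 • w r) - Φ (r, u r))) y.2 =
        y.1⁻¹ • (jetDeriv Φ (y.2, ((u y.2, deriv u y.2) + y.1 • (w y.2, deriv w y.2))) -
          jetDeriv Φ (y.2, (u y.2, deriv u y.2))) := by
      filter_upwards [hu.prod_inr _, hw.prod_inr _, t2.eventually hΦ,
        (hg.eventually hΦ).prod_inr _] with y h1 h2 h3 h4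
      have h5 := ((hasDerivAt_comp_graph (u := fun r => u r + y.1 • w r) h3
        (h1.add (h2.const_smul y.1))).sub (hasDerivAt_comp_graph h4 h1)).const_smul y.1⁻¹
      have h6 : deriv (fun r => u r + y.1 • w r) y.2 = deriv u y.2 + y.1 • deriv w y.2 :=
        ((h1.differentiableAt (by simp)).hasDerivAt.add
          ((h2.differentiableAt (by simp)).hasDerivAt.const_smul y.1)).deriv
      rw [h6] at h5
      exact h5.deriv
    filter_upwards [eventually_prod_eventually_nhds (P := fun ε r' =>
      deriv (fun r => ε⁻¹ • (Φ (r, u r + ε • w r) - Φ (r, u r))) r' =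
        ε⁻¹ • (jetDeriv Φ (r', ((u r', deriv u r') + ε • (w r', deriv w r'))) -
          jetDeriv Φ (r', (u r', deriv u r')))) e1] with y hy
    rw [iteratedDeriv_succ']
    exact (Filter.EventuallyEq.iteratedDeriv_eq p hy).symm

/-- Difference quotients of `Φ (r, u r)` in the direction `w` converge smoothly. -/
theorem smoothTendsto_quotient {r : ℝ} {u w : ℝ → E} {Φ : ℝ × E → F}
    (hu : ∀ᶠ r' in 𝓝 r, ContDiffAt ℝ ∞ u r') (hw : ∀ᶠ r' in 𝓝 r, ContDiffAt ℝ ∞ w r')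
    (hΦ : ∀ᶠ q in 𝓝 (r, u r), ContDiffAt ℝ ∞ Φ q) :
    SmoothTendsto (𝓝[≠] (0 : ℝ)) (fun ε r => ε⁻¹ • (Φ (r, u r + ε • w r) - Φ (r, u r)))
      (fun r => fibreDeriv Φ (r, (u r, w r))) r where
  smooth := by
    have hg : Tendsto (fun r' => (r', u r')) (𝓝 r) (𝓝 (r, u r)) :=
      tendsto_id.prodMk_nhds hu.self_of_nhds.continuousAt.tendsto
    have t2 : Tendsto (fun y : ℝ × ℝ => (y.2, u y.2 + y.1 • w y.2)) (𝓝[≠] 0 ×ˢ 𝓝 r)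
        (𝓝 (r, u r)) := by
      have t0 : Tendsto (fun y : ℝ × ℝ => y.2) (𝓝[≠] 0 ×ˢ 𝓝 r) (𝓝 r) := tendsto_snd
      have te : Tendsto (fun y : ℝ × ℝ => y.1) (𝓝[≠] 0 ×ˢ 𝓝 r) (𝓝 0) :=
        (tendsto_fst).mono_right nhdsWithin_le_nhds
      have := (hu.self_of_nhds.continuousAt.tendsto.comp t0).add
        (te.smul (hw.self_of_nhds.continuousAt.tendsto.comp t0))
      simp only [zero_smul, add_zero] at this
      exact t0.prodMk_nhds this
    filter_upwards [hu.prod_inr _, hw.prod_inr _, t2.eventually hΦ,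
      (hg.eventually hΦ).prod_inr _] with y h1 h2 h3 h4
    exact ((ContDiffAt.comp (f := fun r => (r, u r + y.1 • w r)) y.2 h3
      (contDiffAt_id.prodMk (h1.add (h2.const_smul y.1)))).sub
      (ContDiffAt.comp (f := fun r => (r, u r)) y.2 h4 (contDiffAt_id.prodMk h1))).const_smul _
  smooth₀ := by
    have hg : Tendsto (fun r' => (r', u r')) (𝓝 r) (𝓝 (r, u r)) :=
      tendsto_id.prodMk_nhds hu.self_of_nhds.continuousAt.tendsto
    filter_upwards [hu, hw, hg.eventually hΦ] with r' h1 h2 h3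
    exact ContDiffAt.comp (f := fun r => (r, (u r, w r))) r'
      (contDiffAt_fibreDeriv (q := (r', (u r', w r'))) h3) (contDiffAt_id.prodMk (h1.prodMk h2))
  tendsto p := tendsto_iteratedDeriv_quotient p hu hw hΦ

end SmoothTendsto

end

/-! ### Isomorphisms of representing systems, and when two systems define the same loop. -/

section

variable {n : ℕ} {X : Type*} [TopologicalSpace X] {𝒪 : Orbifold n X} {m m' m'' : ℕ}

namespace LoopSystem

variable (σ : LoopSystem 𝒪 m)

theorem ξ_tendsto {i j : Fin m} {t : UnitAddCircle} (hi : t ∈ σ.I i) (hj : t ∈ σ.I j) :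
    Tendsto (σ.ξ i j t) (𝓝 (σ.γ i t)) (𝓝 (σ.γ j t)) := by
  have := (σ.ξ i j t).continuousAt (σ.ξ_source i j t ⟨hi, hj⟩)
  rwa [ContinuousAt, σ.ξ_apply i j t ⟨hi, hj⟩] at this

theorem γ_contDiffAt {i : Fin m} {r : ℝ} (hr : (r : UnitAddCircle) ∈ σ.I i) :
    ContDiffAt ℝ ∞ (fun r : ℝ => σ.γ i r) r :=
  (σ.γ_smooth i).contDiffAt ((isOpen_lift (σ.isOpen_I i)).mem_nhds hr)

theorem γ_continuousAt {i : Fin m} {t : UnitAddCircle} (ht : t ∈ σ.I i) :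
    ContinuousAt (σ.γ i) t := by
  obtain ⟨r, rfl⟩ := exists_coe_eq t
  exact continuousAt_coe_iff.2 (σ.γ_contDiffAt ht).continuousAt

theorem cocycle {i j k : Fin m} {t : UnitAddCircle} (hi : t ∈ σ.I i) (hj : t ∈ σ.I j)
    (hk : t ∈ σ.I k) : ∀ᶠ x in 𝓝 (σ.γ i t), σ.ξ j k t (σ.ξ i j t x) = σ.ξ i k t x :=
  σ.ξ_cocycle i j k t ⟨⟨hi, hj⟩, hk⟩

theorem ξ_self {i : Fin m} {t : UnitAddCircle} (hi : t ∈ σ.I i) :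
    σ.ξ i i t =ᶠ[𝓝 (σ.γ i t)] id := by
  filter_upwards [σ.cocycle hi hi hi,
    (σ.ξ_tendsto hi hi).eventually ((σ.ξ i i t).open_source.mem_nhds (σ.ξ_source i i t ⟨hi, hi⟩)),
    (σ.ξ i i t).open_source.mem_nhds (σ.ξ_source i i t ⟨hi, hi⟩)] with x h1 h2 h3
  exact (σ.ξ i i t).injOn h2 h3 h1

theorem mem_nhds_I {i : Fin m} {t : UnitAddCircle} (ht : t ∈ σ.I i) : σ.I i ∈ 𝓝 t :=
  (σ.isOpen_I i).mem_nhds ht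

end LoopSystem

theorem germ_symm {E F : Type*} [TopologicalSpace E] [TopologicalSpace F]
    {φ ψ : OpenPartialHomeomorph E F} {x : E} (hφ : x ∈ φ.source) (hψ : x ∈ ψ.source)
    (h : φ =ᶠ[𝓝 x] ψ) : φ.symm =ᶠ[𝓝 (φ x)] ψ.symm := by
  have ht : Tendsto φ.symm (𝓝 (φ x)) (𝓝 x) := by
    have := φ.symm.continuousAt (φ.map_source hφ)
    rwa [ContinuousAt, φ.left_inv hφ] at this
  filter_upwards [φ.open_target.mem_nhds (φ.map_source hφ), ht.eventually h,
    ht.eventually (ψ.open_source.mem_nhds hψ)] with y h1 h2 h3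
  rw [φ.right_inv h1] at h2
  rw [h2, ψ.left_inv h3, ← h2]

/-- An isomorphism between the morphisms from the circle defined by two representing systems:
a germ of a transition map from `γ_i(t)` to the corresponding point of the other system, for all
indices `i`, `l` and `t`, locally constant and compatible with the transition maps. -/
structure SysHom (σ : LoopSystem 𝒪 m) (τ : LoopSystem 𝒪 m') where
  b : Fin m → Fin m' → UnitAddCircle → OpenPartialHomeomorph (Model n) (Model n)
  transition : ∀ {i l t}, t ∈ σ.I i → t ∈ τ.I l →
    IsTransition (𝒪.chart (σ.U i)) (𝒪.chart (τ.U l)) (b i l t)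
  source : ∀ {i l t}, t ∈ σ.I i → t ∈ τ.I l → σ.γ i t ∈ (b i l t).source
  apply : ∀ {i l t}, t ∈ σ.I i → t ∈ τ.I l → b i l t (σ.γ i t) = τ.γ l t
  locConst : ∀ {i l t}, t ∈ σ.I i → t ∈ τ.I l →
    ∀ᶠ t' in 𝓝 t, b i l t' =ᶠ[𝓝 (σ.γ i t')] b i l t
  compat : ∀ {i i' l l' t}, t ∈ σ.I i → t ∈ σ.I i' → t ∈ τ.I l → t ∈ τ.I l' →
    ∀ᶠ x in 𝓝 (σ.γ i t), b i' l' t (σ.ξ i i' t x) = τ.ξ l l' t (b i l t x)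

/-- Transition maps over the members of an open cover of the circle that define an isomorphism
between two representing systems. -/
structure Patches (σ : LoopSystem 𝒪 m) (τ : LoopSystem 𝒪 m') (C : Type*) where
  N : C → Set UnitAddCircle
  isOpen_N : ∀ c, IsOpen (N c)
  cover : ∀ t, ∃ c, t ∈ N c
  i : C → Fin m
  l : C → Fin m'
  sub_left : ∀ c, N c ⊆ σ.I (i c)
  sub_right : ∀ c, N c ⊆ τ.I (l c)
  β : C → OpenPartialHomeomorph (Model n) (Model n)
  transition : ∀ c, IsTransition (𝒪.chart (σ.U (i c))) (𝒪.chart (τ.U (l c))) (β c)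
  source : ∀ c, ∀ t ∈ N c, σ.γ (i c) t ∈ (β c).source
  apply : ∀ c, ∀ t ∈ N c, β c (σ.γ (i c) t) = τ.γ (l c) t
  compat : ∀ c d, ∀ t ∈ N c, t ∈ N d → ∀ᶠ x in 𝓝 (σ.γ (i c) t),
    β d (σ.ξ (i c) (i d) t x) = τ.ξ (l c) (l d) t (β c x)

namespace Patches

variable {σ : LoopSystem 𝒪 m} {τ : LoopSystem 𝒪 m'} {C : Type*} (p : Patches σ τ C)

def at' (t : UnitAddCircle) : C := (p.cover t).choose

theorem mem_at (t : UnitAddCircle) : t ∈ p.N (p.at' t) := (p.cover t).choose_spec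

theorem β_tendsto {c : C} {t : UnitAddCircle} (ht : t ∈ p.N c) :
    Tendsto (p.β c) (𝓝 (σ.γ (p.i c) t)) (𝓝 (τ.γ (p.l c) t)) := by
  have := (p.β c).continuousAt (p.source c t ht)
  rwa [ContinuousAt, p.apply c t ht] at this

def homMap (c : C) (i : Fin m) (l : Fin m') (t : UnitAddCircle) :
    OpenPartialHomeomorph (Model n) (Model n) :=
  ((σ.ξ i (p.i c) t).trans (p.β c)).trans (τ.ξ (p.l c) l t)

theorem homMap_apply (c : C) (i : Fin m) (l : Fin m') (t : UnitAddCircle) (x : Model n) :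
    p.homMap c i l t x = τ.ξ (p.l c) l t (p.β c (σ.ξ i (p.i c) t x)) := rfl

/-- Compatibility of patches makes the extended germ independent of the patch. So the arbitrary
choice of a patch at each point in `toHom` is harmless, and the result is locally constant in `t`.
-/
theorem homMap_germ {c d : C} {i : Fin m} {l : Fin m'} {t : UnitAddCircle} (hc : t ∈ p.N c)
    (hd : t ∈ p.N d) (hi : t ∈ σ.I i) (hl : t ∈ τ.I l) :
    p.homMap d i l t =ᶠ[𝓝 (σ.γ i t)] p.homMap c i l t := by
  have hic := p.sub_left c hc
  have hlc := p.sub_right c hc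
  filter_upwards [σ.cocycle hi hic (p.sub_left d hd),
    (σ.ξ_tendsto hi hic).eventually (p.compat c d t hc hd),
    ((p.β_tendsto hc).comp (σ.ξ_tendsto hi hic)).eventually
      (τ.cocycle hlc (p.sub_right d hd) hl)] with x h1 h2 h3
  rw [homMap_apply, homMap_apply, ← h1, h2]
  exact h3

/-- The isomorphism of representing systems defined by patches. -/
def toHom : SysHom σ τ where
  b i l t := p.homMap (p.at' t) i l t
  transition := fun {i l t} hi hl =>
    (((σ.ξ_transition _ _ t ⟨hi, p.sub_left _ (p.mem_at t)⟩).trans (p.transition _)).trans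
      (τ.ξ_transition _ _ t ⟨p.sub_right _ (p.mem_at t), hl⟩))
  source := fun {i l t} hi hl => by
    have hic := p.sub_left _ (p.mem_at t)
    have hlc := p.sub_right _ (p.mem_at t)
    simp only [homMap, OpenPartialHomeomorph.trans_source, mem_inter_iff, mem_preimage,
      OpenPartialHomeomorph.coe_trans, Function.comp]
    rw [σ.ξ_apply _ _ t ⟨hi, hic⟩, p.apply _ t (p.mem_at t)]
    exact ⟨⟨σ.ξ_source _ _ t ⟨hi, hic⟩, p.source _ t (p.mem_at t)⟩, τ.ξ_source _ _ t ⟨hlc, hl⟩⟩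
  apply := fun {i l t} hi hl => by
    have hic := p.sub_left _ (p.mem_at t)
    have hlc := p.sub_right _ (p.mem_at t)
    rw [homMap_apply, σ.ξ_apply _ _ t ⟨hi, hic⟩, p.apply _ t (p.mem_at t),
      τ.ξ_apply _ _ t ⟨hlc, hl⟩]
  locConst := fun {i l t} hi hl => by
    have hc := p.mem_at t
    filter_upwards [(p.isOpen_N _).mem_nhds hc, σ.mem_nhds_I hi, τ.mem_nhds_I hl,
      σ.ξ_locConst i _ t ⟨hi, p.sub_left _ hc⟩, τ.ξ_locConst _ l t ⟨p.sub_right _ hc, hl⟩]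
      with t' h1 h2 h3 h4 h5
    refine (p.homMap_germ h1 (p.mem_at t') h2 h3).trans ?_
    exact Eventually.of_forall fun x => by rw [homMap_apply, homMap_apply, h4, h5]
  compat := fun {i i' l l' t} hi hi' hl hl' => by
    have hc := p.mem_at t
    have hic := p.sub_left _ hc
    have hlc := p.sub_right _ hc
    filter_upwards [σ.cocycle hi hi' hic, ((p.β_tendsto hc).comp (σ.ξ_tendsto hi hic)).eventually
      (τ.cocycle hlc hl hl')] with x h1 h2
    rw [homMap_apply, homMap_apply, h1]
    exact h2.symm

theorem toHom_germ {c : C} {t : UnitAddCircle} (hc : t ∈ p.N c) :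
    p.toHom.b (p.i c) (p.l c) t =ᶠ[𝓝 (σ.γ (p.i c) t)] p.β c := by
  have hic := p.sub_left c hc
  have hlc := p.sub_right c hc
  refine (p.homMap_germ hc (p.mem_at t) hic hlc).trans ?_
  filter_upwards [σ.ξ_self hic, (p.β_tendsto hc).eventually (τ.ξ_self hlc)] with x h1 h2
  rw [homMap_apply, h1, id, h2, id]

end Patches

namespace SysHom

variable {σ : LoopSystem 𝒪 m} {τ : LoopSystem 𝒪 m'} {υ : LoopSystem 𝒪 m''}

theorem b_tendsto (f : SysHom σ τ) {i : Fin m} {l : Fin m'} {t : UnitAddCircle} (hi : t ∈ σ.I i)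
    (hl : t ∈ τ.I l) : Tendsto (f.b i l t) (𝓝 (σ.γ i t)) (𝓝 (τ.γ l t)) := by
  have := (f.b i l t).continuousAt (f.source hi hl)
  rwa [ContinuousAt, f.apply hi hl] at this

/-- The open set over which the germ at `t` of an isomorphism gives all germs. -/
def nhd (f : SysHom σ τ) (i : Fin m) (l : Fin m') (t : UnitAddCircle) : Set UnitAddCircle :=
  interior {t' | t' ∈ σ.I i ∧ t' ∈ τ.I l ∧ σ.γ i t' ∈ (f.b i l t).source ∧
    f.b i l t' =ᶠ[𝓝 (σ.γ i t')] f.b i l t}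

theorem mem_nhd (f : SysHom σ τ) {i : Fin m} {l : Fin m'} {t : UnitAddCircle} (hi : t ∈ σ.I i)
    (hl : t ∈ τ.I l) : t ∈ f.nhd i l t := by
  refine mem_interior_iff_mem_nhds.2 ?_
  filter_upwards [σ.mem_nhds_I hi, τ.mem_nhds_I hl, f.locConst hi hl,
    (σ.γ_continuousAt hi).tendsto.eventually ((f.b i l t).open_source.mem_nhds (f.source hi hl))]
    with t' h1 h2 h3 h4 using ⟨h1, h2, h4, h3⟩

/-- The patches of an isomorphism over points `t c` with indices `i c`, `l c`. -/
def patches (f : SysHom σ τ) {C : Type*} (i : C → Fin m) (l : C → Fin m') (t : C → UnitAddCircle)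
    (hi : ∀ c, t c ∈ σ.I (i c)) (hl : ∀ c, t c ∈ τ.I (l c)) (N : C → Set UnitAddCircle)
    (hN : ∀ c, IsOpen (N c)) (hsub : ∀ c, N c ⊆ f.nhd (i c) (l c) (t c))
    (hcov : ∀ s, ∃ c, s ∈ N c) : Patches σ τ C where
  N := N
  isOpen_N := hN
  cover := hcov
  i := i
  l := l
  sub_left c s hs := (interior_subset (hsub c hs)).1
  sub_right c s hs := (interior_subset (hsub c hs)).2.1
  β c := f.b (i c) (l c) (t c)
  transition c := f.transition (hi c) (hl c)
  source c s hs := (interior_subset (hsub c hs)).2.2.1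
  apply c s hs := by
    have h := interior_subset (hsub c hs)
    rw [← h.2.2.2.self_of_nhds, f.apply h.1 h.2.1]
  compat c d s hc hd := by
    have h := interior_subset (hsub c hc)
    have h' := interior_subset (hsub d hd)
    filter_upwards [f.compat h.1 h'.1 h.2.1 h'.2.1, h.2.2.2,
      (σ.ξ_tendsto h.1 h'.1).eventually h'.2.2.2] with x h1 h2 h3
    rw [← h3, h1, h2]

/-- The identity isomorphism. -/
def refl (σ : LoopSystem 𝒪 m) : SysHom σ σ where
  b := σ.ξ
  transition hi hl := σ.ξ_transition _ _ _ ⟨hi, hl⟩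
  source hi hl := σ.ξ_source _ _ _ ⟨hi, hl⟩
  apply hi hl := σ.ξ_apply _ _ _ ⟨hi, hl⟩
  locConst hi hl := (σ.ξ_locConst _ _ _ ⟨hi, hl⟩).mono fun _ h => by rw [h]
  compat hi hi' hl hl' := by
    filter_upwards [σ.cocycle hi hi' hl', σ.cocycle hi hl hl'] with x h1 h2
    rw [h1, h2]

/-- The inverse isomorphism. -/
def symm (f : SysHom σ τ) : SysHom τ σ where
  b l i t := (f.b i l t).symm
  transition hl hi := (f.transition hi hl).symm
  source hl hi := by
    rw [← f.apply hi hl]; exact (f.b _ _ _).map_source (f.source hi hl)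
  apply hl hi := by
    rw [← f.apply hi hl]; exact (f.b _ _ _).left_inv (f.source hi hl)
  locConst {l i t} hl hi := by
    filter_upwards [isOpen_interior.mem_nhds (f.mem_nhd hi hl)] with t' ht'
    obtain ⟨h1, h2, h3, h4⟩ := interior_subset ht'
    have := germ_symm (f.source h1 h2) h3 h4
    rwa [f.apply h1 h2] at this
  compat {l l' i i' t} hl hl' hi hi' := by
    have ht : Tendsto (f.b i l t).symm (𝓝 (τ.γ l t)) (𝓝 (σ.γ i t)) := by
      have := (f.b i l t).symm.continuousAt ((f.b i l t).map_source (f.source hi hl))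
      rw [f.apply hi hl] at this
      rw [ContinuousAt, ← f.apply hi hl, (f.b i l t).left_inv (f.source hi hl),
        f.apply hi hl] at this
      exact this
    have hm := (f.b i l t).map_source (f.source hi hl)
    rw [f.apply hi hl] at hm
    filter_upwards [(f.b i l t).open_target.mem_nhds hm, ht.eventually (f.compat hi hi' hl hl'),
      ((σ.ξ_tendsto hi hi').comp ht).eventually
        ((f.b i' l' t).open_source.mem_nhds (f.source hi' hl'))] with y h1 h2 h3
    rw [(f.b i l t).right_inv h1] at h2
    rw [← h2]
    exact (f.b i' l' t).left_inv h3

/-- The composition of isomorphisms. -/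
def trans (f : SysHom σ τ) (g : SysHom τ υ) : SysHom σ υ :=
  Patches.toHom (C := UnitAddCircle)
    -- Each point of the circle contributes one patch, composed through an arbitrary trivialization
    -- of the middle system. The patches agree because both factors satisfy their own compatibility.
    { N := fun t => f.nhd (σ.indexAt t) (τ.indexAt t) t ∩ g.nhd (τ.indexAt t) (υ.indexAt t) t
      isOpen_N := fun t => isOpen_interior.inter isOpen_interior
      cover := fun t => ⟨t, f.mem_nhd (σ.cover t).choose_spec (τ.cover t).choose_spec,
        g.mem_nhd (τ.cover t).choose_spec (υ.cover t).choose_spec⟩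
      i := σ.indexAt
      l := υ.indexAt
      sub_left := fun t s hs => (interior_subset hs.1).1
      sub_right := fun t s hs => (interior_subset hs.2).2.1
      β := fun t => (f.b (σ.indexAt t) (τ.indexAt t) t).trans (g.b (τ.indexAt t) (υ.indexAt t) t)
      transition := fun t => (f.transition (σ.cover t).choose_spec (τ.cover t).choose_spec).trans
        (g.transition (τ.cover t).choose_spec (υ.cover t).choose_spec)
      source := fun t s hs => by
        obtain ⟨h1, h2, h3, h4⟩ := interior_subset hs.1
        obtain ⟨k1, k2, k3, k4⟩ := interior_subset hs.2
        simp only [OpenPartialHomeomorph.trans_source, mem_inter_iff, mem_preimage]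
        rw [← h4.self_of_nhds, f.apply h1 h2]
        exact ⟨h3, k3⟩
      apply := fun t s hs => by
        obtain ⟨h1, h2, h3, h4⟩ := interior_subset hs.1
        obtain ⟨k1, k2, k3, k4⟩ := interior_subset hs.2
        rw [OpenPartialHomeomorph.coe_trans, Function.comp, ← h4.self_of_nhds, f.apply h1 h2,
          ← k4.self_of_nhds, g.apply k1 k2]
      compat := fun c d s hs hs' => by
        obtain ⟨h1, h2, h3, h4⟩ := interior_subset hs.1
        obtain ⟨k1, k2, k3, k4⟩ := interior_subset hs.2
        obtain ⟨h1', h2', h3', h4'⟩ := interior_subset hs'.1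
        obtain ⟨k1', k2', k3', k4'⟩ := interior_subset hs'.2
        filter_upwards [h4, (f.b_tendsto h1 h2).eventually k4,
          (σ.ξ_tendsto h1 h1').eventually h4',
          ((f.b_tendsto h1' h2').comp (σ.ξ_tendsto h1 h1')).eventually k4',
          f.compat h1 h1' h2 h2', (f.b_tendsto h1 h2).eventually (g.compat k1 k1' k2 k2')]
          with x e1 e2 e3 e4 e5 e6
        simp only [OpenPartialHomeomorph.coe_trans, Function.comp] at e4 ⊢
        rw [← e3, ← e1, ← e2, ← e6, ← e5, e4] }

theorem of_refines {ρ : LoopSystem 𝒪 m''} (h : ρ.Refines σ) : Nonempty (SysHom ρ σ) := by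
  obtain ⟨θ, ι, h1, h2, h3, h4⟩ := h
  exact ⟨Patches.toHom (C := Fin m'')
    { N := ρ.I
      isOpen_N := ρ.isOpen_I
      cover := ρ.cover
      i := id
      l := θ
      sub_left := fun _ => subset_rfl
      sub_right := h1
      β := ι
      transition := h2
      source := fun c t ht => (h3 c t ht).1
      apply := fun c t ht => (h3 c t ht).2
      compat := fun c d t hc hd => (h4 c d t ⟨hc, hd⟩).mono fun x hx => hx.symm }⟩

/-- By compactness finitely many connected sets cover the circle on each of which the isomorphism is
a single transition map; these maps are exactly the data of a refinement. -/
theorem exists_refinement (f : SysHom σ τ) :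
    ∃ (q : ℕ) (ρ : LoopSystem 𝒪 q), ρ.Refines σ ∧ ρ.Refines τ := by
  have hnb : ∀ t, ∃ N, IsOpen N ∧ IsConnected N ∧ t ∈ N ∧
      closure N ⊆ f.nhd (σ.indexAt t) (τ.indexAt t) t := fun t =>
    exists_connected_nhd isOpen_interior
      (f.mem_nhd (σ.cover t).choose_spec (τ.cover t).choose_spec)
  choose N n1 n2 n3 n4 using hnb
  obtain ⟨F, hF⟩ := isCompact_univ.elim_nhds_subcover N (fun t _ => (n1 t).mem_nhds (n3 t))
  let e := F.equivFin
  let c : Fin F.card → UnitAddCircle := fun k => (e.symm k : UnitAddCircle)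
  let i : Fin F.card → Fin m := fun k => σ.indexAt (c k)
  let l : Fin F.card → Fin m' := fun k => τ.indexAt (c k)
  have hsub : ∀ k, N (c k) ⊆ f.nhd (i k) (l k) (c k) := fun k => subset_closure.trans (n4 _)
  have hcov : ∀ t, ∃ k, t ∈ N (c k) := by
    intro t
    obtain ⟨s, hs, hst⟩ := mem_iUnion₂.1 (hF.2 (mem_univ t))
    exact ⟨e ⟨s, hs⟩, by simpa [c] using hst⟩
  let p := f.patches i l c (fun k => (σ.cover _).choose_spec) (fun k => (τ.cover _).choose_spec)
    (fun k => N (c k)) (fun k => n1 _) hsub hcov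
  -- The restriction of `σ` to the small sets: it refines `σ` through identity maps and `τ` through
  -- the patches of `f`.
  let ρ : LoopSystem 𝒪 F.card :=
    { I := fun k => N (c k)
      isOpen_I := fun k => n1 _
      isConnected_I := fun k => n2 _
      cover := hcov
      U := fun k => σ.U (i k)
      γ := fun k => σ.γ (i k)
      γ_mem := fun k t ht => σ.γ_mem _ t (p.sub_left k ht)
      γ_smooth := fun k => (σ.γ_smooth (i k)).mono fun r hr => p.sub_left k hr
      ξ := fun k k' => σ.ξ (i k) (i k')
      ξ_transition := fun k k' t ht => σ.ξ_transition _ _ t ⟨p.sub_left k ht.1, p.sub_left k' ht.2⟩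
      ξ_locConst := fun k k' t ht => σ.ξ_locConst _ _ t ⟨p.sub_left k ht.1, p.sub_left k' ht.2⟩
      ξ_source := fun k k' t ht => σ.ξ_source _ _ t ⟨p.sub_left k ht.1, p.sub_left k' ht.2⟩
      ξ_apply := fun k k' t ht => σ.ξ_apply _ _ t ⟨p.sub_left k ht.1, p.sub_left k' ht.2⟩
      ξ_cocycle := fun k k' k'' t ht => σ.ξ_cocycle _ _ _ t
        ⟨⟨p.sub_left k ht.1.1, p.sub_left k' ht.1.2⟩, p.sub_left k'' ht.2⟩ }
  refine ⟨F.card, ρ, ⟨i, fun k => OpenPartialHomeomorph.ofSet (𝒪.chart (σ.U (i k))).V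
    (𝒪.chart (σ.U (i k))).isOpen_V, p.sub_left, fun k => IsTransition.ofSet _,
    fun k t ht => ⟨σ.γ_mem _ t (p.sub_left k ht), rfl⟩,
    fun k k' t ht => Eventually.of_forall fun x => rfl⟩,
    ⟨l, p.β, p.sub_right, p.transition, fun k t ht => ⟨p.source k t ht, p.apply k t ht⟩,
    fun k k' t ht => (p.compat k k' t ht.1 ht.2).mono fun x hx => hx.symm⟩⟩

end SysHom

/-- Two representing systems define the same free loop if and only if they are isomorphic. -/
theorem loop_eq_iff {σ : LoopSystem 𝒪 m} {τ : LoopSystem 𝒪 m'} :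
    σ.loop = τ.loop ↔ Nonempty (SysHom σ τ) := by
  constructor
  · intro h
    -- Equality in the quotient only gives the generated equivalence relation. Isomorphism is
    -- reflexive, symmetric and transitive, so it absorbs the closure.
    have h1 : ∀ a b : Σ m, LoopSystem 𝒪 m, Relation.EqvGen LoopSystem.Equivalent a b →
        Nonempty (SysHom a.2 b.2) := by
      intro a b hab
      induction hab with
      | rel a b h =>
        obtain ⟨q, ρ, r1, r2⟩ := h
        obtain ⟨f⟩ := SysHom.of_refines r1
        obtain ⟨g⟩ := SysHom.of_refines r2
        exact ⟨f.symm.trans g⟩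
      | refl a => exact ⟨SysHom.refl _⟩
      | symm a b _ ih => exact ih.map SysHom.symm
      | trans a b c _ _ ih ih' => exact ih.elim fun f => ih'.map fun g => f.trans g
    exact h1 ⟨m, σ⟩ ⟨m', τ⟩ (Quot.eqvGen_exact h)
  · rintro ⟨f⟩
    obtain ⟨q, ρ, r1, r2⟩ := f.exists_refinement
    exact Quot.sound ⟨q, ρ, r1, r2⟩

theorem exists_loop_eq (l : SmoothLoop 𝒪) : ∃ (m : ℕ) (σ : LoopSystem 𝒪 m), σ.loop = l := by
  obtain ⟨⟨m, σ⟩, rfl⟩ := Quot.exists_rep l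
  exact ⟨m, σ, rfl⟩

end

/-! ### The topological vector space of sections. -/

section

section SmoothTendstoMore

variable {α : Type*} {E F : Type*} [NormedAddCommGroup E] [NormedSpace ℝ E]
  [NormedAddCommGroup F] [NormedSpace ℝ F] {𝓕 : Filter α} {r : ℝ}

theorem SmoothTendsto.param {f : α → E} {c : E} (hf : Tendsto f 𝓕 (𝓝 c)) :
    SmoothTendsto 𝓕 (fun a _ => f a) (fun _ => c) r where
  smooth := Eventually.of_forall fun _ => contDiffAt_const
  smooth₀ := Eventually.of_forall fun _ => contDiffAt_const
  tendsto p := by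
    simp only [iteratedDeriv_const]
    split_ifs
    · exact hf.comp tendsto_fst
    · exact tendsto_const_nhds

theorem SmoothTendsto.tendsto_circle {u : α → UnitAddCircle → E} {u₀ : UnitAddCircle → E}
    (h : SmoothTendsto 𝓕 (fun a r => u a r) (fun r => u₀ r) r) :
    Tendsto (fun y : α × UnitAddCircle => (y.2, u y.1 y.2)) (𝓕 ×ˢ 𝓝 (r : UnitAddCircle))
      (𝓝 ((r : UnitAddCircle), u₀ r)) := by
  have h1 : 𝓕 ×ˢ 𝓝 (r : UnitAddCircle) =
      map (fun y : α × ℝ => (y.1, (y.2 : UnitAddCircle))) (𝓕 ×ˢ 𝓝 r) := by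
    rw [← map_coe_nhds, ← map_id (f := 𝓕), prod_map_map_eq, map_id]; rfl
  rw [h1, tendsto_map'_iff]
  exact ((continuous_circle_coe.tendsto r).comp tendsto_snd).prodMk_nhds h.tendsto_zero

end SmoothTendstoMore

variable {n : ℕ} {X : Type*} [TopologicalSpace X] {𝒪 : Orbifold n X} {m m' : ℕ}

namespace LoopSystem

variable (σ : LoopSystem 𝒪 m)

theorem coordChange_comp {i j k : Fin m} {t : UnitAddCircle} (hi : t ∈ σ.I i) (hj : t ∈ σ.I j)
    (hk : t ∈ σ.I k) (v : Model n) :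
    σ.coordChange j k t (σ.coordChange i j t v) = σ.coordChange i k t v := by
  have h : σ.ξ j k t ∘ σ.ξ i j t =ᶠ[𝓝 (σ.γ i t)] σ.ξ i k t := σ.cocycle hi hj hk
  have h1 := (σ.ξ_transition i j t ⟨hi, hj⟩).differentiableAt (σ.ξ_source i j t ⟨hi, hj⟩)
  have h2 := (σ.ξ_transition j k t ⟨hj, hk⟩).differentiableAt (σ.ξ_source j k t ⟨hj, hk⟩)
  rw [coordChange, coordChange, coordChange, ← h.fderiv_eq,
    fderiv_comp _ (by rwa [σ.ξ_apply i j t ⟨hi, hj⟩]) h1, σ.ξ_apply i j t ⟨hi, hj⟩]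
  rfl

theorem coordChange_self {i : Fin m} {t : UnitAddCircle} (hi : t ∈ σ.I i) (v : Model n) :
    σ.coordChange i i t v = v := by
  rw [coordChange, (σ.ξ_self hi).fderiv_eq, fderiv_id]; rfl

theorem coordChange_inv {i j : Fin m} {t : UnitAddCircle} (hi : t ∈ σ.I i) (hj : t ∈ σ.I j)
    (v : Model n) : σ.coordChange j i t (σ.coordChange i j t v) = v := by
  rw [σ.coordChange_comp hi hj hi, σ.coordChange_self hi]

theorem coordChange_contDiffAt {i j : Fin m} {r : ℝ} (hi : (r : UnitAddCircle) ∈ σ.I i)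
    (hj : (r : UnitAddCircle) ∈ σ.I j) :
    ContDiffAt ℝ ∞ (fun r : ℝ => σ.coordChange i j r) r := by
  have h1 : ContDiffAt ℝ ∞ (fun r' : ℝ => fderiv ℝ (σ.ξ i j r) (σ.γ i r')) r :=
    ContDiffAt.comp (f := fun r' : ℝ => σ.γ i r') r
      (((σ.ξ_transition i j r ⟨hi, hj⟩).contDiffAt
        (σ.ξ_source i j r ⟨hi, hj⟩)).fderiv_right (m := ∞) (by simp)) (σ.γ_contDiffAt hi)
  refine h1.congr_of_eventuallyEq ?_
  filter_upwards [eventually_coe.1 (σ.ξ_locConst i j r ⟨hi, hj⟩)] with r' hr'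
  rw [coordChange, hr']

theorem indexAt_mem (t : UnitAddCircle) : t ∈ σ.I (σ.indexAt t) := (σ.cover t).choose_spec

theorem eventually_mem_I {i : Fin m} {r : ℝ} (hi : (r : UnitAddCircle) ∈ σ.I i) :
    ∀ᶠ r' : ℝ in 𝓝 r, (r' : UnitAddCircle) ∈ σ.I i :=
  (isOpen_lift (σ.isOpen_I i)).mem_nhds hi

namespace Section

variable {σ}

theorem ext' {s s' : σ.Section} (h : ∀ i, ∀ t ∈ σ.I i, s.comp i t = s'.comp i t) : s = s' := by
  apply Subtype.ext
  funext i t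
  by_cases ht : t ∈ σ.I i
  · exact h i t ht
  · exact (s.2.1 i t ht).trans (s'.2.1 i t ht).symm

theorem comp_zero_outside (s : σ.Section) {i : Fin m} {t : UnitAddCircle} (ht : t ∉ σ.I i) :
    s.comp i t = 0 := s.2.1 i t ht

theorem contDiffAt (s : σ.Section) {i : Fin m} {r : ℝ} (hr : (r : UnitAddCircle) ∈ σ.I i) :
    ContDiffAt ℝ ∞ (fun r : ℝ => s.comp i r) r :=
  (s.2.2.1 i).contDiffAt ((isOpen_lift (σ.isOpen_I i)).mem_nhds hr)

theorem eventually_contDiffAt (s : σ.Section) {i : Fin m} {r : ℝ}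
    (hr : (r : UnitAddCircle) ∈ σ.I i) :
    ∀ᶠ r' in 𝓝 r, ContDiffAt ℝ ∞ (fun r : ℝ => s.comp i r) r' :=
  (σ.eventually_mem_I hr).mono fun _ h => s.contDiffAt h

theorem comp_eq (s : σ.Section) {i j : Fin m} {t : UnitAddCircle} (hi : t ∈ σ.I i)
    (hj : t ∈ σ.I j) : s.comp j t = σ.coordChange i j t (s.comp i t) :=
  s.2.2.2 i j t ⟨hi, hj⟩

@[simp] theorem comp_add (s s' : σ.Section) (i : Fin m) (t : UnitAddCircle) :
    (s + s').comp i t = s.comp i t + s'.comp i t := rfl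
@[simp] theorem comp_smul (c : ℝ) (s : σ.Section) (i : Fin m) (t : UnitAddCircle) :
    (c • s).comp i t = c • s.comp i t := rfl
@[simp] theorem comp_zero (i : Fin m) (t : UnitAddCircle) :
    (0 : σ.Section).comp i t = 0 := rfl

theorem contDiffAt_circleDeriv (s : σ.Section) {i : Fin m} {r : ℝ}
    (hr : (r : UnitAddCircle) ∈ σ.I i) (p : ℕ) :
    ContinuousAt (circleDeriv p (s.comp i)) r := by
  have := (SmoothTendsto.const (𝓕 := (⊤ : Filter Unit)) (s.eventually_contDiffAt hr)).tendsto p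
  exact (this.comp (tendsto_top.prodMk tendsto_id : Tendsto (fun r : ℝ => ((), r)) (𝓝 r) _))

theorem tendsto_iff_locally {α : Type*} {𝓕 : Filter α} {u : α → σ.Section} {s : σ.Section} :
    Tendsto u 𝓕 (𝓝 s) ↔ ∀ i p, TendstoLocallyUniformlyOn
      (fun a => circleDeriv p ((u a).comp i)) (circleDeriv p (s.comp i)) 𝓕 (lift (σ.I i)) := by
  have e : 𝓝 s = ⨅ (i : Fin m) (p : ℕ), comap
      (fun s : σ.Section => UniformOnFun.ofFun {K : Set ℝ | IsCompact K ∧ K ⊆ lift (σ.I i)}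
        (circleDeriv p (s.comp i))) (𝓝 (UniformOnFun.ofFun _ (circleDeriv p (s.comp i)))) := by
    rw [nhds_iInf]
    simp_rw [nhds_iInf, nhds_induced]
  rw [e]
  simp only [tendsto_iInf, tendsto_comap_iff, UniformOnFun.tendsto_iff_tendstoUniformlyOn]
  refine forall₂_congr fun i p => ?_
  rw [tendstoLocallyUniformlyOn_iff_forall_isCompact (isOpen_lift (σ.isOpen_I i))]
  exact ⟨fun h K hK hKc => h K ⟨hKc, hK⟩, fun h K hK => h K hK.2 hK.1⟩

/-- The derivatives of the limit are continuous, so locally uniform convergence is the same as joint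
convergence in parameter and point. Every topological question about sections is afterwards treated
through `SmoothTendsto`. -/
theorem tendsto_iff {α : Type*} {𝓕 : Filter α} {u : α → σ.Section} {s : σ.Section} :
    Tendsto u 𝓕 (𝓝 s) ↔ ∀ i (r : ℝ), (r : UnitAddCircle) ∈ σ.I i →
      SmoothTendsto 𝓕 (fun a (r : ℝ) => (u a).comp i r) (fun r : ℝ => s.comp i r) r := by
  rw [tendsto_iff_locally]
  have key : ∀ i p (r : ℝ), (r : UnitAddCircle) ∈ σ.I i →
      (Tendsto (fun y : α × ℝ => (circleDeriv p (s.comp i) y.2,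
        circleDeriv p ((u y.1).comp i) y.2)) (𝓕 ×ˢ 𝓝 r) (uniformity _) ↔
      Tendsto (fun y : α × ℝ => circleDeriv p ((u y.1).comp i) y.2) (𝓕 ×ˢ 𝓝 r)
        (𝓝 (circleDeriv p (s.comp i) r))) := by
    intro i p r hr
    have h1 : Tendsto (fun y : α × ℝ => circleDeriv p (s.comp i) y.2) (𝓕 ×ˢ 𝓝 r)
        (𝓝 (circleDeriv p (s.comp i) r)) := (s.contDiffAt_circleDeriv hr p).tendsto.comp tendsto_snd
    rw [tendsto_uniformity_iff_dist_tendsto_zero]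
    constructor
    · intro h
      exact (tendsto_iff_of_dist h).1 h1
    · intro h
      simpa using h1.dist h
  constructor
  · intro h i r hr
    refine ⟨((σ.eventually_mem_I hr).prod_inr _).mono fun y hy => (u y.1).contDiffAt hy,
      s.eventually_contDiffAt hr, fun p => ?_⟩
    exact (key i p r hr).1
      ((isOpen_lift (σ.isOpen_I i)).tendstoLocallyUniformlyOn_iff_forall_tendsto.1 (h i p) r hr)
  · intro h i p
    rw [(isOpen_lift (σ.isOpen_I i)).tendstoLocallyUniformlyOn_iff_forall_tendsto]
    exact fun r hr => (key i p r hr).2 ((h i r hr).tendsto p)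

theorem smoothTendsto_nhds (s : σ.Section) {i : Fin m} {r : ℝ} (hr : (r : UnitAddCircle) ∈ σ.I i) :
    SmoothTendsto (𝓝 s) (fun (a : σ.Section) (r : ℝ) => a.comp i r) (fun r : ℝ => s.comp i r) r :=
  tendsto_iff.1 (tendsto_id (x := 𝓝 s)) i r hr

/-- If the graph of `s` over a compact set lies in an open condition, so do the graphs of all
sections near `s`. -/
theorem eventually_forall (s : σ.Section) {i : Fin m} {C : Set UnitAddCircle} (hC : IsCompact C)
    (hCI : C ⊆ σ.I i) {P : UnitAddCircle → Model n → Prop}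
    (hP : ∀ t ∈ C, ∀ᶠ q in 𝓝 (t, s.comp i t), P q.1 q.2) :
    ∀ᶠ s' in 𝓝 s, ∀ t ∈ C, P t (s'.comp i t) := by
  refine hC.eventually_forall_prod (P := fun (s' : σ.Section) t => P t (s'.comp i t)) fun t ht => ?_
  obtain ⟨r, rfl⟩ := exists_coe_eq t
  exact (s.smoothTendsto_nhds (hCI ht)).tendsto_circle.eventually (hP _ ht)

end Section

instance : ContinuousAdd σ.Section where
  continuous_add := continuous_iff_continuousAt.2 fun q => by
    refine Section.tendsto_iff.2 fun i r hr => ?_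
    have h1 := (q.1.smoothTendsto_nhds hr).comp_tendsto (continuous_fst.tendsto q)
    have h2 := (q.2.smoothTendsto_nhds hr).comp_tendsto (continuous_snd.tendsto q)
    exact (h1.prodMk h2).comp (Φ := fun p : ℝ × (Model n × Model n) => p.2.1 + p.2.2)
      (Eventually.of_forall fun p => by fun_prop)

instance : ContinuousSMul ℝ σ.Section where
  continuous_smul := continuous_iff_continuousAt.2 fun q => by
    refine Section.tendsto_iff.2 fun i r hr => ?_
    have h1 : SmoothTendsto (𝓝 q) (fun (a : ℝ × σ.Section) (_ : ℝ) => a.1) (fun _ => q.1) r :=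
      SmoothTendsto.param (continuous_fst.tendsto q)
    have h2 := (q.2.smoothTendsto_nhds hr).comp_tendsto (continuous_snd.tendsto q)
    exact (h1.prodMk h2).comp (Φ := fun p : ℝ × (ℝ × Model n) => p.2.1 • p.2.2)
      (Eventually.of_forall fun p => by fun_prop)

instance : IsTopologicalAddGroup σ.Section where
  continuous_neg := by
    have : (fun s : σ.Section => -s) = fun s => (-1 : ℝ) • s := by
      funext s; rw [neg_smul, one_smul]
    rw [this]
    exact continuous_const_smul _

/-- The `p`-th derivative of the `i`-th component of a section. -/
def jet (i : Fin m) (p : ℕ) : σ.Section →ₗ[ℝ] C(lift (σ.I i), Model n) where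
  toFun (s : σ.Section) := ⟨fun r => circleDeriv p (s.comp i) r, continuous_iff_continuousAt.2 fun r =>
    (s.contDiffAt_circleDeriv r.2 p).comp continuousAt_subtype_val⟩
  map_add' (s s' : σ.Section) := by
    ext1 r
    exact iteratedDeriv_add ((s.contDiffAt r.2).of_le (WithTop.coe_le_coe.2 le_top))
      ((s'.contDiffAt r.2).of_le (WithTop.coe_le_coe.2 le_top))
  map_smul' c (s : σ.Section) := by
    ext1 r
    exact iteratedDeriv_const_smul_field (𝕝 := ℝ) c (fun r : ℝ => s.comp i r)

/-- Convergence on compact sets is the compact-open topology on a locally compact set. The topology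
is thus induced by linear maps into locally convex spaces, whence local convexity. -/
theorem section_topology_eq : (inferInstance : TopologicalSpace σ.Section) =
    ⨅ (i : Fin m) (p : ℕ), TopologicalSpace.induced (σ.jet i p) inferInstance := by
  have key : ∀ (𝓕 : Filter σ.Section) (s : σ.Section), 𝓕 ≤ 𝓝 s ↔
      𝓕 ≤ @nhds _ (⨅ (i : Fin m) (p : ℕ), TopologicalSpace.induced (σ.jet i p) inferInstance) s := by
    intro 𝓕 s
    rw [← tendsto_id', Section.tendsto_iff_locally, ← tendsto_id', nhds_iInf]
    simp_rw [nhds_iInf, nhds_induced, tendsto_iInf, tendsto_comap_iff]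
    refine forall₂_congr fun i p => ?_
    have := (isOpen_lift (σ.isOpen_I i)).locallyCompactSpace
    rw [ContinuousMap.tendsto_iff_tendstoLocallyUniformly,
      tendstoLocallyUniformlyOn_iff_tendstoLocallyUniformly_comp_coe]
    rfl
  refine TopologicalSpace.ext_nhds fun s => le_antisymm ?_ ?_
  · exact (key _ s).1 le_rfl
  · exact (key _ s).2 le_rfl

instance : LocallyConvexSpace ℝ σ.Section := by
  have h : @LocallyConvexSpace ℝ σ.Section _ _ _ _
      (⨅ (i : Fin m) (p : ℕ), TopologicalSpace.induced (σ.jet i p) inferInstance) :=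
    LocallyConvexSpace.iInf fun i => LocallyConvexSpace.iInf fun p =>
      LocallyConvexSpace.induced (σ.jet i p)
  rwa [← section_topology_eq] at h

/-- Local sections that agree on overlaps glue to a section. -/
theorem exists_section {C : Type*} (N : C → Set UnitAddCircle) (hN : ∀ c, IsOpen (N c))
    (hcov : ∀ t, ∃ c, t ∈ N c) (i : C → Fin m) (hi : ∀ c, N c ⊆ σ.I (i c))
    (f : C → UnitAddCircle → Model n) (hf : ∀ c, SmoothOnCircle (f c) (N c))
    (hcompat : ∀ c d, ∀ t ∈ N c, t ∈ N d → f d t = σ.coordChange (i c) (i d) t (f c t)) :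
    ∃ s : σ.Section, ∀ c j, ∀ t ∈ N c, t ∈ σ.I j → s.comp j t = σ.coordChange (i c) j t (f c t) := by
  classical
  choose c hc using hcov
  let g : Fin m → UnitAddCircle → Model n := fun j t =>
    if t ∈ σ.I j then σ.coordChange (i (c t)) j t (f (c t) t) else 0
  have hg : ∀ d j, ∀ t ∈ N d, t ∈ σ.I j → g j t = σ.coordChange (i d) j t (f d t) := by
    intro d j t hd hj
    simp only [g, if_pos hj]
    rw [hcompat d (c t) t hd (hc t), σ.coordChange_comp (hi d hd) (hi _ (hc t)) hj]
  refine ⟨⟨g, fun j t ht => if_neg ht, fun j r hr => ?_, fun j k t ht => ?_⟩, hg⟩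
  · have hr' : (r : UnitAddCircle) ∈ σ.I j := hr
    have hd := hc r
    have h2 : ContDiffAt ℝ ∞ (fun r' : ℝ => f (c (r : UnitAddCircle)) r') r :=
      (hf _).contDiffAt ((isOpen_lift (hN _)).mem_nhds hd)
    refine (((σ.coordChange_contDiffAt (hi _ hd) hr').clm_apply h2).congr_of_eventuallyEq
      ?_).contDiffWithinAt
    filter_upwards [σ.eventually_mem_I hr', (isOpen_lift (hN _)).mem_nhds hd] with r' h3 h4
    exact hg _ j r' h4 h3
  · rw [hg _ j t (hc t) ht.1, hg _ k t (hc t) ht.2, σ.coordChange_comp (hi _ (hc t)) ht.1 ht.2]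

end LoopSystem

/-! ### Smooth operators between spaces of sections -/

open LoopSystem

section Operators

variable {H : Type} [AddCommGroup H] [Module ℝ H] [TopologicalSpace H]

/-- The map `f` to sections is locally given by smooth functions of the values of curves that
depend linearly and continuously on the argument. -/
def IsLocalOperator (σ : LoopSystem 𝒪 m) (f : H → σ.Section) (O : Set H) : Prop :=
  ∀ h₀ ∈ O, ∀ i (r : ℝ), (r : UnitAddCircle) ∈ σ.I i →
    ∃ (E : Type) (_ : NormedAddCommGroup E) (_ : NormedSpace ℝ E) (A : H →ₗ[ℝ] (ℝ → E))
      (Φ : ℝ × E → Model n),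
      (∀ h, SmoothTendsto (𝓝 h) A (A h) r) ∧
      (∀ᶠ q in 𝓝 (r, A h₀ r), ContDiffAt ℝ ∞ Φ q) ∧
      ∀ᶠ y in 𝓝 h₀ ×ˢ 𝓝 r, (f y.1).comp i (y.2 : ℝ) = Φ (y.2, A y.1 y.2)

theorem IsLocalOperator.continuousAt {σ : LoopSystem 𝒪 m} {f : H → σ.Section} {O : Set H}
    (hf : IsLocalOperator σ f O) {h : H} (hh : h ∈ O) : ContinuousAt f h := by
  refine Section.tendsto_iff.2 fun i r hr => ?_
  obtain ⟨E, _, _, A, Φ, h1, h2, h3⟩ := hf h hh i r hr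
  refine ((h1 h).comp h2).congr (h3.mono fun y hy => hy.symm) ?_
  rw [← nhds_prod_eq] at h3
  have : Tendsto (fun r' => (h, r')) (𝓝 r) (𝓝 (h, r)) := tendsto_const_nhds.prodMk_nhds tendsto_id
  exact (this.eventually h3).mono fun y hy => hy.symm

/-- Linearity of `A` turns a difference quotient of `f` into one of `Φ` along the curves `A h` and
`A v`. One pair `A`, `Φ` serves for all nearby points, directions and times; this uniformity makes
the derivative a local operator again. -/
theorem IsLocalOperator.quotient [ContinuousAdd H] [ContinuousSMul ℝ H]
    {σ : LoopSystem 𝒪 m} {f : H → σ.Section} {O : Set H}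
    (hf : IsLocalOperator σ f O) {h₀ : H} (hh : h₀ ∈ O) (v₀ : H) (i : Fin m) (r : ℝ)
    (hr : (r : UnitAddCircle) ∈ σ.I i) :
    ∃ (E : Type) (_ : NormedAddCommGroup E) (_ : NormedSpace ℝ E) (A : H →ₗ[ℝ] (ℝ → E))
      (Φ : ℝ × E → Model n), (∀ h, SmoothTendsto (𝓝 h) A (A h) r) ∧
      (∀ᶠ q in 𝓝 (r, A h₀ r), ContDiffAt ℝ ∞ Φ q) ∧
      ∀ᶠ y in 𝓝 (h₀, v₀) ×ˢ 𝓝 r, SmoothTendsto (𝓝[≠] (0 : ℝ))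
        (fun ε (r : ℝ) => ε⁻¹ • ((f (y.1.1 + ε • y.1.2)).comp i r - (f y.1.1).comp i r))
        (fun r => fibreDeriv Φ (r, (A y.1.1 r, A y.1.2 r))) y.2 := by
  obtain ⟨E, _, _, A, Φ, h1, h2, h3⟩ := hf h₀ hh i r hr
  refine ⟨E, _, _, A, Φ, h1, h2, ?_⟩
  have t1 : Tendsto (fun y : (H × H) × ℝ => (y.1.1, y.2)) (𝓝 (h₀, v₀) ×ˢ 𝓝 r)
      (𝓝 h₀ ×ˢ 𝓝 r) := (continuous_fst.tendsto (h₀, v₀)).prodMap tendsto_id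
  have t2 : Tendsto (fun y : (H × H) × ℝ => (y.1.2, y.2)) (𝓝 (h₀, v₀) ×ˢ 𝓝 r)
      (𝓝 v₀ ×ˢ 𝓝 r) := (continuous_snd.tendsto (h₀, v₀)).prodMap tendsto_id
  have e3 : ∀ᶠ z in 𝓝 h₀ ×ˢ 𝓝 r, ∀ᶠ z' in 𝓝 z, (f z'.1).comp i (z'.2 : ℝ) = Φ (z'.2, A z'.1 z'.2) := by
    rw [← nhds_prod_eq] at h3 ⊢
    exact h3.eventually_nhds
  filter_upwards [
    t1.eventually (eventually_prod_eventually_nhds (P := fun h r => ContDiffAt ℝ ∞ (A h) r)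
      (h1 h₀).smooth),
    t2.eventually (eventually_prod_eventually_nhds (P := fun h r => ContDiffAt ℝ ∞ (A h) r)
      (h1 v₀).smooth),
    t1.eventually ((h1 h₀).tendsto_prodMk_zero.eventually h2.eventually_nhds),
    t1.eventually e3]
  rintro ⟨⟨h, v⟩, r'⟩ c1 c2 c3 c4
  refine (smoothTendsto_quotient c1 c2 c3).congr ?_ (Eventually.of_forall fun _ => rfl)
  have hline : Tendsto (fun ε : ℝ => h + ε • v) (𝓝[≠] 0) (𝓝 h) := by
    have : Tendsto (fun ε : ℝ => h + ε • v) (𝓝 0) (𝓝 (h + (0 : ℝ) • v)) :=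
      Continuous.tendsto (by fun_prop) 0
    rw [zero_smul, add_zero] at this
    exact this.mono_left nhdsWithin_le_nhds
  simp only [nhds_prod_eq] at c4
  have h5 : ∀ᶠ y : ℝ × ℝ in 𝓝[≠] 0 ×ˢ 𝓝 r', (f h).comp i (y.2 : ℝ) = Φ (y.2, A h y.2) := by
    have : Tendsto (fun y : ℝ × ℝ => (h, y.2)) (𝓝[≠] 0 ×ˢ 𝓝 r') (𝓝 h ×ˢ 𝓝 r') :=
      tendsto_const_nhds.prodMk tendsto_snd
    exact this.eventually c4
  filter_upwards [(hline.prodMap tendsto_id).eventually c4, h5] with y h6 h7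
  simp only [Prod.map, id] at h6
  rw [h6, h7, map_add, map_smul]; rfl

/-- Each local representation yields a smooth limit of the difference quotients. Uniqueness of
limits shows that these agree, and that they satisfy the linear gluing condition of sections. -/
theorem IsLocalOperator.exists_derivative [ContinuousAdd H] [ContinuousSMul ℝ H]
    {σ : LoopSystem 𝒪 m} {f : H → σ.Section} {O : Set H}
    (hf : IsLocalOperator σ f O) {h : H} (hh : h ∈ O) (v : H) :
    ∃ s : σ.Section, Tendsto (fun ε : ℝ => ε⁻¹ • (f (h + ε • v) - f h)) (𝓝[≠] 0) (𝓝 s) := by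
  classical
  have key : ∀ i (r : ℝ), (r : UnitAddCircle) ∈ σ.I i → ∃ w : ℝ → Model n, ∀ᶠ r' in 𝓝 r,
      SmoothTendsto (𝓝[≠] (0 : ℝ))
        (fun ε (r : ℝ) => ε⁻¹ • ((f (h + ε • v)).comp i r - (f h).comp i r)) w r' := by
    intro i r hr
    obtain ⟨E, _, _, A, Φ, h1, h2, h3⟩ := hf.quotient hh v i r hr
    rw [← nhds_prod_eq] at h3
    have : Tendsto (fun r' => ((h, v), r')) (𝓝 r) (𝓝 ((h, v), r)) :=
      tendsto_const_nhds.prodMk_nhds tendsto_id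
    exact ⟨fun r => fibreDeriv Φ (r, (A h r, A v r)), this.eventually h3⟩
  have hpt : ∀ i t, t ∈ σ.I i → ∃ w : Model n, Tendsto
      (fun ε : ℝ => ε⁻¹ • ((f (h + ε • v)).comp i t - (f h).comp i t)) (𝓝[≠] 0) (𝓝 w) := by
    intro i t ht
    obtain ⟨r, rfl⟩ := exists_coe_eq t
    obtain ⟨w, hw⟩ := key i r ht
    exact ⟨w r, hw.self_of_nhds.tendsto_zero.comp
      (tendsto_id.prodMk (tendsto_const_nhds (x := r)))⟩
  choose! g hg using hpt
  let g' : Fin m → UnitAddCircle → Model n := fun i t => if t ∈ σ.I i then g i t else 0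
  have hst : ∀ i (r : ℝ), (r : UnitAddCircle) ∈ σ.I i → SmoothTendsto (𝓝[≠] (0 : ℝ))
      (fun ε (r : ℝ) => ε⁻¹ • ((f (h + ε • v)).comp i r - (f h).comp i r))
      (fun r : ℝ => g' i r) r := by
    intro i r hr
    obtain ⟨w, hw⟩ := key i r hr
    refine hw.self_of_nhds.congr (Eventually.of_forall fun _ => rfl) ?_
    filter_upwards [hw, σ.eventually_mem_I hr] with r' h1 h2
    simp only [g', if_pos h2]
    exact tendsto_nhds_unique (h1.tendsto_zero.comp
      (tendsto_id.prodMk (tendsto_const_nhds (x := r')))) (hg i r' h2)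
  let s : σ.Section := ⟨g', fun i t ht => if_neg ht,
    fun i r hr => (hst i r hr).smooth₀.self_of_nhds.contDiffWithinAt, fun i j t ht => by
      simp only [g', if_pos ht.1, if_pos ht.2]
      refine tendsto_nhds_unique (hg j t ht.2) ?_
      refine (((σ.coordChange i j t).continuous.tendsto _).comp (hg i t ht.1)).congr fun ε => ?_
      rw [Function.comp, map_smul, map_sub, ← (f _).comp_eq ht.1 ht.2, ← (f _).comp_eq ht.1 ht.2]⟩
  exact ⟨s, Section.tendsto_iff.2 hst⟩

/-- The derivative is represented by the fibre derivative of `Φ` on the doubled curves `(A h, A v)`,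
so the class of local operators is closed under differentiation and the induction on the order
closes. -/
theorem IsLocalOperator.exists_fderiv [ContinuousAdd H] [ContinuousSMul ℝ H]
    {σ : LoopSystem 𝒪 m} {f : H → σ.Section} {O : Set H} (hO : IsOpen O)
    (hf : IsLocalOperator σ f O) : ∃ df : H × H → σ.Section,
      (∀ x ∈ O, ∀ v, Tendsto (fun ε : ℝ => ε⁻¹ • (f (x + ε • v) - f x)) (𝓝[≠] 0)
        (𝓝 (df (x, v)))) ∧ IsLocalOperator σ df (O ×ˢ univ) := by
  have hex : ∀ q : H × H, ∃ s : σ.Section, q.1 ∈ O →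
      Tendsto (fun ε : ℝ => ε⁻¹ • (f (q.1 + ε • q.2) - f q.1)) (𝓝[≠] 0) (𝓝 s) := by
    intro q
    by_cases hq : q.1 ∈ O
    · obtain ⟨s, hs⟩ := hf.exists_derivative hq q.2
      exact ⟨s, fun _ => hs⟩
    · exact ⟨0, fun h => absurd h hq⟩
  choose df hdf using hex
  refine ⟨df, fun x hx v => hdf (x, v) hx, ?_⟩
  rintro ⟨h₀, v₀⟩ ⟨hh, -⟩ i r hr
  obtain ⟨E, _, _, A, Φ, h1, h2, h3⟩ := hf.quotient hh v₀ i r hr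
  refine ⟨E × E, inferInstance, inferInstance,
    { toFun := fun q r => (A q.1 r, A q.2 r)
      map_add' := fun q q' => by funext r; simp
      map_smul' := fun c q => by funext r; simp }, fibreDeriv Φ, ?_, ?_, ?_⟩
  · intro q
    exact ((h1 q.1).comp_tendsto (continuous_fst.tendsto q)).prodMk
      ((h1 q.2).comp_tendsto (continuous_snd.tendsto q))
  · have : Tendsto (fun q : ℝ × (E × E) => (q.1, q.2.1)) (𝓝 (r, (A h₀ r, A v₀ r)))
        (𝓝 (r, A h₀ r)) := Continuous.tendsto (by fun_prop) (r, (A h₀ r, A v₀ r))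
    exact (this.eventually h2).mono fun p hp => contDiffAt_fibreDeriv hp
  · have hO' : ∀ᶠ y : (H × H) × ℝ in 𝓝 (h₀, v₀) ×ˢ 𝓝 r, y.1.1 ∈ O :=
      ((continuous_fst.tendsto (h₀, v₀)).comp tendsto_fst).eventually (hO.mem_nhds hh)
    filter_upwards [h3, hO', (σ.eventually_mem_I hr).prod_inr _] with y h4 h5 h6
    have h7 := (Section.tendsto_iff.1 (hdf y.1 h5) i y.2 h6).tendsto_zero.comp
      (tendsto_id.prodMk (tendsto_const_nhds (x := y.2)))
    exact tendsto_nhds_unique h7 (h4.tendsto_zero.comp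
      (tendsto_id.prodMk (tendsto_const_nhds (x := y.2))))

theorem IsLocalOperator.ckOn (σ : LoopSystem 𝒪 m) (k : ℕ) :
    ∀ {H : Type} [AddCommGroup H] [Module ℝ H] [TopologicalSpace H] [ContinuousAdd H]
      [ContinuousSMul ℝ H] {f : H → σ.Section} {O : Set H}, IsOpen O →
      IsLocalOperator σ f O → CkOn k f O := by
  induction k with
  | zero => exact fun _ hf h hh => (hf.continuousAt hh).continuousWithinAt
  | succ k ih =>
    intro H _ _ _ _ _ f O hO hf
    refine ⟨fun h hh => (hf.continuousAt hh).continuousWithinAt, ?_⟩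
    obtain ⟨df, h1, h2⟩ := hf.exists_fderiv hO
    exact ⟨df, h1, ih (hO.prod isOpen_univ) h2⟩

theorem IsLocalOperator.smoothOn [ContinuousAdd H] [ContinuousSMul ℝ H] {σ : LoopSystem 𝒪 m}
    {f : H → σ.Section} {O : Set H} (hO : IsOpen O) (hf : IsLocalOperator σ f O) :
    SmoothOn f O := fun k => hf.ckOn σ k hO

end Operators

end

/-! ### The isotropy group: finiteness, realization by local group elements, action on sections. -/

section

open LoopSystem

/-- A function with finitely many values and closed level sets is locally constant. The levels are
given as a relation with existence and uniqueness. -/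
theorem _root_.IsPreconnected.exists_const_of_finite {α G : Type*} [TopologicalSpace α] [Finite G]
    {W : Set α} (hW : IsPreconnected W) (hne : W.Nonempty) {Q : G → α → Prop}
    (hc : ∀ g, ∀ x ∈ W, (∃ᶠ y in 𝓝[W] x, Q g y) → Q g x) (hex : ∀ x ∈ W, ∃ g, Q g x)
    (huniq : ∀ x ∈ W, ∀ g h, Q g x → Q h x → g = h) : ∃ g, ∀ x ∈ W, Q g x := by
  obtain ⟨x₀, hx₀⟩ := hne
  obtain ⟨g, hg⟩ := hex x₀ hx₀
  refine ⟨g, hW.forall_of_clopen (fun x hx hgx => ?_) (hc g) hx₀ hg⟩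
  by_contra hne
  have h1 : ∃ᶠ y in 𝓝[W] x, ∃ h, h ≠ g ∧ Q h y := by
    refine ((not_eventually.1 hne).and_eventually self_mem_nhdsWithin).mono ?_
    rintro y ⟨hy, hyW⟩
    obtain ⟨h, hh⟩ := hex y hyW
    exact ⟨h, fun e => hy (e ▸ hh), hh⟩
  obtain ⟨h, hh⟩ : ∃ h, ∃ᶠ y in 𝓝[W] x, h ≠ g ∧ Q h y := by
    by_contra hcon
    push Not at hcon
    exact h1 ((eventually_all.2 fun h => hcon h).mono fun y hy ⟨h, h2, h3⟩ => hy h h2 h3)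
  exact hh.exists.choose_spec.1 (huniq x hx h g (hc h x hx (hh.mono fun _ h => h.2)) hgx)

variable {n : ℕ} {X : Type*} [TopologicalSpace X] {𝒪 : Orbifold n X} {m m' : ℕ}

/-- The differential of a transition map at a point. -/
def IsTransition.fderivEquiv {a b : OrbifoldChart n X}
    {φ : OpenPartialHomeomorph (Model n) (Model n)} (h : IsTransition a b φ) {x : Model n}
    (hx : x ∈ φ.source) : Model n ≃L[ℝ] Model n :=
  ContinuousLinearEquiv.equivOfInverse (fderiv ℝ φ x) (fderiv ℝ φ.symm (φ x))
    (fun v => DFunLike.congr_fun (h.fderiv_symm_comp hx) v)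
    (fun v => DFunLike.congr_fun (h.fderiv_comp_symm hx) v)

namespace LocalTangent

theorem rel_refl (v : LocalTangent 𝒪) : v.Rel v :=
  ⟨_, IsTransition.ofSet _, v.mem, rfl, by
    change fderiv ℝ id v.pt v.vec = v.vec
    rw [fderiv_id]; rfl⟩

theorem rel_symm {v w : LocalTangent 𝒪} (h : v.Rel w) : w.Rel v := by
  obtain ⟨φ, h1, h2, h3, h4⟩ := h
  refine ⟨φ.symm, h1.symm, ?_, ?_, ?_⟩
  · rw [← h3]; exact φ.map_source h2
  · rw [← h3]; exact φ.left_inv h2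
  · rw [← h3, ← h4]; exact DFunLike.congr_fun (h1.fderiv_symm_comp h2) _

theorem rel_trans {u v w : LocalTangent 𝒪} (h : u.Rel v) (h' : v.Rel w) : u.Rel w := by
  obtain ⟨φ, h1, h2, h3, h4⟩ := h
  obtain ⟨ψ, k1, k2, k3, k4⟩ := h'
  refine ⟨φ.trans ψ, h1.trans k1, ?_, ?_, ?_⟩
  · simp only [OpenPartialHomeomorph.trans_source, mem_inter_iff, mem_preimage]
    exact ⟨h2, by rwa [h3]⟩
  · rw [OpenPartialHomeomorph.coe_trans, Function.comp, h3, k3]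
  · rw [OpenPartialHomeomorph.coe_trans, fderiv_comp _ (by rw [h3]; exact k1.differentiableAt k2)
      (h1.differentiableAt h2), ContinuousLinearMap.comp_apply, h4, h3, k4]

theorem mk_eq_iff {v w : LocalTangent 𝒪} :
    (Quot.mk _ v : TangentOrbibundle 𝒪) = Quot.mk _ w ↔ v.Rel w := by
  constructor
  · intro h
    have h' := Quot.eqvGen_exact h
    clear h
    induction h' with
    | rel a b h => exact h
    | refl a => exact rel_refl a
    | symm a b _ ih => exact rel_symm ih
    | trans a b c _ _ ih ih' => exact rel_trans ih ih'
  · exact fun h => Quot.sound h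

end LocalTangent

namespace LoopSystem

variable (σ : LoopSystem 𝒪 m)

theorem isotropy_smooth (θ : σ.isotropy) {i : Fin m} {r : ℝ} (hr : (r : UnitAddCircle) ∈ σ.I i) :
    ContDiffAt ℝ ∞ (fun r : ℝ => (θ.1 i r : Model n →L[ℝ] Model n)) r :=
  (θ.2.2.1 i).contDiffAt ((isOpen_lift (σ.isOpen_I i)).mem_nhds hr)

theorem isotropy_coordChange (θ : σ.isotropy) {i j : Fin m} {t : UnitAddCircle} (hi : t ∈ σ.I i)
    (hj : t ∈ σ.I j) (v : Model n) :
    θ.1 j t (σ.coordChange i j t v) = σ.coordChange i j t (θ.1 i t v) :=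
  θ.2.2.2.1 i j t ⟨hi, hj⟩ v

/-- Compatibility with the map to `TX` only gives, for each vector separately, a stabilizing group
element whose differential acts on it as `θ`. The subspaces where a given element works are finite
in number and cover `ℝⁿ`; a real vector space is not a finite union of proper subspaces, so one
element works for all vectors. -/
theorem isotropy_exists_pointwise (θ : σ.isotropy) {i : Fin m} {t : UnitAddCircle} (ht : t ∈ σ.I i) :
    ∃ g, (𝒪.chart (σ.U i)).act g (σ.γ i t) = σ.γ i t ∧
      fderiv ℝ ((𝒪.chart (σ.U i)).act g) (σ.γ i t) = (θ.1 i t : Model n →L[ℝ] Model n) := by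
  set c := 𝒪.chart (σ.U i) with hc
  let ι := {g : c.G // c.act g (σ.γ i t) = σ.γ i t}
  let p : ι → Submodule ℝ (Model n) := fun g =>
    LinearMap.eqLocus (fderiv ℝ (c.act g.1) (σ.γ i t)).toLinearMap
      (θ.1 i t : Model n →L[ℝ] Model n).toLinearMap
  have hcov : ⋃ g, (p g : Set (Model n)) = univ := by
    refine eq_univ_of_forall fun v => ?_
    have h1 := LocalTangent.mk_eq_iff.1 (θ.2.2.2.2 i t ht v).symm
    obtain ⟨φ, h2, h3, h4, h5⟩ := h1
    obtain ⟨g, hg⟩ := IsTransition.exists_germ_act (a := c) h2 h3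
    have h4' : φ (σ.γ i t) = σ.γ i t := h4
    have h5' : fderiv ℝ φ (σ.γ i t) v = θ.1 i t v := h5
    have hg' : φ =ᶠ[𝓝 (σ.γ i t)] c.act g := hg
    refine mem_iUnion.2 ⟨⟨g, by rw [← hg'.self_of_nhds, h4']⟩, ?_⟩
    change fderiv ℝ (c.act g) (σ.γ i t) v = θ.1 i t v
    rw [← hg'.fderiv_eq, h5']
  obtain ⟨g, hg⟩ := Subspace.exists_eq_top_of_iUnion_eq_univ hcov
  refine ⟨g.1, g.2, ?_⟩
  ext1 v
  have : v ∈ p g := by rw [hg]; trivial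
  exact this

/-- The element found at each point is unique by rigidity, and the condition on it is closed in `t`,
so it is constant on the connected set `I i`. -/
theorem isotropy_exists (θ : σ.isotropy) (i : Fin m) :
    ∃ g, ∀ t ∈ σ.I i, (𝒪.chart (σ.U i)).act g (σ.γ i t) = σ.γ i t ∧
      fderiv ℝ ((𝒪.chart (σ.U i)).act g) (σ.γ i t) = (θ.1 i t : Model n →L[ℝ] Model n) := by
  refine (σ.isConnected_I i).isPreconnected.exists_const_of_finite (σ.isConnected_I i).nonempty
    (fun g t ht hf => ?_) (fun t ht => σ.isotropy_exists_pointwise θ ht)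
    (fun t ht g h hg hh => (𝒪.chart (σ.U i)).act_injective_jet (σ.γ_mem i t ht)
      (hg.1.trans hh.1.symm) (hg.2.trans hh.2.symm))
  replace hf := hf.filter_mono nhdsWithin_le_nhds
  have hγ := σ.γ_continuousAt ht
  have hθ : ContinuousAt (fun t => (θ.1 i t : Model n →L[ℝ] Model n)) t := by
    obtain ⟨r, rfl⟩ := exists_coe_eq t
    exact continuousAt_coe_iff.2 (σ.isotropy_smooth θ ht).continuousAt
  have hg := (𝒪.chart (σ.U i)).act_contDiffAt g (σ.γ_mem i t ht)
  have hg' : ContinuousAt (fderiv ℝ ((𝒪.chart (σ.U i)).act g)) (σ.γ i t) :=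
    (hg.fderiv_right (m := 0) (by simp)).continuousAt
  constructor
  · by_contra hne
    exact hf ((ContinuousAt.eventually_ne_of_ne (ContinuousAt.comp (f := σ.γ i) hg.continuousAt hγ)
      hγ hne).mono fun y hy hy' => hy hy'.1)
  · by_contra hne
    exact hf ((ContinuousAt.eventually_ne_of_ne (ContinuousAt.comp (f := σ.γ i) hg' hγ)
      hθ hne).mono fun y hy hy' => hy hy'.2)

/-- The element of `G_{U i}` whose differential along `γ_i` is the automorphism `θ`. -/
def grp (θ : σ.isotropy) (i : Fin m) : (𝒪.chart (σ.U i)).G := (σ.isotropy_exists θ i).choose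

theorem grp_fix (θ : σ.isotropy) {i : Fin m} {t : UnitAddCircle} (ht : t ∈ σ.I i) :
    (𝒪.chart (σ.U i)).act (σ.grp θ i) (σ.γ i t) = σ.γ i t :=
  ((σ.isotropy_exists θ i).choose_spec t ht).1

theorem grp_fderiv (θ : σ.isotropy) {i : Fin m} {t : UnitAddCircle} (ht : t ∈ σ.I i) :
    fderiv ℝ ((𝒪.chart (σ.U i)).act (σ.grp θ i)) (σ.γ i t) = (θ.1 i t : Model n →L[ℝ] Model n) :=
  ((σ.isotropy_exists θ i).choose_spec t ht).2

theorem grp_unique (θ : σ.isotropy) {i : Fin m} {t : UnitAddCircle} (ht : t ∈ σ.I i)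
    {g : (𝒪.chart (σ.U i)).G} (h1 : (𝒪.chart (σ.U i)).act g (σ.γ i t) = σ.γ i t)
    (h2 : fderiv ℝ ((𝒪.chart (σ.U i)).act g) (σ.γ i t) = (θ.1 i t : Model n →L[ℝ] Model n)) :
    g = σ.grp θ i :=
  (𝒪.chart (σ.U i)).act_injective_jet (σ.γ_mem i t ht) (h1.trans (σ.grp_fix θ ht).symm)
    (h2.trans (σ.grp_fderiv θ ht).symm)

theorem grp_mul (θ η : σ.isotropy) (i : Fin m) : σ.grp (θ * η) i = σ.grp θ i * σ.grp η i := by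
  obtain ⟨t, ht⟩ := (σ.isConnected_I i).nonempty
  symm
  refine σ.grp_unique _ ht ?_ ?_
  · rw [OrbifoldChart.act_mul _ _ _ _ (σ.γ_mem i t ht), σ.grp_fix η ht, σ.grp_fix θ ht]
  · rw [OrbifoldChart.fderiv_act_mul _ _ _ (σ.γ_mem i t ht), σ.grp_fix η ht, σ.grp_fderiv θ ht,
      σ.grp_fderiv η ht]
    rfl

theorem isotropy_ext {θ η : σ.isotropy} (h : ∀ i, ∀ t ∈ σ.I i, ∀ v, θ.1 i t v = η.1 i t v) :
    θ = η := by
  apply Subtype.ext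
  funext i t
  by_cases ht : t ∈ σ.I i
  · exact ContinuousLinearEquiv.ext (funext fun v => h i t ht v)
  · rw [θ.2.1 i t ht, η.2.1 i t ht]

/-- The automorphism is recovered as the differential of its group elements along the curves. This
embeds the isotropy group into a finite product of finite groups. -/
theorem grp_injective : Function.Injective σ.grp := by
  intro θ η h
  refine σ.isotropy_ext fun i t ht v => ?_
  have h1 := σ.grp_fderiv θ ht
  rw [h, σ.grp_fderiv η ht] at h1
  exact (DFunLike.congr_fun h1 v).symm

instance : Finite σ.isotropy := Finite.of_injective _ σ.grp_injective

instance : Fintype σ.isotropy := Fintype.ofFinite _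

theorem grp_mem_source (θ : σ.isotropy) {i j : Fin m} {t : UnitAddCircle} (hi : t ∈ σ.I i)
    (hj : t ∈ σ.I j) : ∀ᶠ x in 𝓝 (σ.γ i t),
      x ∈ (𝒪.chart (σ.U i)).V ∧ (𝒪.chart (σ.U i)).act (σ.grp θ i) x ∈ (σ.ξ i j t).source := by
  have hV := σ.γ_mem i t hi
  have h1 := ((𝒪.chart (σ.U i)).act_contDiffAt (σ.grp θ i) hV).continuousAt
  have h2 : (σ.ξ i j t).source ∈ 𝓝 ((𝒪.chart (σ.U i)).act (σ.grp θ i) (σ.γ i t)) := by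
    rw [σ.grp_fix θ hi]
    exact (σ.ξ i j t).open_source.mem_nhds (σ.ξ_source i j t ⟨hi, hj⟩)
  exact Filter.Eventually.and ((𝒪.chart (σ.U i)).isOpen_V.mem_nhds hV) (h1.eventually h2)

/-- The elements `grp θ i` commute with the transition maps of the system. -/
theorem grp_commute (θ : σ.isotropy) {i j : Fin m} {t : UnitAddCircle} (hi : t ∈ σ.I i)
    (hj : t ∈ σ.I j) : ∀ᶠ x in 𝓝 (σ.γ i t),
      (𝒪.chart (σ.U j)).act (σ.grp θ j) (σ.ξ i j t x) =
        σ.ξ i j t ((𝒪.chart (σ.U i)).act (σ.grp θ i) x) := by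
  have hξ := σ.ξ_transition i j t ⟨hi, hj⟩
  have hs := σ.ξ_source i j t ⟨hi, hj⟩
  have ha := σ.ξ_apply i j t ⟨hi, hj⟩
  have h1 := hξ.trans ((𝒪.chart (σ.U j)).isTransition_actHomeo (σ.grp θ j))
  have h2 := ((𝒪.chart (σ.U i)).isTransition_actHomeo (σ.grp θ i)).trans hξ
  refine h1.germ_of_jet h2 ?_ ?_ ?_ ?_
  · simp only [OpenPartialHomeomorph.trans_source, mem_inter_iff, mem_preimage,
      OrbifoldChart.actHomeo_source]
    exact ⟨hs, by rw [ha]; exact σ.γ_mem j t hj⟩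
  · simp only [OpenPartialHomeomorph.trans_source, mem_inter_iff, mem_preimage,
      OrbifoldChart.actHomeo_source, OrbifoldChart.actHomeo_coe]
    exact ⟨σ.γ_mem i t hi, by rw [σ.grp_fix θ hi]; exact hs⟩
  · simp only [OpenPartialHomeomorph.coe_trans, Function.comp, OrbifoldChart.actHomeo_coe]
    rw [ha, σ.grp_fix θ hj, σ.grp_fix θ hi, ha]
  · simp only [OpenPartialHomeomorph.coe_trans, OrbifoldChart.actHomeo_coe]
    rw [fderiv_comp _ (by rw [ha]; exact OrbifoldChart.act_differentiableAt _ _ (σ.γ_mem j t hj))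
        (hξ.differentiableAt hs),
      fderiv_comp _ (by rw [σ.grp_fix θ hi]; exact hξ.differentiableAt hs)
        (OrbifoldChart.act_differentiableAt _ _ (σ.γ_mem i t hi)),
      ha, σ.grp_fix θ hi, σ.grp_fderiv θ hi, σ.grp_fderiv θ hj]
    ext1 v
    exact σ.isotropy_coordChange θ hi hj v

variable {σ} in
/-- An automorphism of the morphism defined by a system induces an element of the isotropy
group. -/
theorem exists_isotropy_of_hom (f : SysHom σ σ) : ∃ θ : σ.isotropy, ∀ i, ∀ t ∈ σ.I i,
    f.b i i t =ᶠ[𝓝 (σ.γ i t)] (𝒪.chart (σ.U i)).act (σ.grp θ i) := by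
  classical
  -- The bundle automorphism is the differential along the curve of the diagonal germs of `f`;
  -- compatibility of `f` differentiates to compatibility with the gluing of the bundle.
  let θ : Fin m → UnitAddCircle → (Model n ≃L[ℝ] Model n) := fun i t =>
    if h : t ∈ σ.I i then (f.transition h h).fderivEquiv (f.source h h) else 1
  have hθ : ∀ i t, t ∈ σ.I i → (θ i t : Model n →L[ℝ] Model n) = fderiv ℝ (f.b i i t) (σ.γ i t) := by
    intro i t h
    simp only [θ, dif_pos h]
    rfl
  have hθv : ∀ i t, t ∈ σ.I i → ∀ v, θ i t v = fderiv ℝ (f.b i i t) (σ.γ i t) v :=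
    fun i t h v => DFunLike.congr_fun (hθ i t h) v
  have hmem : θ ∈ σ.isotropy := by
    refine ⟨fun i t h => dif_neg h, fun i r hr => ?_, fun i j t ht v => ?_, fun i t ht v => ?_⟩
    · have hr' : (r : UnitAddCircle) ∈ σ.I i := hr
      have h1 : ContDiffAt ℝ ∞ (fun r' : ℝ => fderiv ℝ (f.b i i r) (σ.γ i r')) r :=
        ContDiffAt.comp (f := fun r' : ℝ => σ.γ i r') r
          (((f.transition hr' hr').contDiffAt (f.source hr' hr')).fderiv_right (m := ∞) (by simp))
          (σ.γ_contDiffAt hr')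
      refine (h1.congr_of_eventuallyEq ?_).contDiffWithinAt
      filter_upwards [eventually_coe.1 (f.locConst hr' hr'), σ.eventually_mem_I hr'] with r' h2 h3
      rw [hθ i r' h3, h2.fderiv_eq]
    · rw [hθv i t ht.1, hθv j t ht.2]
      have h := f.compat ht.1 ht.2 ht.1 ht.2
      have h' : f.b j j t ∘ σ.ξ i j t =ᶠ[𝓝 (σ.γ i t)] σ.ξ i j t ∘ f.b i i t := h
      have hd := h'.fderiv_eq (𝕜 := ℝ)
      have k1 := σ.ξ_transition i j t ht
      have k2 := σ.ξ_source i j t ht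
      have k3 := σ.ξ_apply i j t ht
      have k4 : DifferentiableAt ℝ (f.b j j t) (σ.ξ i j t (σ.γ i t)) := by
        rw [k3]; exact (f.transition ht.2 ht.2).differentiableAt (f.source ht.2 ht.2)
      have k5 : DifferentiableAt ℝ (σ.ξ i j t) (f.b i i t (σ.γ i t)) := by
        rw [f.apply ht.1 ht.1]; exact k1.differentiableAt k2
      rw [fderiv_comp _ k4 (k1.differentiableAt k2), fderiv_comp _ k5
          ((f.transition ht.1 ht.1).differentiableAt (f.source ht.1 ht.1)), k3,
        f.apply ht.1 ht.1] at hd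
      exact DFunLike.congr_fun hd v
    · symm
      refine Quot.sound ⟨f.b i i t, f.transition ht ht, f.source ht ht, f.apply ht ht, ?_⟩
      exact (hθv i t ht v).symm
  refine ⟨⟨θ, hmem⟩, fun i t ht => ?_⟩
  -- The germ of `f` and the group element both fix the point of the curve and have the differential
  -- `θ` there.
  refine (f.transition ht ht).germ_of_jet (OrbifoldChart.isTransition_actHomeo _ _)
    (f.source ht ht) (σ.γ_mem i t ht) ?_ ?_
  · rw [f.apply ht ht]; exact (σ.grp_fix ⟨θ, hmem⟩ ht).symm
  · rw [← hθ i t ht]; exact (σ.grp_fderiv ⟨θ, hmem⟩ ht).symm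

/-- The action of an automorphism of `E_σ` on sections. -/
def actSection (θ : σ.isotropy) (s : σ.Section) : σ.Section :=
  ⟨fun i t => θ.1 i t (s.comp i t), fun i t ht => by
      change θ.1 i t (s.comp i t) = 0
      rw [s.comp_zero_outside ht, map_zero],
    fun i r hr => ((σ.isotropy_smooth θ hr).clm_apply (s.contDiffAt hr)).contDiffWithinAt,
    fun i j t ht => by
      change θ.1 j t (s.comp j t) = σ.coordChange i j t (θ.1 i t (s.comp i t))
      rw [s.comp_eq ht.1 ht.2, σ.isotropy_coordChange θ ht.1 ht.2]⟩

@[simp] theorem actSection_comp (θ : σ.isotropy) (s : σ.Section) (i : Fin m) (t : UnitAddCircle) :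
    (σ.actSection θ s).comp i t = θ.1 i t (s.comp i t) := rfl

theorem actSection_one (s : σ.Section) : σ.actSection 1 s = s :=
  Section.ext' fun _ _ _ => rfl

theorem actSection_mul (θ η : σ.isotropy) (s : σ.Section) :
    σ.actSection (θ * η) s = σ.actSection θ (σ.actSection η s) :=
  Section.ext' fun _ _ _ => rfl

theorem actSection_smoothOn (θ : σ.isotropy) {O : Set σ.Section} (hO : IsOpen O) :
    SmoothOn (σ.actSection θ) O := by
  refine IsLocalOperator.smoothOn hO fun s _ i r hr => ?_
  refine ⟨Model n, inferInstance, inferInstance,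
    { toFun := fun s r => s.comp i r
      map_add' := fun _ _ => rfl
      map_smul' := fun _ _ => rfl }, fun p => (θ.1 i p.1 : Model n →L[ℝ] Model n) p.2,
    fun s => s.smoothTendsto_nhds hr, ?_, Eventually.of_forall fun _ => rfl⟩
  have h1 : ∀ᶠ p : ℝ × Model n in 𝓝 (r, s.comp i r), (p.1 : UnitAddCircle) ∈ σ.I i :=
    (continuous_fst.tendsto (r, s.comp i r)).eventually (σ.eventually_mem_I hr)
  filter_upwards [h1] with p hp
  exact ((σ.isotropy_smooth θ hp).comp p contDiffAt_fst).clm_apply contDiffAt_snd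

theorem actSection_continuous (θ : σ.isotropy) : Continuous (σ.actSection θ) :=
  continuousOn_univ.1 (σ.actSection_smoothOn θ isOpen_univ 0)

/-- A section with a given value at a given point. -/
theorem exists_section_value {i : Fin m} {t : UnitAddCircle} (ht : t ∈ σ.I i) (v : Model n) :
    ∃ s : σ.Section, s.comp i t = v := by
  classical
  obtain ⟨N, n1, n2, n3, n4⟩ := exists_connected_nhd (σ.isOpen_I i) ht
  -- With two functions, subordinate to `I i` and to the complement of the closure of `N`, the first
  -- is a bump function with support in `I i` and value `1` at `t`.
  obtain ⟨ρ, h1, h2, h3, h4⟩ := exists_circle_partition (m := 2)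
    (I := fun k => if k = 0 then σ.I i else (closure N)ᶜ) (by
      intro k
      split_ifs
      · exact σ.isOpen_I i
      · exact isClosed_closure.isOpen_compl) (by
      intro t'
      by_cases h : t' ∈ closure N
      · exact ⟨0, by simpa using n4 h⟩
      · exact ⟨1, by simpa using h⟩)
  have hρ : ρ 0 t = 1 := by
    have h5 : t ∉ tsupport (ρ 1) := fun h => (by simpa using h4 1 h : t ∉ closure N)
      (subset_closure n3)
    have h6 : ρ 1 t = 0 := by
      by_contra hne
      exact h5 (subset_tsupport _ hne)
    have := h3 t
    rw [Fin.sum_univ_two, h6, add_zero] at this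
    exact this
  have hsub : tsupport (ρ 0) ⊆ σ.I i := by simpa using h4 0
  have hzero : ∀ t', t' ∉ tsupport (ρ 0) → ρ 0 t' = 0 := fun t' h => by
    by_contra hne; exact h (subset_tsupport _ hne)
  -- The section is glued from the bump multiple of `v` over `I i` (`none`) and from zero over each
  -- `I k` away from the support (`some k`).
  let f : Option (Fin m) → UnitAddCircle → Model n := fun c t' =>
    match c with
    | none => ρ 0 t' • v
    | some _ => 0
  obtain ⟨s, hs⟩ := σ.exists_section (C := Option (Fin m))
    (fun c => match c with
      | none => σ.I i
      | some k => σ.I k ∩ (tsupport (ρ 0))ᶜ)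
    (by
      rintro (_ | k)
      · exact σ.isOpen_I i
      · exact (σ.isOpen_I k).inter (isClosed_tsupport _).isOpen_compl)
    (by
      intro t'
      by_cases h : t' ∈ tsupport (ρ 0)
      · exact ⟨none, hsub h⟩
      · obtain ⟨k, hk⟩ := σ.cover t'
        exact ⟨some k, hk, h⟩)
    (fun c => match c with
      | none => i
      | some k => k)
    (by
      rintro (_ | k)
      · exact subset_rfl
      · exact inter_subset_left) f
    (by
      rintro (_ | k)
      · exact ((h1 0).smul contDiff_const).contDiffOn
      · exact contDiffOn_const)
    (by
      rintro (_ | k) (_ | l) t' hc hd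
      · rw [σ.coordChange_self hc]
      · simp [f, hzero t' hd.2]
      · simp [f, hzero t' hc.2]
      · simp [f])
  refine ⟨s, ?_⟩
  have := hs none i t ht ht
  rw [this, σ.coordChange_self ht]
  simp [f, hρ]

end LoopSystem

end

section

variable {n : ℕ} {X : Type*} [TopologicalSpace X] {𝒪 : Orbifold n X} {m : ℕ}

namespace LoopSystem

variable (σ : LoopSystem 𝒪 m)

/-! ### A fibrewise logarithm and an invariant metric -/

/-- A smooth partition of unity subordinate to the cover of a system. -/
def part : Fin m → UnitAddCircle → ℝ := (exists_circle_partition σ.isOpen_I σ.cover).choose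

theorem part_contDiff (k : Fin m) : ContDiff ℝ ∞ fun r : ℝ => σ.part k r :=
  (exists_circle_partition σ.isOpen_I σ.cover).choose_spec.1 k

theorem part_nonneg (k : Fin m) (t : UnitAddCircle) : 0 ≤ σ.part k t :=
  (exists_circle_partition σ.isOpen_I σ.cover).choose_spec.2.1 k t

theorem sum_part (t : UnitAddCircle) : ∑ k, σ.part k t = 1 :=
  (exists_circle_partition σ.isOpen_I σ.cover).choose_spec.2.2.1 t

theorem tsupport_part (k : Fin m) : tsupport (σ.part k) ⊆ σ.I k :=
  (exists_circle_partition σ.isOpen_I σ.cover).choose_spec.2.2.2 k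

theorem mem_I_of_part_ne {k : Fin m} {t : UnitAddCircle} (h : σ.part k t ≠ 0) : t ∈ σ.I k :=
  σ.tsupport_part k (subset_tsupport _ h)

theorem part_cases (k : Fin m) (t : UnitAddCircle) :
    t ∈ σ.I k ∨ ∀ᶠ t' in 𝓝 t, σ.part k t' = 0 := by
  by_cases h : t ∈ tsupport (σ.part k)
  · exact Or.inl (σ.tsupport_part k h)
  · exact Or.inr (notMem_tsupport_iff_eventuallyEq.1 h)

/-- The summands of the fibrewise logarithm. -/
def logTerm (θ : σ.isotropy) (k i : Fin m) (t : UnitAddCircle) (x : Model n) : Model n :=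
  σ.part k t • (θ⁻¹).1 i t (σ.coordChange k i t
    (σ.ξ i k t ((𝒪.chart (σ.U i)).act (σ.grp θ i) x) - σ.γ k t))

/-- A fibrewise logarithm along the loop: an average, over the isotropy group and a partition of
unity, of the differences `x - γ` in the various trivializations. -/
def log (i : Fin m) (t : UnitAddCircle) (x : Model n) : Model n :=
  (Fintype.card σ.isotropy : ℝ)⁻¹ • ∑ θ : σ.isotropy, ∑ k, σ.logTerm θ k i t x

theorem eventually_ξ_eq {i j : Fin m} {t : UnitAddCircle} (hi : t ∈ σ.I i) (hj : t ∈ σ.I j)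
    {P : OpenPartialHomeomorph (Model n) (Model n) → UnitAddCircle → Model n → Prop}
    (h : ∀ᶠ q in 𝓝 (t, σ.γ i t), P (σ.ξ i j t) q.1 q.2) :
    ∀ᶠ q in 𝓝 (t, σ.γ i t), P (σ.ξ i j q.1) q.1 q.2 := by
  filter_upwards [h, (continuous_fst.tendsto (t, σ.γ i t)).eventually
    (σ.ξ_locConst i j t ⟨hi, hj⟩)] with q h1 h2
  rwa [h2]

/-- Where `r` does not lie over `I k`, the weight vanishes on a neighbourhood, so the transition map
to the `k`-th chart matters only over `I k`, where it is locally constant in time. -/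
theorem logTerm_contDiffAt (θ : σ.isotropy) (k : Fin m) {i : Fin m} {r : ℝ} {x : Model n}
    (hi : (r : UnitAddCircle) ∈ σ.I i) (hx : x ∈ (𝒪.chart (σ.U i)).V)
    (h : (r : UnitAddCircle) ∈ σ.I k →
      (𝒪.chart (σ.U i)).act (σ.grp θ i) x ∈ (σ.ξ i k r).source) :
    ContDiffAt ℝ ∞ (fun p : ℝ × Model n => σ.logTerm θ k i p.1 p.2) (r, x) := by
  rcases σ.part_cases k r with hk | hk
  · have hs := h hk
    have e1 : ∀ᶠ p : ℝ × Model n in 𝓝 (r, x), σ.ξ i k p.1 = σ.ξ i k r :=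
      (continuous_fst.tendsto (r, x)).eventually (eventually_coe.1 (σ.ξ_locConst i k r ⟨hi, hk⟩))
    have c1 : ContDiffAt ℝ ∞ (fun p : ℝ × Model n => σ.ξ i k r
        ((𝒪.chart (σ.U i)).act (σ.grp θ i) p.2)) (r, x) :=
      ContDiffAt.comp (f := fun p : ℝ × Model n => (𝒪.chart (σ.U i)).act (σ.grp θ i) p.2) (r, x)
        ((σ.ξ_transition i k r ⟨hi, hk⟩).contDiffAt hs)
        (ContDiffAt.comp (f := fun p : ℝ × Model n => p.2) (r, x)
          ((𝒪.chart (σ.U i)).act_contDiffAt _ hx) contDiffAt_snd)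
    have c2 : ContDiffAt ℝ ∞ (fun p : ℝ × Model n => σ.γ k p.1) (r, x) :=
      ContDiffAt.comp (f := fun p : ℝ × Model n => p.1) (g := fun r : ℝ => σ.γ k r) (r, x)
        (σ.γ_contDiffAt hk) contDiffAt_fst
    have c3 : ContDiffAt ℝ ∞ (fun p : ℝ × Model n => σ.coordChange k i p.1) (r, x) :=
      ContDiffAt.comp (f := fun p : ℝ × Model n => p.1)
        (g := fun r : ℝ => σ.coordChange k i r) (r, x)
        (σ.coordChange_contDiffAt hk hi) contDiffAt_fst
    have c4 : ContDiffAt ℝ ∞ (fun p : ℝ × Model n =>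
        ((θ⁻¹).1 i p.1 : Model n →L[ℝ] Model n)) (r, x) :=
      ContDiffAt.comp (f := fun p : ℝ × Model n => p.1)
        (g := fun r : ℝ => ((θ⁻¹).1 i r : Model n →L[ℝ] Model n)) (r, x)
        (σ.isotropy_smooth θ⁻¹ hi) contDiffAt_fst
    have c5 : ContDiffAt ℝ ∞ (fun p : ℝ × Model n => σ.part k p.1) (r, x) :=
      ((σ.part_contDiff k).comp contDiff_fst).contDiffAt
    refine (c5.smul (c4.clm_apply (c3.clm_apply (c1.sub c2)))).congr_of_eventuallyEq ?_
    filter_upwards [e1] with p hp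
    rw [logTerm, hp]; rfl
  · refine (contDiffAt_const (c := (0 : Model n))).congr_of_eventuallyEq ?_
    filter_upwards [(continuous_fst.tendsto (r, x)).eventually (eventually_coe.1 hk)] with p hp
    rw [logTerm, hp, zero_smul]

theorem log_contDiffAt {i : Fin m} {r : ℝ} (hi : (r : UnitAddCircle) ∈ σ.I i) :
    ∀ᶠ p in 𝓝 (r, σ.γ i r), ContDiffAt ℝ ∞ (fun p : ℝ × Model n => σ.log i p.1 p.2) p := by
  have key : ∀ᶠ p : ℝ × Model n in 𝓝 (r, σ.γ i r), ∀ (θ : σ.isotropy) (k : Fin m),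
      ContDiffAt ℝ ∞ (fun p : ℝ × Model n => σ.logTerm θ k i p.1 p.2) p := by
    refine eventually_all.2 fun θ => eventually_all.2 fun k => ?_
    rcases σ.part_cases k r with hk | hk
    · have e1 : ∀ᶠ p : ℝ × Model n in 𝓝 (r, σ.γ i r), σ.ξ i k p.1 = σ.ξ i k r :=
        (continuous_fst.tendsto (r, σ.γ i r)).eventually
          (eventually_coe.1 (σ.ξ_locConst i k r ⟨hi, hk⟩))
      filter_upwards [e1, (continuous_snd.tendsto (r, σ.γ i r)).eventually
        (σ.grp_mem_source θ hi hk), (continuous_fst.tendsto (r, σ.γ i r)).eventually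
        (σ.eventually_mem_I hi)] with p h1 h2 h3
      exact σ.logTerm_contDiffAt θ k h3 h2.1 fun _ => by rw [h1]; exact h2.2
    · have h := (continuous_fst.tendsto (r, σ.γ i r)).eventually
        (eventually_coe.1 hk).eventually_nhds
      filter_upwards [h] with p hp
      refine (contDiffAt_const (c := (0 : Model n))).congr_of_eventuallyEq ?_
      filter_upwards [(continuous_fst.tendsto p).eventually hp] with p hp
      rw [logTerm, hp, zero_smul]
  filter_upwards [key] with p hp
  exact ContDiffAt.const_smul (Fintype.card σ.isotropy : ℝ)⁻¹
    (ContDiffAt.sum fun θ _ => ContDiffAt.sum fun k _ => hp θ k)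

/-- Reindexing the average by `θ ↦ θ * η` brings out `η` on the left, thanks to the factor `θ⁻¹` in
each term. The identity holds on all of `V`, not only near the curve. -/
theorem log_act (η : σ.isotropy) (i : Fin m) (t : UnitAddCircle) {x : Model n}
    (hx : x ∈ (𝒪.chart (σ.U i)).V) :
    σ.log i t ((𝒪.chart (σ.U i)).act (σ.grp η i) x) = η.1 i t (σ.log i t x) := by
  have key : ∀ θ : σ.isotropy, ∑ k, σ.logTerm θ k i t ((𝒪.chart (σ.U i)).act (σ.grp η i) x) =
      η.1 i t (∑ k, σ.logTerm (θ * η) k i t x) := by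
    intro θ
    rw [map_sum]
    refine Finset.sum_congr rfl fun k _ => ?_
    rw [logTerm, logTerm, map_smul, ← OrbifoldChart.act_mul _ _ _ _ hx, grp_mul]
    congr 1
    generalize σ.coordChange k i t _ = v
    change (θ.1 i t).symm v = η.1 i t ((η.1 i t).symm ((θ.1 i t).symm v))
    rw [ContinuousLinearEquiv.apply_symm_apply]
  rw [log, log, map_smul, map_sum, Finset.sum_congr rfl fun θ _ => key θ]
  exact congrArg _ (Equiv.sum_comp (Equiv.mulRight η)
    (fun θ => η.1 i t (∑ k, σ.logTerm θ k i t x)))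

/-- Each summand transforms like a vector of the bundle: the group elements commute with the
transition maps, and the cocycle identity removes the dependence on the chart in which `x` is
written. -/
theorem log_ξ {i j : Fin m} {t : UnitAddCircle} (hi : t ∈ σ.I i) (hj : t ∈ σ.I j) :
    ∀ᶠ q in 𝓝 (t, σ.γ i t),
      σ.log j q.1 (σ.ξ i j q.1 q.2) = σ.coordChange i j q.1 (σ.log i q.1 q.2) := by
  have key : ∀ᶠ q in 𝓝 (t, σ.γ i t), ∀ (θ : σ.isotropy) (k : Fin m),
      σ.logTerm θ k j q.1 (σ.ξ i j q.1 q.2) =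
        σ.coordChange i j q.1 (σ.logTerm θ k i q.1 q.2) := by
    refine eventually_all.2 fun θ => eventually_all.2 fun k => ?_
    rcases σ.part_cases k t with hk | hk
    · have h1 : ∀ᶠ q in 𝓝 (t, σ.γ i t),
          (𝒪.chart (σ.U j)).act (σ.grp θ j) (σ.ξ i j q.1 q.2) =
            σ.ξ i j q.1 ((𝒪.chart (σ.U i)).act (σ.grp θ i) q.2) :=
        σ.eventually_ξ_eq hi hj (P := fun ξ t x =>
          (𝒪.chart (σ.U j)).act (σ.grp θ j) (ξ x) =
            ξ ((𝒪.chart (σ.U i)).act (σ.grp θ i) x))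
          ((continuous_snd.tendsto (t, σ.γ i t)).eventually (σ.grp_commute θ hi hj))
      have ht : Tendsto ((𝒪.chart (σ.U i)).act (σ.grp θ i)) (𝓝 (σ.γ i t)) (𝓝 (σ.γ i t)) := by
        have := ((𝒪.chart (σ.U i)).act_contDiffAt (σ.grp θ i) (σ.γ_mem i t hi)).continuousAt
        rwa [ContinuousAt, σ.grp_fix θ hi] at this
      have h2 : ∀ᶠ q in 𝓝 (t, σ.γ i t),
          σ.ξ j k t (σ.ξ i j t ((𝒪.chart (σ.U i)).act (σ.grp θ i) q.2)) =
            σ.ξ i k t ((𝒪.chart (σ.U i)).act (σ.grp θ i) q.2) :=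
        (continuous_snd.tendsto (t, σ.γ i t)).eventually (ht.eventually (σ.cocycle hi hj hk))
      have hfst := continuous_fst.tendsto (t, σ.γ i t)
      filter_upwards [h1, h2, hfst.eventually (σ.ξ_locConst i j t ⟨hi, hj⟩),
        hfst.eventually (σ.ξ_locConst j k t ⟨hj, hk⟩),
        hfst.eventually (σ.ξ_locConst i k t ⟨hi, hk⟩), hfst.eventually (σ.mem_nhds_I hi),
        hfst.eventually (σ.mem_nhds_I hj), hfst.eventually (σ.mem_nhds_I hk)]
        with q h1 h2 h3 h4 h5 h6 h7 h8
      rw [logTerm, logTerm, h1, map_smul, ← σ.isotropy_coordChange θ⁻¹ h6 h7,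
        σ.coordChange_comp h8 h6 h7, h3, h4, h5, h2]
    · filter_upwards [(continuous_fst.tendsto (t, σ.γ i t)).eventually hk] with q hq
      rw [logTerm, logTerm, hq, zero_smul, zero_smul, map_zero]
  filter_upwards [key] with q hq
  rw [log, log, map_smul, map_sum]
  congr 1
  refine Finset.sum_congr rfl fun θ _ => ?_
  rw [map_sum]
  exact Finset.sum_congr rfl fun k _ => hq θ k

theorem log_γ {i : Fin m} {t : UnitAddCircle} (hi : t ∈ σ.I i) : σ.log i t (σ.γ i t) = 0 := by
  rw [log]
  rw [Finset.sum_eq_zero, smul_zero]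
  refine fun θ _ => Finset.sum_eq_zero fun k _ => ?_
  by_cases hk : σ.part k t = 0
  · rw [logTerm, hk, zero_smul]
  · rw [logTerm, σ.grp_fix θ hi, σ.ξ_apply i k t ⟨hi, σ.mem_I_of_part_ne hk⟩, sub_self, map_zero,
      map_zero, smul_zero]

/-- The differential of the group element is `θ`, cancelled by `θ⁻¹`, and the two coordinate changes
cancel as well; only the weight remains, and the weights sum to `1`. -/
theorem hasFDerivAt_logTerm (θ : σ.isotropy) (k : Fin m) {i : Fin m} {t : UnitAddCircle}
    (hi : t ∈ σ.I i) : HasFDerivAt (σ.logTerm θ k i t)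
      (σ.part k t • ContinuousLinearMap.id ℝ (Model n)) (σ.γ i t) := by
  by_cases hk : σ.part k t = 0
  · rw [hk, zero_smul ℝ (ContinuousLinearMap.id ℝ (Model n))]
    refine (hasFDerivAt_const (0 : Model n) _).congr_of_eventuallyEq (Eventually.of_forall fun x => ?_)
    rw [logTerm, hk, zero_smul]
  · have hk' := σ.mem_I_of_part_ne hk
    have d1 := ((𝒪.chart (σ.U i)).act_differentiableAt (σ.grp θ i) (σ.γ_mem i t hi)).hasFDerivAt
    have d2 : HasFDerivAt (σ.ξ i k t) (σ.coordChange i k t)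
        ((𝒪.chart (σ.U i)).act (σ.grp θ i) (σ.γ i t)) := by
      rw [σ.grp_fix θ hi]
      exact ((σ.ξ_transition i k t ⟨hi, hk'⟩).differentiableAt
        (σ.ξ_source i k t ⟨hi, hk'⟩)).hasFDerivAt
    rw [σ.grp_fderiv θ hi] at d1
    have d3 := ((d2.comp _ d1).sub_const (σ.γ k t))
    have d4 := ((((θ⁻¹).1 i t : Model n →L[ℝ] Model n).hasFDerivAt).comp _
      (((σ.coordChange k i t).hasFDerivAt).comp _ d3)).const_smul (σ.part k t)
    refine d4.congr_fderiv ?_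
    congr 1
    ext1 v
    change (θ⁻¹).1 i t (σ.coordChange k i t (σ.coordChange i k t (θ.1 i t v))) = v
    rw [σ.coordChange_inv hi hk']
    change (θ.1 i t).symm _ = v
    simp

theorem hasFDerivAt_log {i : Fin m} {t : UnitAddCircle} (hi : t ∈ σ.I i) :
    HasFDerivAt (σ.log i t) (ContinuousLinearMap.id ℝ (Model n)) (σ.γ i t) := by
  have h : HasFDerivAt (fun x => ∑ θ : σ.isotropy, ∑ k, σ.logTerm θ k i t x)
      (∑ θ : σ.isotropy, ∑ k, σ.part k t • ContinuousLinearMap.id ℝ (Model n)) (σ.γ i t) :=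
    HasFDerivAt.fun_sum fun θ _ => HasFDerivAt.fun_sum fun k _ => σ.hasFDerivAt_logTerm θ k hi
  refine (h.const_smul (Fintype.card σ.isotropy : ℝ)⁻¹).congr_fderiv ?_
  have hc : (Fintype.card σ.isotropy : ℝ) ≠ 0 := Nat.cast_ne_zero.2 Fintype.card_ne_zero
  rw [← Finset.sum_smul, σ.sum_part, one_smul, Finset.sum_const, Finset.card_univ,
    ← Nat.cast_smul_eq_nsmul ℝ, smul_smul, inv_mul_cancel₀ hc, one_smul]

/-- An invariant metric, obtained by averaging over the isotropy group and a partition of unity. -/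
def metricForm (i : Fin m) (t : UnitAddCircle) : Model n →L[ℝ] Model n →L[ℝ] ℝ :=
  ∑ θ : σ.isotropy, ∑ k, σ.part k t •
    (innerSL ℝ (E := Model n)).bilinearComp
      ((σ.coordChange i k t).comp (θ.1 i t : Model n →L[ℝ] Model n))
      ((σ.coordChange i k t).comp (θ.1 i t : Model n →L[ℝ] Model n))

theorem metricForm_apply (i : Fin m) (t : UnitAddCircle) (v w : Model n) :
    σ.metricForm i t v w = ∑ θ : σ.isotropy, ∑ k, σ.part k t *
      inner ℝ (σ.coordChange i k t (θ.1 i t v)) (σ.coordChange i k t (θ.1 i t w)) := by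
  simp only [metricForm, sum_apply]
  rfl

/-- The metric of a system. -/
def metric : σ.InvariantMetric where
  h := σ.metricForm
  smooth i := by
    refine contDiffOn_clm_apply.2 fun v => contDiffOn_clm_apply.2 fun w => ?_
    intro r hr
    simp only [metricForm_apply]
    refine ContDiffAt.contDiffWithinAt (ContDiffAt.sum fun θ _ => ContDiffAt.sum fun k _ => ?_)
    rcases σ.part_cases k r with hk | hk
    · have c (v : Model n) : ContDiffAt ℝ ∞ (fun r : ℝ => σ.coordChange i k r (θ.1 i r v)) r :=
        (σ.coordChange_contDiffAt hr hk).clm_apply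
          ((σ.isotropy_smooth θ hr).clm_apply contDiffAt_const)
      exact (σ.part_contDiff k).contDiffAt.mul ((c v).inner ℝ (c w))
    · refine (contDiffAt_const (c := (0 : ℝ))).congr_of_eventuallyEq ?_
      filter_upwards [eventually_coe.1 hk] with r' h
      rw [h, zero_mul]
  symm i t _ v w := by
    simp only [metricForm_apply]
    refine Finset.sum_congr rfl fun θ _ => Finset.sum_congr rfl fun k _ => ?_
    rw [real_inner_comm]
  pos i t ht v hv := by
    rw [metricForm_apply]
    have h0 : ∀ (θ : σ.isotropy) (k : Fin m), 0 ≤ σ.part k t *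
        inner ℝ (σ.coordChange i k t (θ.1 i t v)) (σ.coordChange i k t (θ.1 i t v)) :=
      fun θ k => mul_nonneg (σ.part_nonneg k t) real_inner_self_nonneg
    refine lt_of_lt_of_le ?_ (Finset.single_le_sum
      (fun θ _ => Finset.sum_nonneg fun k _ => h0 θ k) (Finset.mem_univ (1 : σ.isotropy)))
    obtain ⟨k, -, hk⟩ : ∃ k ∈ Finset.univ, σ.part k t ≠ 0 := by
      refine Finset.exists_ne_zero_of_sum_ne_zero ?_
      rw [σ.sum_part]; exact one_ne_zero
    refine lt_of_lt_of_le ?_ (Finset.single_le_sum (fun k _ => h0 1 k) (Finset.mem_univ k))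
    refine mul_pos (lt_of_le_of_ne (σ.part_nonneg k t) hk.symm) (real_inner_self_pos.2 fun h => hv ?_)
    have := σ.coordChange_inv ht (σ.mem_I_of_part_ne hk) ((1 : σ.isotropy).1 i t v)
    rw [h, map_zero] at this
    exact this.symm
  compatible i j t ht v w := by
    simp only [metricForm_apply]
    refine Finset.sum_congr rfl fun θ _ => Finset.sum_congr rfl fun k _ => ?_
    by_cases hk : σ.part k t = 0
    · rw [hk, zero_mul, zero_mul]
    · have hk' := σ.mem_I_of_part_ne hk
      rw [σ.isotropy_coordChange θ ht.1 ht.2, σ.isotropy_coordChange θ ht.1 ht.2,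
        σ.coordChange_comp ht.1 ht.2 hk', σ.coordChange_comp ht.1 ht.2 hk']
  invariant η hη i t _ v w := by
    simp only [metricForm_apply]
    rw [← Equiv.sum_comp (Equiv.mulRight (⟨η, hη⟩ : σ.isotropy)) (fun θ => ∑ k, σ.part k t *
      inner ℝ (σ.coordChange i k t (θ.1 i t v)) (σ.coordChange i k t (θ.1 i t w)))]
    rfl

namespace InvariantMetric

variable {σ} (h : σ.InvariantMetric)

/-- The pointwise inner product of two sections. -/
def pair (s s' : σ.Section) (t : UnitAddCircle) : ℝ :=
  h.h (σ.indexAt t) t (s.comp (σ.indexAt t) t) (s'.comp (σ.indexAt t) t)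

/-- The choice `indexAt` depends on `t` without any regularity. Compatibility of the metric allows a
fixed index near a point, which yields continuity of the integrand. -/
theorem pair_eq (s s' : σ.Section) {i : Fin m} {t : UnitAddCircle} (hi : t ∈ σ.I i) :
    h.pair s s' t = h.h i t (s.comp i t) (s'.comp i t) := by
  rw [pair, s.comp_eq hi (σ.indexAt_mem t), s'.comp_eq hi (σ.indexAt_mem t),
    h.compatible i _ t ⟨hi, σ.indexAt_mem t⟩]

theorem l2_eq (s s' : σ.Section) : h.l2 s s' = ∫ t : UnitAddCircle, h.pair s s' t := rfl

theorem tendsto_pair (s s' : σ.Section) (t : UnitAddCircle) :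
    Tendsto (fun y : (σ.Section × σ.Section) × UnitAddCircle => h.pair y.1.1 y.1.2 y.2)
      (𝓝 (s, s') ×ˢ 𝓝 t) (𝓝 (h.pair s s' t)) := by
  obtain ⟨r, rfl⟩ := exists_coe_eq t
  have hi := σ.indexAt_mem (r : UnitAddCircle)
  set i := σ.indexAt (r : UnitAddCircle)
  have h1 := ((s.smoothTendsto_nhds hi).comp_tendsto (continuous_fst.tendsto (s, s'))).tendsto_circle
  have h2 := ((s'.smoothTendsto_nhds hi).comp_tendsto (continuous_snd.tendsto (s, s'))).tendsto_circle
  have h3 : Tendsto (fun y : (σ.Section × σ.Section) × UnitAddCircle => h.h i y.2)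
      (𝓝 (s, s') ×ˢ 𝓝 (r : UnitAddCircle)) (𝓝 (h.h i r)) := by
    refine Tendsto.comp (g := h.h i) ?_ tendsto_snd
    exact continuousAt_coe_iff.2
      ((h.smooth i).contDiffAt ((isOpen_lift (σ.isOpen_I i)).mem_nhds hi)).continuousAt
  have h4 := ((isBoundedBilinearMap_apply (𝕜 := ℝ) (E := Model n)
    (F := Model n →L[ℝ] ℝ)).continuous.tendsto _).comp
    (h3.prodMk_nhds ((continuous_snd.tendsto _).comp h1))
  replace h4 := ((isBoundedBilinearMap_apply (𝕜 := ℝ) (E := Model n)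
    (F := ℝ)).continuous.tendsto _).comp (h4.prodMk_nhds ((continuous_snd.tendsto _).comp h2))
  rw [h.pair_eq s s' hi]
  refine h4.congr' ?_
  filter_upwards [tendsto_snd.eventually (σ.mem_nhds_I hi)] with y hy
  exact (h.pair_eq _ _ hy).symm

theorem continuous_pair (s s' : σ.Section) : Continuous (h.pair s s') := by
  refine continuous_iff_continuousAt.2 fun t => ?_
  have h0 : Tendsto (fun _ : UnitAddCircle => (s, s')) (𝓝 t) (𝓝 (s, s')) := tendsto_const_nhds
  have h1 := (h.tendsto_pair s s' t).comp (h0.prodMk tendsto_id)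
  exact h1

theorem integrable_pair (s s' : σ.Section) : Integrable (h.pair s s') :=
  (h.continuous_pair s s').integrable_of_hasCompactSupport (HasCompactSupport.of_compactSpace _)

theorem pair_self_nonneg (s : σ.Section) (t : UnitAddCircle) : 0 ≤ h.pair s s t := by
  rw [pair]
  by_cases hs : s.comp (σ.indexAt t) t = 0
  · rw [hs, map_zero]
  · exact (h.pos _ t (σ.indexAt_mem t) _ hs).le

/-- The inner product of a metric on the space of sections. -/
@[reducible] def core : InnerProductSpace.Core ℝ σ.Section where
  inner := h.l2
  conj_inner_symm s s' := by
    change h.l2 s' s = h.l2 s s'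
    rw [l2_eq, l2_eq]
    congr 1
    funext t
    exact h.symm _ t (σ.indexAt_mem t) _ _
  re_inner_nonneg s := integral_nonneg (h.pair_self_nonneg s)
  add_left s s' s'' := by
    change h.l2 (s + s') s'' = h.l2 s s'' + h.l2 s' s''
    rw [l2_eq, l2_eq, l2_eq, ← integral_add (h.integrable_pair _ _) (h.integrable_pair _ _)]
    congr 1
    funext t
    simp [pair]
  smul_left s s' c := by
    change h.l2 (c • s) s' = c * h.l2 s s'
    rw [l2_eq, l2_eq, ← integral_const_mul]
    congr 1
    funext t
    simp [pair]
  definite s hs := by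
    have h1 := (integral_eq_zero_iff_of_nonneg (h.pair_self_nonneg s) (h.integrable_pair s s)).1 hs
    -- A continuous function that vanishes almost everywhere vanishes everywhere, so definiteness
    -- follows from pointwise positivity.
    have h2 : h.pair s s = 0 := (h.continuous_pair s s).ae_eq_iff_eq volume continuous_zero |>.1 h1
    refine Section.ext' fun i t hi => ?_
    by_contra hne
    have := h.pos i t hi _ hne
    rw [← h.pair_eq s s hi, h2] at this
    exact lt_irrefl _ this

theorem continuous_l2 : Continuous fun p : σ.Section × σ.Section => h.l2 p.1 p.2 := by
  refine continuous_iff_continuousAt.2 fun p => Metric.tendsto_nhds.2 fun ε hε => ?_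
  have key : ∀ᶠ q in 𝓝 p, ∀ t ∈ (univ : Set UnitAddCircle),
      ‖h.pair q.1 q.2 t - h.pair p.1 p.2 t‖ < ε / 2 := by
    refine isCompact_univ.eventually_forall_prod
      (P := fun (q : σ.Section × σ.Section) t => ‖h.pair q.1 q.2 t - h.pair p.1 p.2 t‖ < ε / 2)
      fun t _ => ?_
    have h1 := (h.tendsto_pair p.1 p.2 t).sub (((h.continuous_pair p.1 p.2).tendsto t).comp
      (tendsto_snd (f := 𝓝 p)))
    rw [sub_self] at h1
    exact (Metric.tendsto_nhds.1 h1 (ε / 2) (half_pos hε)).mono fun y hy => by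
      simpa [dist_zero_right] using hy
  filter_upwards [key] with q hq
  rw [dist_eq_norm, l2_eq, l2_eq, ← integral_sub (h.integrable_pair _ _) (h.integrable_pair _ _)]
  refine lt_of_le_of_lt (norm_integral_le_of_norm_le_const (C := ε / 2)
    (Eventually.of_forall fun t => (hq t (mem_univ t)).le)) ?_
  rw [Measure.real, UnitAddCircle.measure_univ]
  simp [half_lt_self hε]

end InvariantMetric

end LoopSystem

end

section

/-! ### Exponential data -/

theorem eventually_tube {T E : Type*} [TopologicalSpace T] [PseudoMetricSpace E] {K : Set T}
    (hK : IsCompact K) {γ : T → E} (hγ : ∀ t ∈ K, ContinuousAt γ t) {P : T → E → Prop}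
    (h : ∀ t ∈ K, ∀ᶠ q in 𝓝 (t, γ t), P q.1 q.2) :
    ∀ᶠ δ in 𝓝[>] (0 : ℝ), ∀ t ∈ K, ∀ x, dist x (γ t) < δ → P t x := by
  obtain ⟨δ, h1, h2⟩ := exists_tube hK hγ h
  filter_upwards [Ioo_mem_nhdsGT h1] with δ' hδ' t ht x hx
  exact h2 t ht x (hx.trans hδ'.2)

theorem contDiffAt_coe_congr {E F : Type*} [NormedAddCommGroup E] [NormedSpace ℝ E]
    [NormedAddCommGroup F] [NormedSpace ℝ F] {f : UnitAddCircle → E → F} {r r' : ℝ} {x : E}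
    (h : ContDiffAt ℝ ∞ (fun p : ℝ × E => f p.1 p.2) (r, x))
    (hr : (r : UnitAddCircle) = (r' : UnitAddCircle)) :
    ContDiffAt ℝ ∞ (fun p : ℝ × E => f p.1 p.2) (r', x) := by
  have h1 : ContDiffAt ℝ ∞ (fun p : ℝ × E => (p.1 + (r - r'), p.2)) (r', x) := by fun_prop
  have h2 := ContDiffAt.comp (g := fun p : ℝ × E => f p.1 p.2) (r', x)
    (by simpa using h) h1
  refine h2.congr_of_eventuallyEq (Eventually.of_forall fun p => ?_)
  change f _ _ = f _ _
  congr 1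
  rw [AddCircle.coe_add, AddCircle.coe_sub, hr, sub_self, add_zero]

theorem eventually_circle_prod {E : Type*} [TopologicalSpace E] {P : ℝ × E → Prop} {r : ℝ} {x : E}
    (h : ∀ᶠ p in 𝓝 (r, x), P p) :
    ∀ᶠ q in 𝓝 ((r : UnitAddCircle), x), ∃ r' : ℝ, (r' : UnitAddCircle) = q.1 ∧ P (r', q.2) := by
  have e : 𝓝 ((r : UnitAddCircle), x) =
      map (fun p : ℝ × E => ((p.1 : UnitAddCircle), p.2)) (𝓝 (r, x)) := by
    rw [nhds_prod_eq, nhds_prod_eq, ← map_coe_nhds, ← map_id (f := 𝓝 x), prod_map_map_eq, map_id]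
    rfl
  rw [e, eventually_map]
  exact h.mono fun p hp => ⟨p.1, rfl, hp⟩

/-- A fibrewise inverse of a smooth family of local diffeomorphisms is smooth. -/
theorem contDiffAt_fibre_inverse {E : Type*} [NormedAddCommGroup E] [NormedSpace ℝ E]
    [FiniteDimensional ℝ E] {L ε : ℝ × E → E} {r : ℝ} {x : E} (hL : ContDiffAt ℝ ∞ L (r, x))
    (hinj : ∀ w, fderiv ℝ L (r, x) (0, w) = 0 → w = 0)
    (hinv : ∀ᶠ p in 𝓝 (r, x), ε (p.1, L p) = p.2) : ContDiffAt ℝ ∞ ε (r, L (r, x)) := by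
  have : CompleteSpace E := FiniteDimensional.complete ℝ E
  -- The inverse function theorem applies to this map over the time axis. Near the image point, `ε`
  -- coincides with the second component of its smooth local inverse.
  let Ψ : ℝ × E → ℝ × E := fun p => (p.1, L p)
  have hΨ : ContDiffAt ℝ ∞ Ψ (r, x) := contDiffAt_fst.prodMk hL
  have hd : HasFDerivAt Ψ ((ContinuousLinearMap.fst ℝ ℝ E).prod (fderiv ℝ L (r, x))) (r, x) :=
    hasFDerivAt_fst.prodMk (hL.differentiableAt (by simp)).hasFDerivAt
  set D := (ContinuousLinearMap.fst ℝ ℝ E).prod (fderiv ℝ L (r, x)) with hD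
  have hDi : Function.Injective D.toLinearMap := by
    refine (injective_iff_map_eq_zero _).2 ?_
    rintro ⟨a, w⟩ h
    have h1 : a = 0 := congrArg Prod.fst h
    have h2 : fderiv ℝ L (r, x) (a, w) = 0 := congrArg Prod.snd h
    rw [h1] at h2
    rw [h1, hinj w h2]; rfl
  let Deq : (ℝ × E) ≃L[ℝ] (ℝ × E) :=
    (LinearEquiv.ofInjectiveEndo D.toLinearMap hDi).toContinuousLinearEquiv
  have hd' : HasFDerivAt Ψ (Deq : (ℝ × E) →L[ℝ] (ℝ × E)) (r, x) := by
    exact hd.congr_fderiv (ContinuousLinearMap.ext fun v => rfl)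
  have hne : (∞ : WithTop ℕ∞) ≠ 0 := by simp
  have hg := hΨ.to_localInverse hd' hne
  have hst := hΨ.hasStrictFDerivAt' hd' hne
  have h1 : ∀ᶠ q in 𝓝 (Ψ (r, x)), Ψ (hΨ.localInverse hd' hne q) = q :=
    hst.eventually_right_inverse
  have h2 : Tendsto (hΨ.localInverse hd' hne) (𝓝 (Ψ (r, x))) (𝓝 (r, x)) := by
    have := hg.continuousAt
    rwa [ContinuousAt, hΨ.localInverse_apply_image hd' hne] at this
  refine (contDiffAt_snd.comp (Ψ (r, x)) hg).congr_of_eventuallyEq ?_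
  filter_upwards [h1, h2.eventually hinv] with q h3 h4
  change ε q = (hΨ.localInverse hd' hne q).2
  rw [← h4]
  exact congrArg ε h3.symm

theorem approx_injOn {E : Type*} [NormedAddCommGroup E] {f : E → E} {S : Set E}
    (h : ∀ x ∈ S, ∀ y ∈ S, ‖f x - f y - (x - y)‖ ≤ 1 / 2 * ‖x - y‖) : InjOn f S := by
  intro x hx y hy hxy
  have h1 := h x hx y hy
  rw [hxy, sub_self, zero_sub, norm_neg] at h1
  have h2 : ‖x - y‖ ≤ 0 := by linarith [norm_nonneg (x - y)]
  exact sub_eq_zero.1 (norm_le_zero_iff.1 h2)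

/-- A map that is `1 / 2`-close to the identity carries the closed ball of radius `2 * ‖v‖` onto a
set containing the closed ball of radius `(1 - 1 / 2) * (2 * ‖v‖) = ‖v‖`. -/
theorem approx_surj {E : Type*} [NormedAddCommGroup E] [NormedSpace ℝ E] [CompleteSpace E]
    {f : E → E} {δ : ℝ} {b : E}
    (h : ∀ x ∈ Metric.ball b δ, ∀ y ∈ Metric.ball b δ, ‖f x - f y - (x - y)‖ ≤ 1 / 2 * ‖x - y‖)
    (hb : f b = 0) {v : E} (hv : 2 * ‖v‖ < δ) : ∃ x, dist x b ≤ 2 * ‖v‖ ∧ f x = v := by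
  have ha : ApproximatesLinearOn f (ContinuousLinearMap.id ℝ E) (Metric.ball b δ) (1 / 2) := by
    intro x hx y hy
    simpa using h x hx y hy
  let R : (ContinuousLinearMap.id ℝ E).NonlinearRightInverse :=
    { toFun := id, nnnorm := 1, bound' := fun y => by simp, right_inv' := fun y => rfl }
  have hs := ha.surjOn_closedBall_of_nonlinearRightInverse R (ε := 2 * ‖v‖) (b := b)
    (by positivity) (Metric.closedBall_subset_ball hv)
  obtain ⟨x, hx, hxv⟩ := hs (show v ∈ _ by
    rw [hb, Metric.mem_closedBall, dist_zero_right]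
    have : (((1 : NNReal) : ℝ)⁻¹ - ((1 / 2 : NNReal) : ℝ)) * (2 * ‖v‖) = ‖v‖ := by
      push_cast; ring
    exact this.ge)
  exact ⟨x, hx, hxv⟩

variable {n : ℕ} {X : Type*} [TopologicalSpace X] {𝒪 : Orbifold n X} {m : ℕ}

/-- Fibrewise exponential maps along the loop of a system, over slightly smaller open sets, with
properties that hold on tubes of a fixed radius. -/
structure ExpData (σ : LoopSystem 𝒪 m) where
  J : Fin m → Set UnitAddCircle
  isOpen_J : ∀ i, IsOpen (J i)
  isConnected_J : ∀ i, IsConnected (J i)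
  closure_J : ∀ i, closure (J i) ⊆ σ.I i
  cover : ∀ t, ∃ i, t ∈ J i
  δ : ℝ
  δ_pos : 0 < δ
  r : ℝ
  r_pos : 0 < r
  e : Fin m → UnitAddCircle → Model n → Model n
  tube_V : ∀ {i t x}, t ∈ J i → dist x (σ.γ i t) < δ → x ∈ (𝒪.chart (σ.U i)).V
  exp_tube : ∀ {i t v}, t ∈ J i → ‖v‖ < r → dist (e i t v) (σ.γ i t) < δ
  log_exp : ∀ {i t v}, t ∈ J i → ‖v‖ < r → σ.log i t (e i t v) = v
  exp_log : ∀ {i t x}, t ∈ J i → dist x (σ.γ i t) < δ → e i t (σ.log i t x) = x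
  exp_smooth : ∀ {i} {ρ : ℝ} {v}, (ρ : UnitAddCircle) ∈ J i → ‖v‖ < r →
    ContDiffAt ℝ ∞ (fun p : ℝ × Model n => e i p.1 p.2) (ρ, v)
  log_smooth : ∀ {i} {ρ : ℝ} {x}, (ρ : UnitAddCircle) ∈ J i → dist x (σ.γ i ρ) < δ →
    ContDiffAt ℝ ∞ (fun p : ℝ × Model n => σ.log i p.1 p.2) (ρ, x)
  tube_source : ∀ {i j t x}, t ∈ J i → t ∈ J j → dist x (σ.γ i t) < δ → x ∈ (σ.ξ i j t).source
  tube_cocycle : ∀ {i j k t x}, t ∈ J i → t ∈ J j → t ∈ J k → dist x (σ.γ i t) < δ →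
    σ.ξ j k t (σ.ξ i j t x) = σ.ξ i k t x
  log_ξ : ∀ {i j t x}, t ∈ J i → t ∈ J j → dist x (σ.γ i t) < δ →
    σ.log j t (σ.ξ i j t x) = σ.coordChange i j t (σ.log i t x)
  ξ_exp : ∀ {i j t v}, t ∈ J i → t ∈ J j → ‖v‖ < r →
    σ.ξ i j t (e i t v) = e j t (σ.coordChange i j t v)
  exp_act : ∀ (θ : σ.isotropy) {i t v}, t ∈ J i → ‖v‖ < r →
    (𝒪.chart (σ.U i)).act (σ.grp θ i) (e i t v) = e i t (θ.1 i t v)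
  -- The tube is thinner than the displacement of any group element that moves the curve. This is
  -- what makes the fibres of the exponential map the orbits of the isotropy group and no larger.
  fix : ∀ {i} (g : (𝒪.chart (σ.U i)).G), (∀ t ∈ J i, ∃ x, dist x (σ.γ i t) < δ ∧
    dist ((𝒪.chart (σ.U i)).act g x) (σ.γ i t) < δ) →
    ∀ t ∈ J i, (𝒪.chart (σ.U i)).act g (σ.γ i t) = σ.γ i t
  act_source : ∀ {i j t x} (g : (𝒪.chart (σ.U i)).G), t ∈ J i → t ∈ J j →
    (𝒪.chart (σ.U i)).act g (σ.γ i t) = σ.γ i t → dist x (σ.γ i t) < δ →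
    (𝒪.chart (σ.U i)).act g x ∈ (σ.ξ i j t).source

namespace LoopSystem

variable (σ : LoopSystem 𝒪 m)

/-- These are open conditions that hold on the curve, where the fibre derivative is the identity.
They are bundled here so that compactness can make them uniform on a tube. -/
theorem log_local {i : Fin m} {t : UnitAddCircle} (hi : t ∈ σ.I i) :
    ∀ᶠ q in 𝓝 (t, σ.γ i t), q.2 ∈ (𝒪.chart (σ.U i)).V ∧
      (∀ ρ : ℝ, (ρ : UnitAddCircle) = q.1 →
        ContDiffAt ℝ ∞ (fun p : ℝ × Model n => σ.log i p.1 p.2) (ρ, q.2)) ∧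
      ‖fderiv ℝ (σ.log i q.1) q.2 - ContinuousLinearMap.id ℝ (Model n)‖ ≤ 1 / 2 := by
  obtain ⟨r, rfl⟩ := exists_coe_eq t
  have hs := σ.log_contDiffAt hi
  -- The fibre derivative is the restriction of the full derivative to the fibre direction, hence
  -- continuous in time and point together.
  have hfd : ∀ p : ℝ × Model n, ContDiffAt ℝ ∞ (fun p : ℝ × Model n => σ.log i p.1 p.2) p →
      fderiv ℝ (σ.log i p.1) p.2 = (fderiv ℝ (fun p : ℝ × Model n => σ.log i p.1 p.2) p).comp
        (ContinuousLinearMap.inr ℝ ℝ (Model n)) := by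
    intro p hp
    have h1 : HasFDerivAt (fun x : Model n => (p.1, x)) (ContinuousLinearMap.inr ℝ ℝ (Model n)) p.2 :=
      hasFDerivAt_prodMk_right p.1 p.2
    exact (HasFDerivAt.comp (g := fun p : ℝ × Model n => σ.log i p.1 p.2) p.2
      (hp.differentiableAt (by simp)).hasFDerivAt h1).fderiv
  have hc : ContinuousAt (fun p : ℝ × Model n =>
      (fderiv ℝ (fun p : ℝ × Model n => σ.log i p.1 p.2) p).comp
        (ContinuousLinearMap.inr ℝ ℝ (Model n))) (r, σ.γ i r) := by
    have := (hs.self_of_nhds.fderiv_right (m := ∞) (by simp)).continuousAt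
    exact this.clm_comp continuousAt_const
  have h0 : (fderiv ℝ (fun p : ℝ × Model n => σ.log i p.1 p.2) (r, σ.γ i r)).comp
        (ContinuousLinearMap.inr ℝ ℝ (Model n)) = ContinuousLinearMap.id ℝ (Model n) := by
    rw [← hfd _ hs.self_of_nhds]
    exact (σ.hasFDerivAt_log hi).fderiv
  have h1 : ∀ᶠ p : ℝ × Model n in 𝓝 (r, σ.γ i r),
      ‖fderiv ℝ (σ.log i p.1) p.2 - ContinuousLinearMap.id ℝ (Model n)‖ < 1 / 2 := by
    rw [ContinuousAt, h0] at hc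
    filter_upwards [Metric.tendsto_nhds.1 hc (1 / 2) (by norm_num), hs] with p h2 h3
    rw [hfd p h3, ← dist_eq_norm]
    exact h2
  have h2 := (continuous_snd.tendsto (r, σ.γ i r)).eventually
    ((𝒪.chart (σ.U i)).isOpen_V.mem_nhds (σ.γ_mem i r hi))
  filter_upwards [eventually_circle_prod (h2.and (hs.and h1))]
  rintro ⟨t, x⟩ ⟨r', rfl, h3, h4, h5⟩
  exact ⟨h3, fun ρ hρ => contDiffAt_coe_congr h4 hρ.symm, h5.le⟩

/-- An element fixing the curve at `t` keeps nearby points in the source by continuity. An element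
moving it there also moves the curve at nearby times, and then the premise fails. -/
theorem eventually_act_source {i j : Fin m} {t : UnitAddCircle} (hi : t ∈ σ.I i)
    (hj : t ∈ σ.I j) : ∀ᶠ q in 𝓝 (t, σ.γ i t), ∀ g : (𝒪.chart (σ.U i)).G,
      (𝒪.chart (σ.U i)).act g (σ.γ i q.1) = σ.γ i q.1 →
        (𝒪.chart (σ.U i)).act g q.2 ∈ (σ.ξ i j q.1).source := by
  refine eventually_all.2 fun g => ?_
  have hc := ((𝒪.chart (σ.U i)).act_contDiffAt g (σ.γ_mem i t hi)).continuousAt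
  by_cases hg : (𝒪.chart (σ.U i)).act g (σ.γ i t) = σ.γ i t
  · refine σ.eventually_ξ_eq hi hj (P := fun ξ t x =>
      (𝒪.chart (σ.U i)).act g (σ.γ i t) = σ.γ i t → (𝒪.chart (σ.U i)).act g x ∈ ξ.source) ?_
    rw [ContinuousAt, hg] at hc
    filter_upwards [(continuous_snd.tendsto (t, σ.γ i t)).eventually (hc.eventually
      ((σ.ξ i j t).open_source.mem_nhds (σ.ξ_source i j t ⟨hi, hj⟩)))] with q hq _ using hq
  · have hγ := σ.γ_continuousAt hi
    have := ContinuousAt.eventually_ne_of_ne (ContinuousAt.comp (f := σ.γ i) hc hγ) hγ hg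
    filter_upwards [(continuous_fst.tendsto (t, σ.γ i t)).eventually this] with q hq h
    exact absurd h hq

/-- If `g` moves a point of the curve by `d`, then by continuity a point near it and the image of
that point cannot both be within a small fraction of `d` of it. So the premise fails for small
tubes. -/
theorem eventually_not_fix (J : Fin m → Set UnitAddCircle) (hJ : ∀ i, J i ⊆ σ.I i) (i : Fin m)
    (g : (𝒪.chart (σ.U i)).G) : ∀ᶠ δ in 𝓝[>] (0 : ℝ),
      (∀ t ∈ J i, ∃ x, dist x (σ.γ i t) < δ ∧
        dist ((𝒪.chart (σ.U i)).act g x) (σ.γ i t) < δ) →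
      ∀ t ∈ J i, (𝒪.chart (σ.U i)).act g (σ.γ i t) = σ.γ i t := by
  by_cases hg : ∀ t ∈ J i, (𝒪.chart (σ.U i)).act g (σ.γ i t) = σ.γ i t
  · exact Eventually.of_forall fun _ _ => hg
  push Not at hg
  obtain ⟨t, ht, hne⟩ := hg
  have hc := ((𝒪.chart (σ.U i)).act_contDiffAt g (σ.γ_mem i t (hJ i ht))).continuousAt
  have hd : 0 < dist ((𝒪.chart (σ.U i)).act g (σ.γ i t)) (σ.γ i t) := dist_pos.2 hne
  set d := dist ((𝒪.chart (σ.U i)).act g (σ.γ i t)) (σ.γ i t)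
  obtain ⟨δ, hδ, h1⟩ := Metric.continuousAt_iff.1 hc (d / 2) (half_pos hd)
  filter_upwards [Ioo_mem_nhdsGT (lt_min hδ (half_pos hd))] with δ' hδ' h
  obtain ⟨x, h2, h3⟩ := h t ht
  have h4 := h1 (h2.trans (hδ'.2.trans_le (min_le_left _ _)))
  have h5 := h3.trans (hδ'.2.trans_le (min_le_right _ _))
  have h6 := dist_triangle_left ((𝒪.chart (σ.U i)).act g (σ.γ i t)) (σ.γ i t)
    ((𝒪.chart (σ.U i)).act g x)
  exact absurd (h6.trans_lt (add_lt_add h4 h5)) (by rw [add_halves]; exact lt_irrefl _)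

/-- Exponential data exist, over open sets that contain given compact sets. -/
theorem exists_expData (K : Fin m → Set UnitAddCircle) (hK : ∀ i, IsCompact (K i))
    (hKI : ∀ i, K i ⊆ σ.I i) : ∃ E : ExpData σ, ∀ i, K i ⊆ E.J i := by
  classical
  -- The sets `J i` must contain the prescribed `K i` and also cover the circle; `K₀` takes care of
  -- the covering.
  obtain ⟨K₀, k1, k2, k3⟩ := exists_compact_cover σ.isOpen_I σ.cover
  choose J j1 j2 j3 j4 using fun i => exists_connected_between (σ.isOpen_I i) (σ.isConnected_I i)
    ((hK i).union (k1 i)) (union_subset (hKI i) (k2 i))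
  have hJI : ∀ i, J i ⊆ σ.I i := fun i => subset_closure.trans (j4 i)
  have hC : ∀ i, IsCompact (closure (J i)) := fun i => isClosed_closure.isCompact
  have hγ : ∀ i, ∀ t ∈ closure (J i), ContinuousAt (σ.γ i) t :=
    fun i t ht => σ.γ_continuousAt (j4 i ht)
  have A : ∀ᶠ δ in 𝓝[>] (0 : ℝ), ∀ i, ∀ t ∈ closure (J i), ∀ x, dist x (σ.γ i t) < δ →
      x ∈ (𝒪.chart (σ.U i)).V ∧ (∀ ρ : ℝ, (ρ : UnitAddCircle) = t →
        ContDiffAt ℝ ∞ (fun p : ℝ × Model n => σ.log i p.1 p.2) (ρ, x)) ∧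
      ‖fderiv ℝ (σ.log i t) x - ContinuousLinearMap.id ℝ (Model n)‖ ≤ 1 / 2 :=
    eventually_all.2 fun i => eventually_tube (hC i) (hγ i) fun t ht => σ.log_local (j4 i ht)
  have B : ∀ᶠ δ in 𝓝[>] (0 : ℝ), ∀ i j, ∀ t ∈ closure (J i) ∩ closure (J j), ∀ x,
      dist x (σ.γ i t) < δ → x ∈ (σ.ξ i j t).source ∧
        σ.log j t (σ.ξ i j t x) = σ.coordChange i j t (σ.log i t x) ∧
        ∀ g : (𝒪.chart (σ.U i)).G, (𝒪.chart (σ.U i)).act g (σ.γ i t) = σ.γ i t →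
          (𝒪.chart (σ.U i)).act g x ∈ (σ.ξ i j t).source := by
    refine eventually_all.2 fun i => eventually_all.2 fun j =>
      eventually_tube ((hC i).inter (hC j)) (fun t ht => hγ i t ht.1) fun t ht => ?_
    have hi := j4 i ht.1
    have hj := j4 j ht.2
    refine (σ.eventually_ξ_eq hi hj (P := fun ξ _ x => x ∈ ξ.source) ?_).and
      ((σ.log_ξ hi hj).and (σ.eventually_act_source hi hj))
    exact (continuous_snd.tendsto (t, σ.γ i t)).eventually
      ((σ.ξ i j t).open_source.mem_nhds (σ.ξ_source i j t ⟨hi, hj⟩))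
  have C : ∀ᶠ δ in 𝓝[>] (0 : ℝ), ∀ i j k, ∀ t ∈ closure (J i) ∩ closure (J j) ∩ closure (J k),
      ∀ x, dist x (σ.γ i t) < δ → σ.ξ j k t (σ.ξ i j t x) = σ.ξ i k t x := by
    refine eventually_all.2 fun i => eventually_all.2 fun j => eventually_all.2 fun k =>
      eventually_tube (((hC i).inter (hC j)).inter (hC k)) (fun t ht => hγ i t ht.1.1) fun t ht => ?_
    have hi := j4 i ht.1.1
    have hj := j4 j ht.1.2
    have hk := j4 k ht.2
    have hf := continuous_fst.tendsto (t, σ.γ i t)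
    filter_upwards [(continuous_snd.tendsto (t, σ.γ i t)).eventually (σ.cocycle hi hj hk),
      hf.eventually (σ.ξ_locConst i j t ⟨hi, hj⟩), hf.eventually (σ.ξ_locConst j k t ⟨hj, hk⟩),
      hf.eventually (σ.ξ_locConst i k t ⟨hi, hk⟩)] with q h1 h2 h3 h4
    rw [h2, h3, h4, h1]
  have D : ∀ᶠ δ in 𝓝[>] (0 : ℝ), ∀ i (g : (𝒪.chart (σ.U i)).G),
      (∀ t ∈ J i, ∃ x, dist x (σ.γ i t) < δ ∧
        dist ((𝒪.chart (σ.U i)).act g x) (σ.γ i t) < δ) →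
      ∀ t ∈ J i, (𝒪.chart (σ.U i)).act g (σ.γ i t) = σ.γ i t :=
    eventually_all.2 fun i => eventually_all.2 fun g => σ.eventually_not_fix J hJI i g
  -- The outer radius `δ` is fixed first. The smaller `η` is then chosen so that transition maps and
  -- isotropy elements carry the `η`-tube into the `δ`-tube.
  obtain ⟨δ, ⟨⟨⟨⟨A, B⟩, C⟩, D⟩, hδ⟩⟩ :=
    ((((A.and B).and C).and D).and self_mem_nhdsWithin).exists
  replace hδ : 0 < δ := hδ
  have E : ∀ᶠ η in 𝓝[>] (0 : ℝ), ∀ i j, ∀ t ∈ closure (J i) ∩ closure (J j), ∀ x,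
      dist x (σ.γ i t) < η → dist (σ.ξ i j t x) (σ.γ j t) < δ := by
    refine eventually_all.2 fun i => eventually_all.2 fun j =>
      eventually_tube ((hC i).inter (hC j)) (fun t ht => hγ i t ht.1) fun t ht => ?_
    have hi := j4 i ht.1
    have hj := j4 j ht.2
    refine σ.eventually_ξ_eq hi hj (P := fun ξ t x => dist (ξ x) (σ.γ j t) < δ) ?_
    have h1 : Tendsto (fun q : UnitAddCircle × Model n => dist (σ.ξ i j t q.2) (σ.γ j q.1))
        (𝓝 (t, σ.γ i t)) (𝓝 0) := by
      rw [← dist_self (σ.γ j t)]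
      exact ((σ.ξ_tendsto hi hj).comp (continuous_snd.tendsto (t, σ.γ i t))).dist
        ((σ.γ_continuousAt hj).tendsto.comp (continuous_fst.tendsto (t, σ.γ i t)))
    exact h1.eventually (gt_mem_nhds hδ)
  have F : ∀ᶠ η in 𝓝[>] (0 : ℝ), ∀ i (θ : σ.isotropy), ∀ t ∈ closure (J i), ∀ x,
      dist x (σ.γ i t) < η →
        dist ((𝒪.chart (σ.U i)).act (σ.grp θ i) x) (σ.γ i t) < δ := by
    refine eventually_all.2 fun i => eventually_all.2 fun θ =>
      eventually_tube (hC i) (hγ i) fun t ht => ?_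
    have hi := j4 i ht
    have hc := ((𝒪.chart (σ.U i)).act_contDiffAt (σ.grp θ i) (σ.γ_mem i t hi)).continuousAt
    rw [ContinuousAt, σ.grp_fix θ hi] at hc
    have h1 : Tendsto (fun q : UnitAddCircle × Model n =>
        dist ((𝒪.chart (σ.U i)).act (σ.grp θ i) q.2) (σ.γ i q.1)) (𝓝 (t, σ.γ i t)) (𝓝 0) := by
      rw [← dist_self (σ.γ i t)]
      exact (hc.comp (continuous_snd.tendsto (t, σ.γ i t))).dist
        ((σ.γ_continuousAt hi).tendsto.comp (continuous_fst.tendsto (t, σ.γ i t)))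
    exact h1.eventually (gt_mem_nhds hδ)
  obtain ⟨η, ⟨E, F⟩, hη⟩ := ((E.and F).and (Ioo_mem_nhdsGT hδ)).exists
  -- The mean value inequality on the convex ball: the logarithm is `1 / 2`-close to the identity,
  -- hence injective and quantitatively surjective.
  have happ : ∀ {i t}, t ∈ J i → ∀ x ∈ Metric.ball (σ.γ i t) δ, ∀ y ∈ Metric.ball (σ.γ i t) δ,
      ‖σ.log i t x - σ.log i t y - (x - y)‖ ≤ 1 / 2 * ‖x - y‖ := by
    intro i t ht x hx y hy
    obtain ⟨ρ, rfl⟩ := exists_coe_eq t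
    have hd : ∀ z ∈ Metric.ball (σ.γ i ρ) δ, DifferentiableAt ℝ (σ.log i ρ) z := by
      intro z hz
      have h1 := ((A i ρ (subset_closure ht) z hz).2.1 ρ rfl).differentiableAt (by simp)
      exact DifferentiableAt.comp (g := fun p : ℝ × Model n => σ.log i p.1 p.2)
        (f := fun z : Model n => (ρ, z)) z h1 (by fun_prop)
    have := (convex_ball (σ.γ i ρ) δ).norm_image_sub_le_of_norm_hasFDerivWithin_le'
      (f := σ.log i ρ) (φ := ContinuousLinearMap.id ℝ (Model n)) (C := 1 / 2)
      (fun z hz => (hd z hz).hasFDerivAt.hasFDerivWithinAt)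
      (fun z hz => (A i ρ (subset_closure ht) z hz).2.2) hy hx
    simpa using this
  let e : Fin m → UnitAddCircle → Model n → Model n := fun i t v =>
    if h : ∃ x, dist x (σ.γ i t) < δ ∧ σ.log i t x = v then h.choose else 0
  have he : ∀ {i t x}, t ∈ J i → dist x (σ.γ i t) < δ → e i t (σ.log i t x) = x := by
    intro i t x ht hx
    have h : ∃ y, dist y (σ.γ i t) < δ ∧ σ.log i t y = σ.log i t x := ⟨x, hx, rfl⟩
    simp only [e, dif_pos h]
    exact approx_injOn (happ ht) h.choose_spec.1 hx h.choose_spec.2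
  have hv : ∀ {i t v}, t ∈ J i → ‖v‖ < η / 2 →
      dist (e i t v) (σ.γ i t) < η ∧ σ.log i t (e i t v) = v := by
    intro i t v ht hv
    -- Solving `log x = v` costs a factor `2` in the radius, so vectors shorter than `η / 2` have
    -- preimages in the `η`-tube.
    obtain ⟨x, h1, h2⟩ := approx_surj (happ ht) (σ.log_γ (hJI i ht)) (v := v)
      (by linarith [hη.2])
    have h3 : dist x (σ.γ i t) < η := by linarith
    have h4 := he ht (h3.trans hη.2)
    rw [h2] at h4
    rw [h4]
    exact ⟨h3, h2⟩
  have hsm : ∀ {i} {ρ : ℝ} {x}, (ρ : UnitAddCircle) ∈ J i → dist x (σ.γ i ρ) < δ →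
      ContDiffAt ℝ ∞ (fun p : ℝ × Model n => σ.log i p.1 p.2) (ρ, x) :=
    fun {i ρ x} ht hx => (A i ρ (subset_closure ht) x hx).2.1 ρ rfl
  refine ⟨{
    J := J
    isOpen_J := j1
    isConnected_J := j2
    closure_J := j4
    cover := fun t => (k3 t).imp fun i hi => j3 i (Or.inr (interior_subset hi))
    δ := δ
    δ_pos := hδ
    r := η / 2
    r_pos := half_pos hη.1
    e := e
    tube_V := fun {i t x} ht hx => (A i t (subset_closure ht) x hx).1
    exp_tube := fun ht h => (hv ht h).1.trans hη.2
    log_exp := fun ht h => (hv ht h).2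
    exp_log := he
    exp_smooth := ?_
    log_smooth := hsm
    tube_source := fun {i j t x} hi hj hx =>
      (B i j t ⟨subset_closure hi, subset_closure hj⟩ x hx).1
    tube_cocycle := fun {i j k t x} hi hj hk hx =>
      C i j k t ⟨⟨subset_closure hi, subset_closure hj⟩, subset_closure hk⟩ x hx
    log_ξ := fun {i j t x} hi hj hx =>
      (B i j t ⟨subset_closure hi, subset_closure hj⟩ x hx).2.1
    ξ_exp := ?_
    exp_act := ?_
    fix := fun {i} g => D i g
    act_source := fun {i j t x} g hi hj hg hx =>
      (B i j t ⟨subset_closure hi, subset_closure hj⟩ x hx).2.2 g hg }, fun i => ?_⟩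
  · intro i ρ v ht h
    obtain ⟨h1, h2⟩ := hv ht h
    have h3 := h1.trans hη.2
    have hL := hsm ht h3
    have key := contDiffAt_fibre_inverse (ε := fun p : ℝ × Model n => e i p.1 p.2) hL ?_ ?_
    · simpa only [h2] using key
    · intro w hw
      -- A kernel vector of the fibre derivative would satisfy `‖w‖ ≤ 1 / 2 * ‖w‖`.
      have h5 : fderiv ℝ (σ.log i ρ) (e i ρ v) w = 0 := by
        have h1 : HasFDerivAt (fun x : Model n => (ρ, x)) (ContinuousLinearMap.inr ℝ ℝ (Model n))
          (e i ρ v) := hasFDerivAt_prodMk_right _ _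
        have h6 := (HasFDerivAt.comp (g := fun p : ℝ × Model n => σ.log i p.1 p.2) (e i ρ v)
          (hL.differentiableAt (by simp)).hasFDerivAt h1).fderiv
        exact (DFunLike.congr_fun h6 w).trans hw
      have h6 := ContinuousLinearMap.le_of_opNorm_le _
        (A i ρ (subset_closure ht) _ h3).2.2 w
      rw [sub_apply, h5, zero_sub, norm_neg] at h6
      change ‖w‖ ≤ 1 / 2 * ‖w‖ at h6
      have h7 : ‖w‖ ≤ 0 := by linarith [norm_nonneg w]
      exact norm_le_zero_iff.1 h7
    · have hc : ContinuousAt (fun p : ℝ × Model n => dist p.2 (σ.γ i p.1)) (ρ, e i ρ v) := by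
        refine Filter.Tendsto.dist (continuousAt_snd.tendsto) ?_
        exact ContinuousAt.comp (f := fun p : ℝ × Model n => p.1) (g := fun r : ℝ => σ.γ i r)
          (σ.γ_contDiffAt (hJI i ht)).continuousAt continuousAt_fst
      filter_upwards [hc.eventually (gt_mem_nhds h3),
        (continuous_fst.tendsto (ρ, e i ρ v)).eventually
          ((isOpen_lift (j1 i)).mem_nhds ht)] with p h4 h5
      exact he h5 h4
  · intro i j t v hi hj h
    obtain ⟨h1, h2⟩ := hv hi h
    have h3 := E i j t ⟨subset_closure hi, subset_closure hj⟩ _ h1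
    -- The image under the transition map lies in the `δ`-tube, where a point is determined by its
    -- logarithm. The equivariance of the exponential is deduced in the same way.
    rw [← he hj h3, (B i j t ⟨subset_closure hi, subset_closure hj⟩ _ (h1.trans hη.2)).2.1, h2]
  · intro θ i t v hi h
    obtain ⟨h1, h2⟩ := hv hi h
    have h3 := F i θ t (subset_closure hi) _ h1
    rw [← he hi h3, σ.log_act θ i t (A i t (subset_closure hi) _ (h1.trans hη.2)).1, h2]
  · exact (subset_union_left).trans (j3 i)

end LoopSystem

end

/-! ### The systems obtained by exponentiating sections, and the loops they represent. -/

section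

variable {n : ℕ} {X : Type*} [TopologicalSpace X] {𝒪 : Orbifold n X} {m m' : ℕ}

open LoopSystem

namespace ExpData

variable {σ : LoopSystem 𝒪 m} (E : ExpData σ)

theorem J_sub (i : Fin m) : E.J i ⊆ σ.I i := subset_closure.trans (E.closure_J i)

theorem exp_zero {i : Fin m} {t : UnitAddCircle} (ht : t ∈ E.J i) : E.e i t 0 = σ.γ i t := by
  have h := E.exp_log ht (x := σ.γ i t) (by rw [dist_self]; exact E.δ_pos)
  rwa [σ.log_γ (E.J_sub i ht)] at h

theorem exp_contDiffAt_fibre {i : Fin m} {t : UnitAddCircle} {v : Model n} (ht : t ∈ E.J i)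
    (hv : ‖v‖ < E.r) : ContDiffAt ℝ ∞ (E.e i t) v := by
  obtain ⟨r, rfl⟩ := exists_coe_eq t
  exact ContDiffAt.comp (g := fun p : ℝ × Model n => E.e i p.1 p.2) (f := fun v => (r, v)) v
    (E.exp_smooth ht hv) (by fun_prop)

/-- The exponential inverts the logarithm, whose differential on the curve is the identity. -/
theorem hasFDerivAt_exp {i : Fin m} {t : UnitAddCircle} (ht : t ∈ E.J i) :
    HasFDerivAt (E.e i t) (ContinuousLinearMap.id ℝ (Model n)) 0 := by
  have hr : ‖(0 : Model n)‖ < E.r := by rw [norm_zero]; exact E.r_pos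
  refine HasFDerivAt.of_local_left_inverse (f := σ.log i t)
    (f' := ContinuousLinearEquiv.refl ℝ (Model n)) (E.exp_contDiffAt_fibre ht hr).continuousAt ?_ ?_
  · rw [E.exp_zero ht]
    exact σ.hasFDerivAt_log (E.J_sub i ht)
  · filter_upwards [continuous_norm.continuousAt.eventually (gt_mem_nhds hr)] with v hv
    exact E.log_exp ht hv

theorem exp_continuousAt {i : Fin m} {t : UnitAddCircle} {v : Model n} (ht : t ∈ E.J i)
    (hv : ‖v‖ < E.r) :
    ContinuousAt (fun q : UnitAddCircle × Model n => E.e i q.1 q.2) (t, v) := by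
  obtain ⟨r, rfl⟩ := exists_coe_eq t
  have h := (E.exp_smooth ht hv).continuousAt
  have e : 𝓝 ((r : UnitAddCircle), v) =
      map (fun p : ℝ × Model n => ((p.1 : UnitAddCircle), p.2)) (𝓝 (r, v)) := by
    rw [nhds_prod_eq, nhds_prod_eq, ← map_coe_nhds, ← map_id (f := 𝓝 v), prod_map_map_eq, map_id]
    rfl
  rw [ContinuousAt, e, tendsto_map'_iff]
  exact h

/-- Sections that are small enough to be exponentiated. -/
def adm : Set σ.Section := {s | ∀ i, ∀ t ∈ E.J i, ‖s.comp i t‖ < E.r}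

theorem act_adm_comp {s : σ.Section} (hs : s ∈ E.adm) {i j : Fin m} {t : UnitAddCircle}
    (hi : t ∈ E.J i) (hj : t ∈ E.J j) : σ.ξ i j t (E.e i t (s.comp i t)) = E.e j t (s.comp j t) := by
  rw [E.ξ_exp hi hj (hs i t hi), s.comp_eq (E.J_sub i hi) (E.J_sub j hj)]

/-- The representing system obtained by exponentiating a section. -/
def sys (s : σ.Section) (hs : s ∈ E.adm) : LoopSystem 𝒪 m where
  I := E.J
  isOpen_I := E.isOpen_J
  isConnected_I := E.isConnected_J
  cover := E.cover
  U := σ.U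
  γ i t := E.e i t (s.comp i t)
  γ_mem i t ht := E.tube_V ht (E.exp_tube ht (hs i t ht))
  γ_smooth i r hr := (ContDiffAt.comp (g := fun p : ℝ × Model n => E.e i p.1 p.2)
    (f := fun r : ℝ => (r, s.comp i r)) r (E.exp_smooth hr (hs i r hr))
    (contDiffAt_id.prodMk (s.contDiffAt (E.J_sub i hr)))).contDiffWithinAt
  ξ := σ.ξ
  ξ_transition i j t ht := σ.ξ_transition i j t ⟨E.J_sub i ht.1, E.J_sub j ht.2⟩
  ξ_locConst i j t ht := σ.ξ_locConst i j t ⟨E.J_sub i ht.1, E.J_sub j ht.2⟩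
  ξ_source i j t ht := E.tube_source ht.1 ht.2 (E.exp_tube ht.1 (hs i t ht.1))
  ξ_apply i j t ht := E.act_adm_comp hs ht.1 ht.2
  ξ_cocycle i j k t ht := by
    have h := E.exp_tube ht.1.1 (hs i t ht.1.1)
    filter_upwards [Metric.isOpen_ball.mem_nhds h] with x hx
    exact E.tube_cocycle ht.1.1 ht.1.2 ht.2 hx

theorem zero_mem_adm : (0 : σ.Section) ∈ E.adm := fun i t _ => by
  rw [Section.comp_zero, norm_zero]; exact E.r_pos

theorem sys_γ {s : σ.Section} (hs : s ∈ E.adm) (i : Fin m) (t : UnitAddCircle) :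
    (E.sys s hs).γ i t = E.e i t (s.comp i t) := rfl

theorem dist_γ {s : σ.Section} (hs : s ∈ E.adm) {i : Fin m} {t : UnitAddCircle} (ht : t ∈ E.J i) :
    dist ((E.sys s hs).γ i t) (σ.γ i t) < E.δ := E.exp_tube ht (hs i t ht)

theorem sys_zero_γ {i : Fin m} {t : UnitAddCircle} (ht : t ∈ E.J i) :
    (E.sys 0 E.zero_mem_adm).γ i t = σ.γ i t := E.exp_zero ht

/-- Since `e i t 0` is the curve, this system is `σ` restricted to the sets `J i`, and identity
patches suffice. -/
theorem loop_sys_zero : (E.sys 0 E.zero_mem_adm).loop = σ.loop :=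
  loop_eq_iff.2 ⟨Patches.toHom (C := Fin m)
    { N := E.J
      isOpen_N := E.isOpen_J
      cover := E.cover
      i := id
      l := id
      sub_left := fun _ => Subset.rfl
      sub_right := E.J_sub
      β := fun i => OpenPartialHomeomorph.ofSet _ (𝒪.chart (σ.U i)).isOpen_V
      transition := fun _ => IsTransition.ofSet _
      source := fun i t ht => (E.sys 0 E.zero_mem_adm).γ_mem i t ht
      apply := fun _ _ ht => E.sys_zero_γ ht
      compat := fun _ _ _ _ _ => Eventually.of_forall fun _ => rfl }⟩

theorem section_ext {s s' : σ.Section} (h : ∀ i, ∀ t ∈ E.J i, s.comp i t = s'.comp i t) :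
    s = s' := by
  refine Section.ext' fun i t hi => ?_
  obtain ⟨j, hj⟩ := E.cover t
  rw [s.comp_eq (E.J_sub j hj) hi, s'.comp_eq (E.J_sub j hj) hi, h j t hj]

/-! ### The domain of the exponential map -/

/-- The metric is bounded below on unit vectors over a compact set. The domain can then be defined
by the invariant metric and still consist of sections that can be exponentiated. -/
theorem exists_radius : ∃ R > 0, ∀ i, ∀ t ∈ closure (E.J i), ∀ v,
    σ.metric.h i t v v < R → ‖v‖ < E.r := by
  have key : ∀ᶠ R in 𝓝[>] (0 : ℝ), ∀ i, ∀ q ∈ closure (E.J i) ×ˢ Metric.sphere (0 : Model n) 1,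
      R < σ.metric.h i q.1 q.2 q.2 := by
    refine eventually_all.2 fun i => IsCompact.eventually_forall_prod
      (isClosed_closure.isCompact.prod (isCompact_sphere _ _))
      (P := fun (R : ℝ) (q : UnitAddCircle × Model n) => R < σ.metric.h i q.1 q.2 q.2) ?_
    rintro ⟨t, u⟩ ⟨ht, hu⟩
    have hi := E.closure_J i ht
    have hu0 : u ≠ 0 := by
      rintro rfl
      simp at hu
    have hpos := σ.metric.pos i t hi u hu0
    have hh : ContinuousAt (σ.metric.h i) t := by
      obtain ⟨r, rfl⟩ := exists_coe_eq t
      exact continuousAt_coe_iff.2 ((σ.metric.smooth i).contDiffAt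
        ((isOpen_lift (σ.isOpen_I i)).mem_nhds hi)).continuousAt
    have h1 : ContinuousAt (fun q : UnitAddCircle × Model n => σ.metric.h i q.1 q.2 q.2) (t, u) :=
      ((ContinuousAt.comp (f := Prod.fst) (x := (t, u)) hh continuousAt_fst).clm_apply
        continuousAt_snd).clm_apply continuousAt_snd
    have h2 : Tendsto (fun y : ℝ × (UnitAddCircle × Model n) => y.1) (𝓝[>] 0 ×ˢ 𝓝 (t, u)) (𝓝 0) :=
      tendsto_nhds_of_tendsto_nhdsWithin tendsto_fst
    exact h2.eventually_lt (h1.tendsto.comp tendsto_snd) hpos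
  obtain ⟨R, hR, hR0⟩ := (key.and self_mem_nhdsWithin).exists
  replace hR0 : 0 < R := hR0
  -- Here `R` bounds the metric from below on the unit sphere; by homogeneity a vector with `E.r ≤
  -- ‖v‖` has squared length above `E.r ^ 2 * R`.
  refine ⟨E.r ^ 2 * R, mul_pos (pow_pos E.r_pos 2) hR0, fun i t ht v hv => ?_⟩
  by_contra hle
  push Not at hle
  have hv0 : 0 < ‖v‖ := E.r_pos.trans_le hle
  have hu : ‖‖v‖⁻¹ • v‖ = 1 := by
    rw [norm_smul, norm_inv, norm_norm, inv_mul_cancel₀ hv0.ne']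
  have h1 := hR i (t, ‖v‖⁻¹ • v) ⟨ht, by simpa using hu⟩
  have h2 : σ.metric.h i t v v =
      ‖v‖ ^ 2 * σ.metric.h i t (‖v‖⁻¹ • v) (‖v‖⁻¹ • v) := by
    simp only [map_smul, smul_apply, smul_eq_mul]
    field_simp
  rw [h2] at hv
  have h3 : E.r ^ 2 * R ≤ ‖v‖ ^ 2 * R :=
    mul_le_mul_of_nonneg_right (pow_le_pow_left₀ E.r_pos.le hle 2) hR0.le
  have h4 := mul_lt_mul_of_pos_left h1 (pow_pos hv0 2)
  simp only at h4
  linarith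

/-- The bound on the squared length that defines the domain of the exponential map. -/
def R : ℝ := E.exists_radius.choose

theorem R_pos : 0 < E.R := E.exists_radius.choose_spec.1

/-- The domain of the exponential map: the sections of length less than a given bound. -/
def dom : Set σ.Section := {s | ∀ t, σ.metric.pair s s t < E.R}

theorem dom_bound {s : σ.Section} (hs : s ∈ E.dom) {i : Fin m} {t : UnitAddCircle}
    (ht : t ∈ closure (E.J i)) : ‖s.comp i t‖ < E.r := by
  refine E.exists_radius.choose_spec.2 i t ht _ ?_
  rw [← σ.metric.pair_eq s s (E.closure_J i ht)]
  exact hs t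

theorem dom_sub : E.dom ⊆ E.adm := fun _ hs _ _ ht => E.dom_bound hs (subset_closure ht)

theorem zero_mem_dom : (0 : σ.Section) ∈ E.dom := fun t => by
  rw [InvariantMetric.pair, Section.comp_zero, map_zero]
  exact E.R_pos

theorem isOpen_dom : IsOpen E.dom := by
  refine isOpen_iff_mem_nhds.2 fun s hs => ?_
  have key : ∀ᶠ s' in 𝓝 s, ∀ t ∈ (univ : Set UnitAddCircle), σ.metric.pair s' s' t < E.R := by
    refine isCompact_univ.eventually_forall_prod
      (P := fun (s' : σ.Section) t => σ.metric.pair s' s' t < E.R) fun t _ => ?_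
    have h0 : Tendsto (fun s' : σ.Section => (s', s')) (𝓝 s) (𝓝 (s, s)) :=
      tendsto_id.prodMk_nhds tendsto_id
    have h1 := (σ.metric.tendsto_pair s s t).comp (h0.prodMap (tendsto_id (x := 𝓝 t)))
    exact h1.eventually (gt_mem_nhds (hs t))
  exact key.mono fun s' h t => h t (mem_univ t)

/-- Scaling by `c` multiplies the squared length by `c ^ 2`, so the domain is star-shaped about the
zero section. -/
theorem isConnected_dom : IsConnected E.dom := by
  have h : StarConvex ℝ 0 E.dom := by
    refine starConvex_zero_iff.2 fun s hs c h0 h1 t => ?_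
    have h2 : σ.metric.pair (c • s) (c • s) t = c ^ 2 * σ.metric.pair s s t := by
      simp only [InvariantMetric.pair, Section.comp_smul, map_smul, smul_apply, smul_eq_mul]
      ring
    rw [h2]
    refine lt_of_le_of_lt ?_ (hs t)
    exact mul_le_of_le_one_left (σ.metric.pair_self_nonneg s t) (pow_le_one₀ h0 h1)
  exact (h.isPathConnected E.zero_mem_dom).isConnected

theorem act_mem_dom (θ : σ.isotropy) {s : σ.Section} (hs : s ∈ E.dom) :
    σ.actSection θ s ∈ E.dom := fun t => by
  rw [InvariantMetric.pair, actSection_comp,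
    σ.metric.invariant θ.1 θ.2 _ t (σ.indexAt_mem t)]
  exact hs t

/-! ### The fibres of the exponential map -/

/-- Both composites are transition maps defined on the whole tube, whose slices are convex, so
equality of germs spreads over a slice. It is used from the central curve outwards and from an
exponentiated curve back to the centre. -/
theorem ball_sub_source (θg : ∀ i, (𝒪.chart (σ.U i)).G)
    (hfix : ∀ i, ∀ t ∈ E.J i, (𝒪.chart (σ.U i)).act (θg i) (σ.γ i t) = σ.γ i t)
    {i j : Fin m} {t : UnitAddCircle} (hi : t ∈ E.J i) (hj : t ∈ E.J j) {x y : Model n}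
    (hx : dist x (σ.γ i t) < E.δ) (hy : dist y (σ.γ i t) < E.δ)
    (h : ∀ᶠ z in 𝓝 x, (𝒪.chart (σ.U j)).act (θg j) (σ.ξ i j t z) =
      σ.ξ i j t ((𝒪.chart (σ.U i)).act (θg i) z)) :
    ∀ᶠ z in 𝓝 y, (𝒪.chart (σ.U j)).act (θg j) (σ.ξ i j t z) =
      σ.ξ i j t ((𝒪.chart (σ.U i)).act (θg i) z) := by
  have hξ := σ.ξ_transition i j t ⟨E.J_sub i hi, E.J_sub j hj⟩
  refine IsTransition.germ_of_preconnected
    (hξ.trans ((𝒪.chart (σ.U j)).isTransition_actHomeo (θg j)))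
    (((𝒪.chart (σ.U i)).isTransition_actHomeo (θg i)).trans hξ)
    (convex_ball (σ.γ i t) E.δ).isPreconnected ?_ ?_ hx hy h
  · intro z hz
    have h1 := E.tube_source hi hj hz
    exact ⟨h1, hξ.mem_target h1⟩
  · intro z hz
    exact ⟨E.tube_V hi hz, E.act_source (θg i) hi hj (hfix i t hi) hz⟩

theorem commute_germ (θ : σ.isotropy) {s : σ.Section} (hs : s ∈ E.adm) {i j : Fin m}
    {t : UnitAddCircle} (hi : t ∈ E.J i) (hj : t ∈ E.J j) :
    ∀ᶠ z in 𝓝 ((E.sys s hs).γ i t), (𝒪.chart (σ.U j)).act (σ.grp θ j) (σ.ξ i j t z) =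
      σ.ξ i j t ((𝒪.chart (σ.U i)).act (σ.grp θ i) z) :=
  E.ball_sub_source (σ.grp θ) (fun i _ ht => σ.grp_fix θ (E.J_sub i ht)) hi hj
    (by rw [dist_self]; exact E.δ_pos) (E.dist_γ hs hi)
    (σ.grp_commute θ (E.J_sub i hi) (E.J_sub j hj))

theorem grp_act_γ (θ : σ.isotropy) {s : σ.Section} (hs : s ∈ E.adm)
    (hs' : σ.actSection θ s ∈ E.adm) {i : Fin m} {t : UnitAddCircle} (hi : t ∈ E.J i) :
    (𝒪.chart (σ.U i)).act (σ.grp θ i) ((E.sys s hs).γ i t) =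
      (E.sys (σ.actSection θ s) hs').γ i t :=
  E.exp_act θ hi (hs i t hi)

/-- Sections in the same orbit of the isotropy group represent the same loop. -/
theorem loop_act (θ : σ.isotropy) {s : σ.Section} (hs : s ∈ E.adm)
    (hs' : σ.actSection θ s ∈ E.adm) :
    (E.sys s hs).loop = (E.sys (σ.actSection θ s) hs').loop :=
  loop_eq_iff.2 ⟨Patches.toHom (C := Fin m)
    { N := E.J
      isOpen_N := E.isOpen_J
      cover := E.cover
      i := id
      l := id
      sub_left := fun _ => Subset.rfl
      sub_right := fun _ => Subset.rfl
      β := fun i => (𝒪.chart (σ.U i)).actHomeo (σ.grp θ i)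
      transition := fun i => (𝒪.chart (σ.U i)).isTransition_actHomeo _
      source := fun i t ht => (E.sys s hs).γ_mem i t ht
      apply := fun _ _ ht => E.grp_act_γ θ hs hs' ht
      compat := fun _ _ _ hi hj => E.commute_germ θ hs hi hj }⟩

/-- An isomorphism between the systems of two sections is induced by the isotropy group. -/
theorem exists_isotropy_of_hom {s s' : σ.Section} (hs : s ∈ E.adm) (hs' : s' ∈ E.adm)
    (f : SysHom (E.sys s hs) (E.sys s' hs')) : ∃ θ : σ.isotropy, σ.actSection θ s = s' ∧
      ∀ i, ∀ t ∈ E.J i, f.b i i t =ᶠ[𝓝 ((E.sys s hs).γ i t)]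
        (𝒪.chart (σ.U i)).act (σ.grp θ i) := by
  have hV : ∀ {i t}, t ∈ E.J i → (E.sys s hs).γ i t ∈ (𝒪.chart (σ.U i)).V :=
    fun {i t} ht => (E.sys s hs).γ_mem i t ht
  -- Over each `J i` the diagonal germs of `f` are a single group element, by rigidity and
  -- connectedness.
  have h1 : ∀ i, ∃ g, ∀ t ∈ E.J i, f.b i i t =ᶠ[𝓝 ((E.sys s hs).γ i t)]
      (𝒪.chart (σ.U i)).act g := by
    intro i
    refine (E.isConnected_J i).isPreconnected.exists_const_of_finite (E.isConnected_J i).nonempty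
      (Q := fun g t => f.b i i t =ᶠ[𝓝 ((E.sys s hs).γ i t)] (𝒪.chart (σ.U i)).act g)
      (fun g t ht hfr => ?_) (fun t ht => (f.transition ht ht).exists_germ_act (f.source ht ht))
      (fun t ht g h hg hh => (𝒪.chart (σ.U i)).act_injective_germ (hV ht) (hg.symm.trans hh))
    obtain ⟨h, hh⟩ := (f.transition ht ht).exists_germ_act (f.source ht ht)
    replace hfr := hfr.filter_mono nhdsWithin_le_nhds
    have h2 := ((E.sys s hs).γ_continuousAt (i := i) ht).tendsto.eventually
      (Filter.Eventually.eventually_nhds hh)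
    obtain ⟨t', h3, h4, h5, h6⟩ := (hfr.and_eventually
      ((f.locConst ht ht).and (h2.and ((E.isOpen_J i).mem_nhds ht)))).exists
    have : g = h := (𝒪.chart (σ.U i)).act_injective_germ (hV h6)
      (h3.symm.trans (h4.trans h5))
    rw [this]
    exact hh
  choose g hg using h1
  have happ : ∀ i, ∀ t ∈ E.J i,
      (𝒪.chart (σ.U i)).act (g i) ((E.sys s hs).γ i t) = (E.sys s' hs').γ i t := by
    intro i t ht
    rw [← (hg i t ht).self_of_nhds, f.apply ht ht]
  -- The element carries one exponentiated curve to the other, and both lie in the thin tube; so it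
  -- cannot move the central curve.
  have hfix : ∀ i, ∀ t ∈ E.J i, (𝒪.chart (σ.U i)).act (g i) (σ.γ i t) = σ.γ i t := fun i =>
    E.fix (g i) fun t ht => ⟨_, E.dist_γ hs ht, by rw [happ i t ht]; exact E.dist_γ hs' ht⟩
  -- Commutation with the cocycle is known along the exponentiated curve and is carried back to the
  -- central one.
  have hcomm : ∀ i j t, t ∈ E.J i → t ∈ E.J j → ∀ᶠ z in 𝓝 (σ.γ i t),
      (𝒪.chart (σ.U j)).act (g j) (σ.ξ i j t z) =
        σ.ξ i j t ((𝒪.chart (σ.U i)).act (g i) z) := by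
    intro i j t hi hj
    refine E.ball_sub_source g hfix hi hj (E.dist_γ hs hi) (by rw [dist_self]; exact E.δ_pos) ?_
    filter_upwards [f.compat (i := i) (i' := j) (l := i) (l' := j) hi hj hi hj, hg i t hi,
      ((E.sys s hs).ξ_tendsto (i := i) (j := j) hi hj).eventually (hg j t hj)] with z h1 h2 h3
    rw [h2] at h1
    exact h3.symm.trans h1
  -- The elements `g i` thus define an automorphism of `σ` itself, which comes from the isotropy
  -- group.
  let p : Patches σ σ (Fin m) :=
    { N := E.J
      isOpen_N := E.isOpen_J
      cover := E.cover
      i := id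
      l := id
      sub_left := E.J_sub
      sub_right := E.J_sub
      β := fun i => (𝒪.chart (σ.U i)).actHomeo (g i)
      transition := fun i => (𝒪.chart (σ.U i)).isTransition_actHomeo _
      source := fun i t ht => σ.γ_mem i t (E.J_sub i ht)
      apply := hfix
      compat := fun i j t hi hj => hcomm i j t hi hj }
  obtain ⟨θ, hθ⟩ := LoopSystem.exists_isotropy_of_hom p.toHom
  have hgrp : ∀ i, g i = σ.grp θ i := by
    intro i
    obtain ⟨t, ht⟩ := (E.isConnected_J i).nonempty
    have h1 : p.toHom.b i i t =ᶠ[𝓝 (σ.γ i t)] (𝒪.chart (σ.U i)).act (g i) :=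
      p.toHom_germ (c := i) ht
    exact (𝒪.chart (σ.U i)).act_injective_germ (σ.γ_mem i t (E.J_sub i ht))
      (h1.symm.trans (hθ i t (E.J_sub i ht)))
  refine ⟨θ, E.section_ext fun i t ht => ?_, fun i t ht => by rw [← hgrp]; exact hg i t ht⟩
  have h2 := happ i t ht
  rw [hgrp, sys_γ, sys_γ] at h2
  -- Taking equivariant logarithms turns the equality of exponentiated curves into one of sections.
  have h3 := σ.log_act θ i t (hV ht)
  rw [sys_γ, h2, E.log_exp ht (hs i t ht), E.log_exp ht (hs' i t ht)] at h3
  exact h3.symm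

theorem loop_eq_iff_act {s s' : σ.Section} (hs : s ∈ E.dom) (hs' : s' ∈ E.dom) :
    (E.sys s (E.dom_sub hs)).loop = (E.sys s' (E.dom_sub hs')).loop ↔
      ∃ θ : σ.isotropy, σ.actSection θ s = s' := by
  constructor
  · intro h
    obtain ⟨f⟩ := loop_eq_iff.1 h
    obtain ⟨θ, h1, -⟩ := E.exists_isotropy_of_hom _ _ f
    exact ⟨θ, h1⟩
  · rintro ⟨θ, rfl⟩
    exact E.loop_act θ _ _

/-- Sections take any value at a given point, and small multiples of them lie in the domain; fixing
these forces `θ` to fix every vector. -/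
theorem act_effective (θ : σ.isotropy) (h : ∀ s ∈ E.dom, σ.actSection θ s = s) : θ = 1 := by
  refine σ.isotropy_ext fun i t ht v => ?_
  obtain ⟨s, hs⟩ := σ.exists_section_value ht v
  have h1 : Tendsto (fun c : ℝ => c • s) (𝓝[>] 0) (𝓝 0) := by
    have : Tendsto (fun c : ℝ => c • s) (𝓝 0) (𝓝 ((0 : ℝ) • s)) :=
      tendsto_id.smul_const s
    rw [zero_smul] at this
    exact this.mono_left nhdsWithin_le_nhds
  obtain ⟨c, hc, hc0⟩ := ((h1.eventually (E.isOpen_dom.mem_nhds E.zero_mem_dom)).and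
    self_mem_nhdsWithin).exists
  have h2 := congrArg (fun s : σ.Section => s.comp i t) (h _ hc)
  simp only [actSection_comp, Section.comp_smul, map_smul, hs] at h2
  exact smul_right_injective _ (ne_of_gt (show (0 : ℝ) < c from hc0)) h2

end ExpData

end

/-! ### Transfers: passing from sections of one system to sections of another. -/

section

variable {n : ℕ} {X : Type*} [TopologicalSpace X] {𝒪 : Orbifold n X} {m m' : ℕ}

open LoopSystem

theorem LoopSystem.Section.ext_cover {σ : LoopSystem 𝒪 m} {s s' : σ.Section}
    (h : ∀ t, ∃ j, t ∈ σ.I j ∧ s.comp j t = s'.comp j t) : s = s' := by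
  refine Section.ext' fun i t hi => ?_
  obtain ⟨j, hj, hs⟩ := h t
  rw [s.comp_eq hj hi, s'.comp_eq hj hi, hs]

/-- Finiteness is what later allows the conditions on all patches to hold together on one
neighbourhood in the space of sections. -/
theorem SysHom.exists_finite_patches {σ : LoopSystem 𝒪 m} {τ : LoopSystem 𝒪 m'}
    (f : SysHom σ τ) : ∃ k, Nonempty (Patches σ τ (Fin k)) := by
  obtain ⟨T, hT⟩ := isCompact_univ.elim_nhds_subcover
    (fun t => f.nhd (σ.indexAt t) (τ.indexAt t) t)
    (fun t _ => isOpen_interior.mem_nhds (f.mem_nhd (σ.indexAt_mem t) (τ.indexAt_mem t)))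
  let u : Fin T.card → UnitAddCircle := fun c => T.equivFin.symm c
  refine ⟨T.card, ⟨f.patches (fun c => σ.indexAt (u c)) (fun c => τ.indexAt (u c)) u
    (fun c => σ.indexAt_mem _) (fun c => τ.indexAt_mem _)
    (fun c => f.nhd (σ.indexAt (u c)) (τ.indexAt (u c)) (u c)) (fun c => isOpen_interior)
    (fun c => Subset.rfl) fun s => ?_⟩⟩
  obtain ⟨t, ht, hs⟩ := mem_iUnion₂.1 (hT.2 (mem_univ s))
  refine ⟨T.equivFin ⟨t, ht⟩, ?_⟩
  simpa [u] using hs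

/-- The inverse of an isomorphism given by patches. -/
def Patches.symm {σ : LoopSystem 𝒪 m} {τ : LoopSystem 𝒪 m'} {C : Type*} (p : Patches σ τ C) :
    Patches τ σ C where
  N := p.N
  isOpen_N := p.isOpen_N
  cover := p.cover
  i := p.l
  l := p.i
  sub_left := p.sub_right
  sub_right := p.sub_left
  β c := (p.β c).symm
  transition c := (p.transition c).symm
  source c t ht := by rw [← p.apply c t ht]; exact (p.β c).map_source (p.source c t ht)
  apply c t ht := by rw [← p.apply c t ht]; exact (p.β c).left_inv (p.source c t ht)
  compat c d t hc hd := by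
    have h1 : Tendsto (p.β c).symm (𝓝 (τ.γ (p.l c) t)) (𝓝 (σ.γ (p.i c) t)) := by
      have := (p.β c).symm.continuousAt ((p.β c).map_source (p.source c t hc))
      rwa [ContinuousAt, (p.β c).left_inv (p.source c t hc), p.apply c t hc] at this
    have h2 : ∀ᶠ w in 𝓝 (τ.γ (p.l c) t), w ∈ (p.β c).target := by
      rw [← p.apply c t hc]
      exact (p.β c).open_target.mem_nhds ((p.β c).map_source (p.source c t hc))
    have h3 : ∀ᶠ z in 𝓝 (σ.γ (p.i c) t), σ.ξ (p.i c) (p.i d) t z ∈ (p.β d).source :=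
      (σ.ξ_tendsto (p.sub_left c hc) (p.sub_left d hd)).eventually
        ((p.β d).open_source.mem_nhds (p.source d t hd))
    filter_upwards [h1.eventually (p.compat c d t hc hd), h2, h1.eventually h3] with w h4 h5 h6
    rw [(p.β c).right_inv h5] at h4
    rw [← h4, (p.β d).left_inv h6]

namespace ExpData

variable {σ : LoopSystem 𝒪 m} {τ : LoopSystem 𝒪 m'} {E : ExpData σ} {F : ExpData τ}
  {x : σ.Section} {y : τ.Section} {hxa : x ∈ E.adm} {hya : y ∈ F.adm} {k : ℕ}

/-- The map `φ` expresses the sections of `E_σ` near `x` as sections of `E_τ` with the help of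
transition maps over the compact sets `K c`. -/
structure IsTransfer (p : Patches (E.sys x hxa) (F.sys y hya) (Fin k))
    (K : Fin k → Set UnitAddCircle) (A : Set σ.Section) (φ : σ.Section → τ.Section) : Prop where
  isOpen : IsOpen A
  mem : x ∈ A
  sub_dom : A ⊆ E.dom
  isLocal : IsLocalOperator τ φ A
  map_dom : ∀ s ∈ A, φ s ∈ F.dom
  map_base : φ x = y
  source : ∀ s ∈ A, ∀ c, ∀ t ∈ interior (K c),
    E.e (p.i c) t (s.comp (p.i c) t) ∈ (p.β c).source
  exp_eq : ∀ s ∈ A, ∀ c, ∀ t ∈ interior (K c),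
    F.e (p.l c) t ((φ s).comp (p.l c) t) = p.β c (E.e (p.i c) t (s.comp (p.i c) t))
  loop_eq : ∀ s, ∀ hs : s ∈ A, (E.sys s (E.dom_sub (sub_dom hs))).loop =
    (F.sys (φ s) (F.dom_sub (map_dom s hs))).loop

variable (p : Patches (E.sys x hxa) (F.sys y hya) (Fin k))

/-- The vectors over a point that can be transferred by a patch. -/
def Good (c : Fin k) (t : UnitAddCircle) (v : Model n) : Prop :=
  ‖v‖ < E.r ∧ E.e (p.i c) t v ∈ (p.β c).source ∧
    dist (p.β c (E.e (p.i c) t v)) (τ.γ (p.l c) t) < F.δ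

/-- The fibrewise form of a transfer. -/
def transferMap (c : Fin k) (t : UnitAddCircle) (v : Model n) : Model n :=
  τ.log (p.l c) t (p.β c (E.e (p.i c) t v))

theorem good_base {c : Fin k} {t : UnitAddCircle} (ht : t ∈ p.N c) :
    Good p c t (x.comp (p.i c) t) := by
  refine ⟨hxa _ t (p.sub_left c ht), p.source c t ht, ?_⟩
  have h := p.apply c t ht
  rw [sys_γ] at h
  rw [h]
  exact F.dist_γ _ (p.sub_right c ht)

theorem good_nhds {c : Fin k} {t : UnitAddCircle} {v : Model n} (ht : t ∈ p.N c)
    (h : Good p c t v) : ∀ᶠ q in 𝓝 (t, v), Good p c q.1 q.2 := by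
  have hi : t ∈ E.J (p.i c) := p.sub_left c ht
  have hl : t ∈ F.J (p.l c) := p.sub_right c ht
  have he := E.exp_continuousAt hi h.1
  have h1 : ContinuousAt (fun q : UnitAddCircle × Model n => p.β c (E.e (p.i c) q.1 q.2)) (t, v) :=
    ContinuousAt.comp (f := fun q : UnitAddCircle × Model n => E.e (p.i c) q.1 q.2)
      ((p.β c).continuousAt h.2.1) he
  have h2 : ContinuousAt (fun q : UnitAddCircle × Model n => τ.γ (p.l c) q.1) (t, v) :=
    ContinuousAt.comp (f := fun q : UnitAddCircle × Model n => q.1)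
      (τ.γ_continuousAt (F.J_sub _ hl)) continuousAt_fst
  refine Filter.Eventually.and ?_ (Filter.Eventually.and ?_ ?_)
  · exact (continuous_norm.comp continuous_snd).continuousAt.eventually (gt_mem_nhds h.1)
  · exact he.eventually ((p.β c).open_source.mem_nhds h.2.1)
  · exact (Filter.Tendsto.dist h1 h2).eventually (gt_mem_nhds h.2.2)

theorem transferMap_contDiffAt {c : Fin k} {r : ℝ} {v : Model n} (ht : (r : UnitAddCircle) ∈ p.N c)
    (h : Good p c r v) :
    ContDiffAt ℝ ∞ (fun q : ℝ × Model n => transferMap p c q.1 q.2) (r, v) := by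
  have hβ : IsTransition (𝒪.chart (σ.U (p.i c))) (𝒪.chart (τ.U (p.l c))) (p.β c) := p.transition c
  have h1 : ContDiffAt ℝ ∞ (fun q : ℝ × Model n => p.β c (E.e (p.i c) q.1 q.2)) (r, v) :=
    ContDiffAt.comp (f := fun q : ℝ × Model n => E.e (p.i c) q.1 q.2) (r, v)
      (hβ.contDiffAt h.2.1) (E.exp_smooth (p.sub_left c ht) h.1)
  exact ContDiffAt.comp (g := fun q : ℝ × Model n => τ.log (p.l c) q.1 q.2)
    (f := fun q : ℝ × Model n => (q.1, p.β c (E.e (p.i c) q.1 q.2))) (r, v)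
    (F.log_smooth (p.sub_right c ht) h.2.2) (contDiffAt_fst.prodMk h1)

theorem exp_transferMap {c : Fin k} {t : UnitAddCircle} {v : Model n} (ht : t ∈ p.N c)
    (h : Good p c t v) : F.e (p.l c) t (transferMap p c t v) = p.β c (E.e (p.i c) t v) :=
  F.exp_log (p.sub_right c ht) h.2.2

/-- The compatibility of patches is an identity of germs, hence persists at nearby points; it
persists at nearby times because the cocycles are locally constant. -/
theorem compat_nhds {c d : Fin k} {t : UnitAddCircle} (hc : t ∈ p.N c) (hd : t ∈ p.N d) :
    ∀ᶠ q in 𝓝 (t, x.comp (p.i c) t), ∀ᶠ z in 𝓝 (E.e (p.i c) q.1 q.2),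
      p.β d (σ.ξ (p.i c) (p.i d) q.1 z) = τ.ξ (p.l c) (p.l d) q.1 (p.β c z) := by
  have hi : t ∈ E.J (p.i c) := p.sub_left c hc
  have hf := continuous_fst.tendsto (t, x.comp (p.i c) t)
  have h1 : ∀ᶠ z in 𝓝 (E.e (p.i c) t (x.comp (p.i c) t)),
      p.β d (σ.ξ (p.i c) (p.i d) t z) = τ.ξ (p.l c) (p.l d) t (p.β c z) := p.compat c d t hc hd
  filter_upwards [(E.exp_continuousAt hi (hxa _ t hi)).eventually h1.eventually_nhds,
    hf.eventually ((E.sys x hxa).ξ_locConst (p.i c) (p.i d) t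
      ⟨p.sub_left c hc, p.sub_left d hd⟩),
    hf.eventually ((F.sys y hya).ξ_locConst (p.l c) (p.l d) t
      ⟨p.sub_right c hc, p.sub_right d hd⟩)] with q h2 h3 h4
  change σ.ξ (p.i c) (p.i d) q.1 = σ.ξ (p.i c) (p.i d) t at h3
  change τ.ξ (p.l c) (p.l d) q.1 = τ.ξ (p.l c) (p.l d) t at h4
  rw [h3, h4]
  exact h2

/-- Isomorphic systems of exponentiated sections give rise to a transfer. -/
theorem exists_transfer (hx : x ∈ E.dom) (hy : y ∈ F.dom) {K : Fin k → Set UnitAddCircle} (hK : ∀ c, IsCompact (K c))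
    (hKN : ∀ c, K c ⊆ p.N c) (hcov : ∀ t, ∃ c, t ∈ interior (K c)) :
    ∃ A φ, IsTransfer p K A φ := by
  classical
  have hJ : ∀ {c t}, t ∈ K c → t ∈ E.J (p.i c) := fun {c t} ht => p.sub_left c (hKN c ht)
  have hL : ∀ {c t}, t ∈ K c → t ∈ F.J (p.l c) := fun {c t} ht => p.sub_right c (hKN c ht)
  -- The sections that can be transferred on every compact piece with matching results on overlaps.
  -- Compactness of the pieces makes this a neighbourhood of `x`.
  let P : Set σ.Section := {s | s ∈ E.dom ∧ (∀ c, ∀ t ∈ K c, Good p c t (s.comp (p.i c) t)) ∧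
    ∀ c d, ∀ t ∈ K c ∩ K d, ∀ᶠ z in 𝓝 (E.e (p.i c) t (s.comp (p.i c) t)),
      p.β d (σ.ξ (p.i c) (p.i d) t z) = τ.ξ (p.l c) (p.l d) t (p.β c z)}
  have hP : P ∈ 𝓝 x := by
    refine Filter.Eventually.and (E.isOpen_dom.mem_nhds hx) (Filter.Eventually.and ?_ ?_)
    · refine eventually_all.2 fun c => ?_
      exact x.eventually_forall (P := fun t v => Good p c t v) (hK c)
        (fun t ht => E.J_sub _ (hJ ht)) fun t ht => good_nhds p (hKN c ht) (good_base p (hKN c ht))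
    · refine eventually_all.2 fun c => eventually_all.2 fun d => ?_
      exact x.eventually_forall (P := fun t v => ∀ᶠ z in 𝓝 (E.e (p.i c) t v),
          p.β d (σ.ξ (p.i c) (p.i d) t z) = τ.ξ (p.l c) (p.l d) t (p.β c z))
        ((hK c).inter (hK d)) (fun t ht => E.J_sub _ (hJ ht.1))
        fun t ht => compat_nhds p (hKN c ht.1) (hKN d ht.2)
  have hM : ∀ {c t}, t ∈ interior (K c) → t ∈ K c := fun {c t} ht => interior_subset ht
  have hex : ∀ s : σ.Section, ∃ z : τ.Section, s ∈ P → ∀ c j, ∀ t ∈ interior (K c), t ∈ τ.I j →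
      z.comp j t = τ.coordChange (p.l c) j t (transferMap p c t (s.comp (p.i c) t)) := by
    intro s
    by_cases hs : s ∈ P
    · have h1 : ∀ c, SmoothOnCircle (fun t => transferMap p c t (s.comp (p.i c) t))
          (interior (K c)) := by
        intro c r hr
        have hr' : (r : UnitAddCircle) ∈ K c := hM hr
        refine ContDiffAt.contDiffWithinAt ?_
        exact ContDiffAt.comp (g := fun q : ℝ × Model n => transferMap p c q.1 q.2)
          (f := fun r : ℝ => (r, s.comp (p.i c) r)) r
          (transferMap_contDiffAt p (hKN c hr') (hs.2.1 c _ hr'))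
          (contDiffAt_id.prodMk (s.contDiffAt (E.J_sub _ (hJ hr'))))
      have h2 : ∀ c d, ∀ t ∈ interior (K c), t ∈ interior (K d) →
          transferMap p d t (s.comp (p.i d) t) =
            τ.coordChange (p.l c) (p.l d) t (transferMap p c t (s.comp (p.i c) t)) := by
        intro c d t hc hd
        have h1 := (hs.2.2 c d t ⟨hM hc, hM hd⟩).self_of_nhds
        rw [E.act_adm_comp (E.dom_sub hs.1) (hJ (hM hc)) (hJ (hM hd))] at h1
        rw [transferMap, h1, F.log_ξ (hL (hM hc)) (hL (hM hd)) (hs.2.1 c t (hM hc)).2.2]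
        rfl
      obtain ⟨z, hz⟩ := τ.exists_section (fun c => interior (K c)) (fun c => isOpen_interior) hcov
        p.l (fun c t ht => F.J_sub _ (hL (hM ht)))
        (fun c t => transferMap p c t (s.comp (p.i c) t)) h1 h2
      exact ⟨z, fun _ => hz⟩
    · exact ⟨0, fun h => absurd h hs⟩
  choose φ hφ using hex
  have hφl : ∀ s ∈ P, ∀ c, ∀ t ∈ interior (K c),
      (φ s).comp (p.l c) t = transferMap p c t (s.comp (p.i c) t) := by
    intro s hs c t ht
    have hl := F.J_sub _ (hL (hM ht))
    rw [hφ s hs c (p.l c) t ht hl, τ.coordChange_self hl]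
  have hφe : ∀ s ∈ P, ∀ c, ∀ t ∈ interior (K c),
      F.e (p.l c) t ((φ s).comp (p.l c) t) = p.β c (E.e (p.i c) t (s.comp (p.i c) t)) := by
    intro s hs c t ht
    rw [hφl s hs c t ht]
    exact exp_transferMap p (hKN c (hM ht)) (hs.2.1 c t (hM ht))
  -- Near each time the transfer is a smooth fibrewise function of a single component of the
  -- section, so that component serves as the linear map.
  have hloc : IsLocalOperator τ φ (interior P) := by
    intro s hs j r hr
    obtain ⟨c, hc⟩ := hcov r
    have hrJ := E.J_sub _ (hJ (hM hc))
    refine ⟨Model n, inferInstance, inferInstance,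
      { toFun := fun s r => s.comp (p.i c) r
        map_add' := fun _ _ => rfl
        map_smul' := fun _ _ => rfl },
      fun q => τ.coordChange (p.l c) j q.1 (transferMap p c q.1 q.2),
      fun s => s.smoothTendsto_nhds hrJ, ?_, ?_⟩
    · have hg := good_nhds p (hKN c (hM hc)) ((interior_subset hs).2.1 c r (hM hc))
      have hcoe : Tendsto (fun q : ℝ × Model n => ((q.1 : UnitAddCircle), q.2))
          (𝓝 (r, s.comp (p.i c) r)) (𝓝 ((r : UnitAddCircle), s.comp (p.i c) r)) :=
        (continuous_circle_coe.prodMap continuous_id).tendsto (r, s.comp (p.i c) r)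
      have hf := continuous_fst.tendsto (r, s.comp (p.i c) r)
      filter_upwards [hcoe.eventually hg, hf.eventually (τ.eventually_mem_I hr),
        hf.eventually ((isOpen_lift isOpen_interior).mem_nhds hc)] with q h1 h2 h3
      have h4 := hM (show (q.1 : UnitAddCircle) ∈ interior (K c) from h3)
      exact (ContDiffAt.comp (f := fun q : ℝ × Model n => q.1)
        (g := fun r : ℝ => τ.coordChange (p.l c) j r) q
        (τ.coordChange_contDiffAt (F.J_sub _ (hL h4)) h2) contDiffAt_fst).clm_apply
        (transferMap_contDiffAt p (hKN c h4) h1)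
    · filter_upwards [(tendsto_fst (f := 𝓝 s) (g := 𝓝 r)).eventually
          (isOpen_interior.mem_nhds hs),
        (tendsto_snd (f := 𝓝 s) (g := 𝓝 r)).eventually (τ.eventually_mem_I hr),
        (tendsto_snd (f := 𝓝 s) (g := 𝓝 r)).eventually
          ((isOpen_lift isOpen_interior).mem_nhds hc)] with q h1 h2 h3
      exact hφ q.1 (interior_subset h1) c j q.2 h3 h2
  have hxP : x ∈ interior P := mem_interior_iff_mem_nhds.2 hP
  have hbase : φ x = y := by
    refine Section.ext_cover fun t => ?_
    obtain ⟨c, hc⟩ := hcov t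
    refine ⟨p.l c, F.J_sub _ (hL (hM hc)), ?_⟩
    have h1 := p.apply c t (hKN c (hM hc))
    rw [sys_γ, sys_γ] at h1
    rw [hφl x (interior_subset hxP) c t hc, transferMap, h1,
      F.log_exp (hL (hM hc)) (hya _ t (hL (hM hc)))]
  have hcont : ContinuousOn φ (interior P) := fun s hs =>
    (hloc.continuousAt hs).continuousWithinAt
  refine ⟨interior P ∩ φ ⁻¹' F.dom, φ,
    { isOpen := hcont.isOpen_inter_preimage isOpen_interior F.isOpen_dom
      mem := ⟨hxP, by rw [mem_preimage, hbase]; exact hy⟩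
      sub_dom := fun s hs => (interior_subset hs.1).1
      isLocal := fun s hs => hloc s hs.1
      map_dom := fun s hs => hs.2
      map_base := hbase
      source := fun s hs c t ht => ((interior_subset hs.1).2.1 c t (hM ht)).2.1
      exp_eq := fun s hs => hφe s (interior_subset hs.1)
      loop_eq := fun s hs => loop_eq_iff.2 ⟨Patches.toHom (C := Fin k)
        { N := fun c => interior (K c)
          isOpen_N := fun c => isOpen_interior
          cover := hcov
          i := p.i
          l := p.l
          sub_left := fun c t ht => hJ (hM ht)
          sub_right := fun c t ht => hL (hM ht)
          β := p.β
          transition := p.transition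
          source := fun c t ht => ((interior_subset hs.1).2.1 c t (hM ht)).2.1
          apply := fun c t ht => (hφe s (interior_subset hs.1) c t ht).symm
          compat := fun c d t hc hd => (interior_subset hs.1).2.2 c d t ⟨hM hc, hM hd⟩ }⟩ }⟩

namespace IsTransfer

variable {p} {K : Fin k → Set UnitAddCircle} {A : Set σ.Section} {φ : σ.Section → τ.Section}

theorem continuousOn (h : IsTransfer p K A φ) : ContinuousOn φ A := fun _ hs =>
  (h.isLocal.continuousAt hs).continuousWithinAt

theorem log_eq (h : IsTransfer p K A φ) (hKN : ∀ c, K c ⊆ p.N c) {s : σ.Section} (hs : s ∈ A)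
    (c : Fin k) {t : UnitAddCircle} (ht : t ∈ interior (K c)) :
    (φ s).comp (p.l c) t = τ.log (p.l c) t (p.β c (E.e (p.i c) t (s.comp (p.i c) t))) := by
  have hl : t ∈ F.J (p.l c) := p.sub_right c (hKN c (interior_subset ht))
  rw [← h.exp_eq s hs c t ht, F.log_exp hl (F.dom_sub (h.map_dom s hs) _ t hl)]

/-- On each patch exponential and logarithm cancel in both systems, and so do `β c` and its inverse.
-/
theorem left_inv (h : IsTransfer p K A φ) {B : Set τ.Section} {ψ : τ.Section → σ.Section}
    (h' : IsTransfer p.symm K B ψ) (hKN : ∀ c, K c ⊆ p.N c)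
    (hcov : ∀ t, ∃ c, t ∈ interior (K c)) {s : σ.Section} (hs : s ∈ A) (hB : φ s ∈ B) :
    ψ (φ s) = s := by
  refine Section.ext_cover fun t => ?_
  obtain ⟨c, hc⟩ := hcov t
  have hi : t ∈ E.J (p.i c) := p.sub_left c (hKN c (interior_subset hc))
  refine ⟨p.i c, E.J_sub _ hi, ?_⟩
  have h1 : (ψ (φ s)).comp (p.i c) t = σ.log (p.i c) t ((p.β c).symm
      (F.e (p.l c) t ((φ s).comp (p.l c) t))) := h'.log_eq hKN hB c hc
  rw [h1, h.exp_eq s hs c t hc, (p.β c).left_inv (h.source s hs c t hc),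
    E.log_exp hi (E.dom_sub (h.sub_dom hs) _ t hi)]

/-- A transfer is equivariant near its base point. -/
theorem exists_equivariant (h : IsTransfer p K A φ) (hK : ∀ c, IsCompact (K c))
    (hKN : ∀ c, K c ⊆ p.N c) (hcov : ∀ t, ∃ c, t ∈ interior (K c)) (θ : σ.isotropy)
    (hθ : σ.actSection θ x = x) : ∃ θ' : τ.isotropy, τ.actSection θ' y = y ∧
      ∀ᶠ s in 𝓝 x, φ (σ.actSection θ s) = τ.actSection θ' (φ s) := by
  have hβ : ∀ c, IsTransition (𝒪.chart (σ.U (p.i c))) (𝒪.chart (τ.U (p.l c))) (p.β c) :=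
    p.transition
  have hfix : ∀ c, ∀ t ∈ p.N c, (𝒪.chart (σ.U (p.i c))).act (σ.grp θ (p.i c))
      ((E.sys x hxa).γ (p.i c) t) = (E.sys x hxa).γ (p.i c) t := by
    intro c t ht
    have hi : t ∈ E.J (p.i c) := p.sub_left c ht
    rw [sys_γ, E.exp_act θ hi (hxa _ t hi), ← actSection_comp, hθ]
  have hV : ∀ c, ∀ t ∈ p.N c, (E.sys x hxa).γ (p.i c) t ∈ (𝒪.chart (σ.U (p.i c))).V :=
    fun c t ht => (E.sys x hxa).γ_mem _ t (p.sub_left c ht)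
  have hact : ∀ c, ∀ t ∈ p.N c, Tendsto ((𝒪.chart (σ.U (p.i c))).act (σ.grp θ (p.i c)))
      (𝓝 ((E.sys x hxa).γ (p.i c) t)) (𝓝 ((E.sys x hxa).γ (p.i c) t)) := by
    intro c t ht
    have := ((𝒪.chart (σ.U (p.i c))).act_contDiffAt (σ.grp θ (p.i c)) (hV c t ht)).continuousAt
    rwa [ContinuousAt, hfix c t ht] at this
  -- The automorphism of the first exponentiated system given by `θ`, conjugated by the patches, is
  -- an automorphism of the second.
  let q : Patches (F.sys y hya) (F.sys y hya) (Fin k) :=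
    { N := p.N
      isOpen_N := p.isOpen_N
      cover := p.cover
      i := p.l
      l := p.l
      sub_left := p.sub_right
      sub_right := p.sub_right
      β := fun c => ((p.β c).symm.trans
        ((𝒪.chart (σ.U (p.i c))).actHomeo (σ.grp θ (p.i c)))).trans (p.β c)
      transition := fun c => ((hβ c).symm.trans
        ((𝒪.chart (σ.U (p.i c))).isTransition_actHomeo _)).trans (hβ c)
      source := fun c t ht => by
        have h1 := p.symm.source c t ht
        have h2 : (p.β c).symm ((F.sys y hya).γ (p.l c) t) =
          (E.sys x hxa).γ (p.i c) t := p.symm.apply c t ht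
        refine ⟨⟨h1, ?_⟩, ?_⟩
        · change (p.β c).symm _ ∈ (𝒪.chart (σ.U (p.i c))).V
          rw [h2]; exact hV c t ht
        · change (𝒪.chart (σ.U (p.i c))).act _ ((p.β c).symm _) ∈ (p.β c).source
          rw [h2, hfix c t ht]; exact p.source c t ht
      apply := fun c t ht => by
        have h2 : (p.β c).symm ((F.sys y hya).γ (p.l c) t) =
          (E.sys x hxa).γ (p.i c) t := p.symm.apply c t ht
        change p.β c ((𝒪.chart (σ.U (p.i c))).act _ ((p.β c).symm _)) = _
        rw [h2, hfix c t ht, p.apply c t ht]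
      compat := fun c d t hc hd => by
        have h0 : Tendsto (p.β c).symm (𝓝 ((F.sys y hya).γ (p.l c) t))
            (𝓝 ((E.sys x hxa).γ (p.i c) t)) := p.symm.β_tendsto hc
        have h1 := h0.eventually (E.commute_germ θ hxa
          (i := p.i c) (j := p.i d) (p.sub_left c hc) (p.sub_left d hd))
        have h2 := h0.eventually ((hact c t hc).eventually (p.compat c d t hc hd))
        have h3 := p.symm.compat c d t hc hd
        filter_upwards [h1, h2, h3] with w h4 h5 h6
        change p.β d ((𝒪.chart (σ.U (p.i d))).act _ ((p.β d).symm (τ.ξ (p.l c) (p.l d) t w))) =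
          τ.ξ (p.l c) (p.l d) t (p.β c ((𝒪.chart (σ.U (p.i c))).act _ ((p.β c).symm w)))
        change (p.β d).symm (τ.ξ (p.l c) (p.l d) t w) =
          σ.ξ (p.i c) (p.i d) t ((p.β c).symm w) at h6
        rw [h6, h4]
        exact h5 }
  -- The description of fibres, applied with both sections equal to `y`, yields an isotropy element
  -- fixing `y` that realizes this automorphism.
  obtain ⟨θ', h1, h2⟩ := F.exists_isotropy_of_hom _ _ q.toHom
  have h3 : ∀ c, ∀ t ∈ p.N c, ∀ᶠ z in 𝓝 ((E.sys x hxa).γ (p.i c) t),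
      (𝒪.chart (τ.U (p.l c))).act (τ.grp θ' (p.l c)) (p.β c z) =
        p.β c ((𝒪.chart (σ.U (p.i c))).act (σ.grp θ (p.i c)) z) := by
    intro c t ht
    have h4 := (h2 (p.l c) t (p.sub_right c ht)).symm.trans (q.toHom_germ (c := c) ht)
    filter_upwards [(p.β_tendsto ht).eventually h4,
      (p.β c).open_source.mem_nhds (p.source c t ht)] with z h5 h6
    rw [h5]
    change p.β c ((𝒪.chart (σ.U (p.i c))).act _ ((p.β c).symm (p.β c z))) = _
    rw [(p.β c).left_inv h6]
  -- The conjugation identity is one of germs along the curve of `x`; by compactness it holds along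
  -- the curves of all nearby sections.
  have h4 : ∀ᶠ s in 𝓝 x, ∀ c, ∀ t ∈ K c,
      (𝒪.chart (τ.U (p.l c))).act (τ.grp θ' (p.l c))
          (p.β c (E.e (p.i c) t (s.comp (p.i c) t))) =
        p.β c ((𝒪.chart (σ.U (p.i c))).act (σ.grp θ (p.i c))
          (E.e (p.i c) t (s.comp (p.i c) t))) := by
    refine eventually_all.2 fun c => ?_
    refine x.eventually_forall (P := fun t v =>
      (𝒪.chart (τ.U (p.l c))).act (τ.grp θ' (p.l c)) (p.β c (E.e (p.i c) t v)) =
        p.β c ((𝒪.chart (σ.U (p.i c))).act (σ.grp θ (p.i c)) (E.e (p.i c) t v))) (hK c)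
      (fun t ht => E.J_sub _ (p.sub_left c (hKN c ht))) fun t ht => ?_
    have hi : t ∈ E.J (p.i c) := p.sub_left c (hKN c ht)
    exact (E.exp_continuousAt hi (hxa _ t hi)).eventually (h3 c t (hKN c ht))
  have h5 : ∀ᶠ s in 𝓝 x, σ.actSection θ s ∈ A := by
    have := (σ.actSection_continuous θ).tendsto x
    rw [hθ] at this
    exact this.eventually (h.isOpen.mem_nhds h.mem)
  refine ⟨θ', h1, ?_⟩
  filter_upwards [h4, h5, h.isOpen.mem_nhds h.mem] with s h6 h7 h8
  refine Section.ext_cover fun t => ?_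
  obtain ⟨c, hc⟩ := hcov t
  have hi : t ∈ E.J (p.i c) := p.sub_left c (hKN c (interior_subset hc))
  have hl : t ∈ F.J (p.l c) := p.sub_right c (hKN c (interior_subset hc))
  refine ⟨p.l c, F.J_sub _ hl, ?_⟩
  rw [actSection_comp, h.log_eq hKN h7 c hc, h.log_eq hKN h8 c hc, actSection_comp,
    ← E.exp_act θ hi (E.dom_sub (h.sub_dom h8) _ t hi), ← h6 c t (interior_subset hc),
    τ.log_act θ' _ t ((hβ c).mem_target (h.source s h8 c t hc))]

end IsTransfer

end ExpData

end

/-! ### Equivariant diffeomorphisms between the charts. -/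

section

variable {n : ℕ} {X : Type*} [TopologicalSpace X] {𝒪 : Orbifold n X} {m m' : ℕ}

open LoopSystem

theorem LoopSystem.actSection_add {σ : LoopSystem 𝒪 m} (θ : σ.isotropy) (s s' : σ.Section) :
    σ.actSection θ (s + s') = σ.actSection θ s + σ.actSection θ s' :=
  Section.ext' fun i t _ => by simp

theorem LoopSystem.actSection_smul {σ : LoopSystem 𝒪 m} (θ : σ.isotropy) (c : ℝ) (s : σ.Section) :
    σ.actSection θ (c • s) = c • σ.actSection θ s :=
  Section.ext' fun i t _ => by simp

/-- An element of the isotropy group is determined by its action near a section. -/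
theorem LoopSystem.eq_of_eventually_actSection {σ : LoopSystem 𝒪 m} {θ η : σ.isotropy}
    {x : σ.Section} (h : ∀ᶠ s in 𝓝 x, σ.actSection θ s = σ.actSection η s) : θ = η := by
  refine σ.isotropy_ext fun i t ht v => ?_
  obtain ⟨s, hs⟩ := σ.exists_section_value ht v
  have h1 : Tendsto (fun c : ℝ => x + c • s) (𝓝[>] 0) (𝓝 x) := by
    have : Tendsto (fun c : ℝ => x + c • s) (𝓝 0) (𝓝 (x + (0 : ℝ) • s)) :=
      tendsto_const_nhds.add (tendsto_id.smul_const s)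
    rw [zero_smul, add_zero] at this
    exact this.mono_left nhdsWithin_le_nhds
  obtain ⟨c, hc, hc0⟩ := ((h1.eventually h).and self_mem_nhdsWithin).exists
  rw [actSection_add, actSection_add, h.self_of_nhds, actSection_smul, actSection_smul] at hc
  have h2 := congrArg (fun s : σ.Section => s.comp i t) (add_left_cancel hc)
  simp only [actSection_comp, Section.comp_smul, hs] at h2
  exact smul_right_injective _ (ne_of_gt (show (0 : ℝ) < c from hc0)) h2

namespace ExpData

variable {σ : LoopSystem 𝒪 m} {τ : LoopSystem 𝒪 m'} (E : ExpData σ) (F : ExpData τ)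

open Classical in
/-- The map from sections to loops. -/
def proj (s : σ.Section) : SmoothLoop 𝒪 := if h : s ∈ E.adm then (E.sys s h).loop else σ.loop

theorem proj_eq {s : σ.Section} (hs : s ∈ E.adm) : E.proj s = (E.sys s hs).loop := dif_pos hs

theorem proj_zero : E.proj 0 = σ.loop := (E.proj_eq E.zero_mem_adm).trans E.loop_sys_zero

variable {E F} {x : σ.Section} {y : τ.Section}

/-- Sections that represent the same loop have neighbourhoods that correspond under a
diffeomorphism over the space of loops. -/
theorem exists_diffeo (hx : x ∈ E.dom) (hy : y ∈ F.dom) (h : E.proj x = F.proj y) :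
    ∃ φ : OpenPartialHomeomorph σ.Section τ.Section,
      φ.source ⊆ E.dom ∧ φ.target ⊆ F.dom ∧ x ∈ φ.source ∧ φ x = y ∧
      IsLocalOperator τ φ φ.source ∧ IsLocalOperator σ φ.symm φ.target ∧
      (∀ s ∈ φ.source, F.proj (φ s) = E.proj s) ∧
      (∀ θ, σ.actSection θ x = x → ∃ θ', τ.actSection θ' y = y ∧
        ∀ᶠ s in 𝓝 x, φ (σ.actSection θ s) = τ.actSection θ' (φ s)) ∧
      ∀ θ', τ.actSection θ' y = y → ∃ θ, σ.actSection θ x = x ∧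
        ∀ᶠ z in 𝓝 y, φ.symm (τ.actSection θ' z) = σ.actSection θ (φ.symm z) := by
  rw [E.proj_eq (E.dom_sub hx), F.proj_eq (F.dom_sub hy), loop_eq_iff] at h
  obtain ⟨f⟩ := h
  obtain ⟨k, ⟨p⟩⟩ := f.exists_finite_patches
  obtain ⟨K, hK, hKN, hcov⟩ := exists_compact_cover p.isOpen_N p.cover
  obtain ⟨A, φ, hA⟩ := exists_transfer p hx hy hK hKN hcov
  -- The reverse transfer uses the same patches and compact sets, which makes the two mutually
  -- inverse near the base points.
  obtain ⟨B, ψ, hB⟩ := exists_transfer p.symm hy hx hK hKN hcov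
  have hleft : ∀ s ∈ A, φ s ∈ B → ψ (φ s) = s := fun s hs hsB => hA.left_inv hB hKN hcov hs hsB
  -- Reversing patches twice gives back `p` definitionally, so the cancellation lemma applies in
  -- both directions.
  have hA' : IsTransfer p.symm.symm K A φ := hA
  have hright : ∀ z ∈ B, ψ z ∈ A → φ (ψ z) = z := fun s hs hsB =>
    hB.left_inv hA' hKN hcov hs hsB
  let Φ : OpenPartialHomeomorph σ.Section τ.Section :=
    { toFun := φ
      invFun := ψ
      source := A ∩ φ ⁻¹' B
      target := B ∩ ψ ⁻¹' A
      map_source' := fun s hs => ⟨hs.2, by rw [mem_preimage, hleft s hs.1 hs.2]; exact hs.1⟩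
      map_target' := fun z hz => ⟨hz.2, by rw [mem_preimage, hright z hz.1 hz.2]; exact hz.1⟩
      left_inv' := fun s hs => hleft s hs.1 hs.2
      right_inv' := fun z hz => hright z hz.1 hz.2
      open_source := hA.continuousOn.isOpen_inter_preimage hA.isOpen hB.isOpen
      open_target := hB.continuousOn.isOpen_inter_preimage hB.isOpen hA.isOpen
      continuousOn_toFun := hA.continuousOn.mono inter_subset_left
      continuousOn_invFun := hB.continuousOn.mono inter_subset_left }
  refine ⟨Φ, fun s hs => hA.sub_dom hs.1, fun z hz => hB.sub_dom hz.1,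
    ⟨hA.mem, by rw [mem_preimage, hA.map_base]; exact hB.mem⟩, hA.map_base,
    fun s hs => hA.isLocal s hs.1, fun z hz => hB.isLocal z hz.1, fun s hs => ?_,
    fun θ hθ => hA.exists_equivariant hK hKN hcov θ hθ,
    fun θ hθ => hB.exists_equivariant hK hKN hcov θ hθ⟩
  rw [E.proj_eq (E.dom_sub (hA.sub_dom hs.1)), hA.loop_eq s hs.1]
  exact F.proj_eq _

/-- The diffeomorphism may be chosen equivariant under the stabilizers. -/
theorem exists_equivariant_diffeo (hx : x ∈ E.dom) (hy : y ∈ F.dom) (h : E.proj x = F.proj y)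
    (S : Subgroup σ.isotropy) (S' : Subgroup τ.isotropy)
    (hS : ∀ θ, θ ∈ S ↔ σ.actSection θ x = x) (hS' : ∀ θ, θ ∈ S' ↔ τ.actSection θ y = y) :
    ∃ (φ : OpenPartialHomeomorph σ.Section τ.Section) (κ : S ≃* S'),
      φ.source ⊆ E.dom ∧ φ.target ⊆ F.dom ∧ x ∈ φ.source ∧ φ x = y ∧
      SmoothOn φ φ.source ∧ SmoothOn φ.symm φ.target ∧
      (∀ s ∈ φ.source, F.proj (φ s) = E.proj s) ∧
      ∀ g : S, ∀ s ∈ φ.source, σ.actSection g s ∈ φ.source ∧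
        φ (σ.actSection g s) = τ.actSection (κ g) (φ s) := by
  obtain ⟨φ, f1, f2, f3, f4, f5, f6, f7, f8, f9⟩ := exists_diffeo hx hy h
  have hφ : Tendsto φ (𝓝 x) (𝓝 y) := by
    have := φ.continuousAt f3
    rwa [ContinuousAt, f4] at this
  have hyt : y ∈ φ.target := by rw [← f4]; exact φ.map_source f3
  have hyx : φ.symm y = x := by rw [← f4]; exact φ.left_inv f3
  have hψ : Tendsto φ.symm (𝓝 y) (𝓝 x) := by
    have := φ.symm.continuousAt hyt
    rwa [ContinuousAt, hyx] at this
  have hact : ∀ g : S, Tendsto (σ.actSection g) (𝓝 x) (𝓝 x) := fun g => by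
    have := (σ.actSection_continuous g).tendsto x
    rwa [(hS g).1 g.2] at this
  have hact' : ∀ g : S', Tendsto (τ.actSection g) (𝓝 y) (𝓝 y) := fun g => by
    have := (τ.actSection_continuous g).tendsto y
    rwa [(hS' g).1 g.2] at this
  have hsrc := φ.open_source.mem_nhds f3
  have htgt := φ.open_target.mem_nhds hyt
  have hex : ∀ g : S, ∃ a : S', ∀ᶠ s in 𝓝 x, φ (σ.actSection g s) = τ.actSection a (φ s) := by
    intro g
    obtain ⟨θ', h1, h2⟩ := f8 g ((hS g).1 g.2)
    exact ⟨⟨θ', (hS' θ').2 h1⟩, h2⟩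
  choose κ hκ using hex
  -- The corresponding element is unique, as the values of `φ` fill a neighbourhood of `y` and an
  -- isotropy element is determined by its action there. Uniqueness makes the correspondence a
  -- homomorphism, and surjective.
  have huniq : ∀ (g : S) (a b : S'), (∀ᶠ s in 𝓝 x, φ (σ.actSection g s) = τ.actSection a (φ s)) →
      (∀ᶠ s in 𝓝 x, φ (σ.actSection g s) = τ.actSection b (φ s)) → a = b := by
    intro g a b ha hb
    refine Subtype.ext (eq_of_eventually_actSection (x := y) ?_)
    filter_upwards [hψ.eventually ha, hψ.eventually hb, htgt] with z h1 h2 h3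
    rw [h1, φ.right_inv h3] at h2
    exact h2
  let K : S →* S' := MonoidHom.mk' κ fun g h => by
    refine huniq (g * h) _ _ (hκ _) ?_
    filter_upwards [(hact h).eventually (hκ g), hκ h] with s h1 h2
    change φ (σ.actSection ((g : σ.isotropy) * h) s) = τ.actSection ((κ g : τ.isotropy) * κ h) _
    rw [actSection_mul, h1, h2, actSection_mul]
  have hbij : Function.Bijective K := by
    constructor
    · intro g h hgh
      refine Subtype.ext (eq_of_eventually_actSection (x := x) ?_)
      have hgh' : κ g = κ h := hgh
      have h1 := hκ g
      rw [hgh'] at h1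
      filter_upwards [h1, hκ h, (hact g).eventually hsrc, (hact h).eventually hsrc]
        with s h1 h2 h3 h4
      exact φ.injOn h3 h4 (h1.trans h2.symm)
    · intro a
      obtain ⟨θ, h1, h2⟩ := f9 a ((hS' a).1 a.2)
      refine ⟨⟨θ, (hS θ).2 h1⟩, huniq ⟨θ, (hS θ).2 h1⟩ _ _ (hκ _) ?_⟩
      filter_upwards [hφ.eventually h2, hφ.eventually ((hact' a).eventually htgt), hsrc]
        with s h3 h4 h5
      rw [φ.left_inv h5] at h3
      rw [← h3, φ.right_inv h4]
  have : Finite S := inferInstance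
  -- The sections where equivariance holds for the whole finite stabilizer. This set and its
  -- interior are invariant under `S`, so restricting to the interior gives an exactly equivariant
  -- map.
  let Z : Set σ.Section := {s | ∀ g : S, σ.actSection g s ∈ φ.source ∧
    φ (σ.actSection g s) = τ.actSection (κ g) (φ s)}
  have hZ : Z ∈ 𝓝 x := eventually_all.2 fun g => ((hact g).eventually hsrc).and (hκ g)
  have hZi : ∀ g : S, ∀ s ∈ Z, σ.actSection g s ∈ Z := by
    intro g s hs h
    have h1 := hs (h * g)
    change σ.actSection ((h : σ.isotropy) * g) s ∈ φ.source ∧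
      φ (σ.actSection ((h : σ.isotropy) * g) s) = _ at h1
    rw [actSection_mul] at h1
    refine ⟨h1.1, h1.2.trans ?_⟩
    rw [(hs g).2, ← actSection_mul]
    exact congrArg (fun a : S' => τ.actSection a (φ s)) (map_mul K h g)
  have hZs : interior Z ⊆ φ.source := by
    intro s hs
    have h1 := (interior_subset hs 1).1
    change σ.actSection (1 : σ.isotropy) s ∈ _ at h1
    rwa [actSection_one] at h1
  have hZint : ∀ g : S, ∀ s ∈ interior Z, σ.actSection g s ∈ interior Z := by
    intro g s hs
    have h1 : IsOpen (σ.actSection ((g⁻¹ : S) : σ.isotropy) ⁻¹' interior Z) :=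
      isOpen_interior.preimage (σ.actSection_continuous _)
    have h2 : σ.actSection ((g⁻¹ : S) : σ.isotropy) ⁻¹' interior Z ⊆ Z := by
      intro z hz
      have h3 := hZi g _ (interior_subset hz)
      rw [← actSection_mul] at h3
      change σ.actSection ((g : σ.isotropy) * (g : σ.isotropy)⁻¹) z ∈ Z at h3
      rwa [mul_inv_cancel, actSection_one] at h3
    refine interior_maximal h2 h1 ?_
    change σ.actSection ((g : σ.isotropy)⁻¹) (σ.actSection g s) ∈ interior Z
    rwa [← actSection_mul, inv_mul_cancel, actSection_one]
  have hr : (φ.restrOpen (interior Z) isOpen_interior).source = φ.source ∩ interior Z := rfl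
  have ht : (φ.restrOpen (interior Z) isOpen_interior).target ⊆ φ.target := fun z hz => hz.1
  refine ⟨φ.restrOpen (interior Z) isOpen_interior, MulEquiv.ofBijective K hbij,
    fun s hs => f1 hs.1, fun z hz => f2 (ht hz), ⟨f3, mem_interior_iff_mem_nhds.2 hZ⟩, f4,
    IsLocalOperator.smoothOn (OpenPartialHomeomorph.open_source _) fun s hs => f5 s hs.1,
    IsLocalOperator.smoothOn (OpenPartialHomeomorph.open_target _) fun z hz => f6 z (ht hz),
    fun s hs => f7 s hs.1, fun g s hs => ⟨⟨hZs (hZint g s hs.2), hZint g s hs.2⟩, ?_⟩⟩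
  exact (interior_subset hs.2 g).2

end ExpData

end

/-! ### Continuity and openness of the projection to the loop space. -/

section

variable {n : ℕ} {X : Type*} [TopologicalSpace X] {𝒪 : Orbifold n X} {m m' : ℕ}

open LoopSystem

theorem circleDeriv_congr {E : Type*} [NormedAddCommGroup E] [NormedSpace ℝ E] (p : ℕ)
    (f : UnitAddCircle → E) {r r' : ℝ} (h : (r : UnitAddCircle) = (r' : UnitAddCircle)) :
    circleDeriv p f r = circleDeriv p f r' := by
  have h1 : (fun z : ℝ => f ((z + (r - r') : ℝ) : UnitAddCircle)) = fun z : ℝ => f z := by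
    funext z
    rw [AddCircle.coe_add, AddCircle.coe_sub, h, sub_self, add_zero]
  have h2 := congrFun (iteratedDeriv_comp_add_const p (fun z : ℝ => f z) (r - r')) r'
  rw [h1, add_sub_cancel] at h2
  exact h2.symm

theorem LoopSystem.continuousAt_circleDeriv (σ : LoopSystem 𝒪 m) {i : Fin m} {r : ℝ}
    (hr : (r : UnitAddCircle) ∈ σ.I i) (p : ℕ) : ContinuousAt (circleDeriv p (σ.γ i)) r := by
  have h : ∀ᶠ r' in 𝓝 r, ContDiffAt ℝ ∞ (fun r : ℝ => σ.γ i r) r' :=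
    (σ.eventually_mem_I hr).mono fun _ h => σ.γ_contDiffAt h
  have := (SmoothTendsto.const (𝓕 := (⊤ : Filter Unit)) h).tendsto p
  exact (this.comp (tendsto_top.prodMk tendsto_id : Tendsto (fun r : ℝ => ((), r)) (𝓝 r) _))

theorem LoopSystem.isOpen_nhd (σ : LoopSystem 𝒪 m) {K : Fin m → Set UnitAddCircle}
    (hK : ∀ i, IsCompact (K i)) (hKI : ∀ i, K i ⊆ σ.I i) (hcov : ∀ t, ∃ i, t ∈ K i) (k : ℕ)
    {ε : ℝ} (hε : 0 < ε) : IsOpen (σ.nhd K k ε) :=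
  TopologicalSpace.isOpen_generateFrom_of_mem ⟨m, σ, K, k, ε, hε, hK, hKI, hcov, rfl⟩

theorem LoopSystem.nhd_mem_nhds (σ : LoopSystem 𝒪 m) {K : Fin m → Set UnitAddCircle}
    (hK : ∀ i, IsCompact (K i)) (hKI : ∀ i, K i ⊆ σ.I i) (hcov : ∀ t, ∃ i, t ∈ K i) (k : ℕ)
    {ε : ℝ} (hε : 0 < ε) : σ.nhd K k ε ∈ 𝓝 σ.loop := by
  refine (σ.isOpen_nhd hK hKI hcov k hε).mem_nhds ⟨σ, rfl, rfl, hKI, fun i j t ht => ⟨?_, ?_⟩, ?_⟩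
  · exact σ.ξ_source i j t ⟨hKI i ht.1, hKI j ht.2⟩
  · exact Eventually.of_forall fun _ => rfl
  · intro i r _ p _
    rw [sub_self, norm_zero]
    exact hε

namespace ExpData

variable {σ : LoopSystem 𝒪 m} {τ : LoopSystem 𝒪 m'} (E : ExpData σ) (F : ExpData τ)

theorem smoothTendsto_exp {i : Fin m} {r : ℝ} (hr : (r : UnitAddCircle) ∈ E.J i) :
    SmoothTendsto (𝓝 (0 : σ.Section)) (fun (s : σ.Section) (r : ℝ) => E.e i r (s.comp i r))
      (fun r : ℝ => σ.γ i r) r := by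
  have h := (0 : σ.Section).smoothTendsto_nhds (E.J_sub i hr)
  have h0 : ‖(0 : Model n)‖ < E.r := by rw [norm_zero]; exact E.r_pos
  refine (h.comp (Φ := fun p : ℝ × Model n => E.e i p.1 p.2) ?_).congr
    (Eventually.of_forall fun _ => rfl) ?_
  · filter_upwards [(continuous_fst.tendsto (r, (0 : Section σ).comp i r)).eventually
      ((isOpen_lift (E.isOpen_J i)).mem_nhds hr),
      (continuous_norm.comp continuous_snd).continuousAt.eventually (gt_mem_nhds h0)] with p h1 h2
    exact E.exp_smooth h1 h2
  · filter_upwards [(isOpen_lift (E.isOpen_J i)).mem_nhds hr] with r' h1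
    exact E.exp_zero h1

/-- The loops of small sections lie in a given basic neighbourhood. -/
theorem eventually_proj_mem_nhd {τ : LoopSystem 𝒪 m} {K : Fin m → Set UnitAddCircle} {k : ℕ} {ε : ℝ}
    (hK : ∀ i, IsCompact (K i)) (hKE : ∀ i, K i ⊆ E.J i) (hKI : ∀ i, K i ⊆ τ.I i)
    (hU : σ.U = τ.U) (h1 : ∀ i j, ∀ t ∈ K i ∩ K j, σ.γ i t ∈ (τ.ξ i j t).source ∧
      ∀ᶠ x in 𝓝 (σ.γ i t), σ.ξ i j t x = τ.ξ i j t x)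
    (h2 : ∀ i, ∀ r ∈ lift (K i), ∀ p ≤ k,
      ‖circleDeriv p (σ.γ i) r - circleDeriv p (τ.γ i) r‖ < ε) :
    ∀ᶠ s in 𝓝 (0 : σ.Section), E.proj s ∈ τ.nhd K k ε := by
  have h0 : ‖(0 : Model n)‖ < E.r := by rw [norm_zero]; exact E.r_pos
  have A : ∀ᶠ s in 𝓝 (0 : σ.Section), ∀ i j, ∀ t ∈ K i ∩ K j,
      E.e i t (s.comp i t) ∈ (τ.ξ i j t).source ∧
        ∀ᶠ x in 𝓝 (E.e i t (s.comp i t)), σ.ξ i j t x = τ.ξ i j t x := by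
    refine eventually_all.2 fun i => eventually_all.2 fun j => ?_
    refine (0 : σ.Section).eventually_forall (P := fun t v =>
      E.e i t v ∈ (τ.ξ i j t).source ∧ ∀ᶠ x in 𝓝 (E.e i t v), σ.ξ i j t x = τ.ξ i j t x)
      ((hK i).inter (hK j)) (fun t ht => E.J_sub i (hKE i ht.1)) fun t ht => ?_
    have hi := hKE i ht.1
    have hj := hKE j ht.2
    have he := E.exp_continuousAt hi h0
    rw [ContinuousAt] at he
    simp only [E.exp_zero hi] at he
    rw [Section.comp_zero]
    have hf := continuous_fst.tendsto (t, (0 : Model n))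
    filter_upwards [he.eventually ((τ.ξ i j t).open_source.mem_nhds (h1 i j t ht).1),
      he.eventually (h1 i j t ht).2.eventually_nhds,
      hf.eventually (σ.ξ_locConst i j t ⟨E.J_sub i hi, E.J_sub j hj⟩),
      hf.eventually (τ.ξ_locConst i j t ⟨hKI i ht.1, hKI j ht.2⟩)] with q h3 h4 h5 h6
    rw [h5, h6]
    exact ⟨h3, h4⟩
  -- Derivatives are functions on the line while compactness is available on the circle, so all
  -- lifts of `t` are treated together. The orders up to `k` are indexed by `Fin (k + 1)` to keep
  -- the conditions finite in number.
  have B : ∀ᶠ s in 𝓝 (0 : σ.Section), ∀ i, ∀ t ∈ K i, ∀ r : ℝ, (r : UnitAddCircle) = t →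
      ∀ p : Fin (k + 1), ‖circleDeriv p (fun t => E.e i t (s.comp i t)) r -
        circleDeriv p (τ.γ i) r‖ < ε := by
    refine eventually_all.2 fun i => (hK i).eventually_forall_prod
      (P := fun (s : σ.Section) t => ∀ r : ℝ, (r : UnitAddCircle) = t →
        ∀ p : Fin (k + 1), ‖circleDeriv p (fun t => E.e i t (s.comp i t)) r -
          circleDeriv p (τ.γ i) r‖ < ε) fun t ht => ?_
    obtain ⟨r, rfl⟩ := exists_coe_eq t
    have h3 : ∀ᶠ y in 𝓝 (0 : σ.Section) ×ˢ 𝓝 r, ∀ p : Fin (k + 1),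
        ‖circleDeriv p (fun t => E.e i t (y.1.comp i t)) y.2 - circleDeriv p (τ.γ i) y.2‖ < ε := by
      refine eventually_all.2 fun p => ?_
      have h4 := (E.smoothTendsto_exp (hKE i ht)).tendsto p
      have h5 := (τ.continuousAt_circleDeriv (hKI i ht) p).tendsto.comp
        (tendsto_snd (f := 𝓝 (0 : σ.Section)))
      exact (h4.sub h5).norm.eventually
        (gt_mem_nhds (h2 i r ht p (Nat.lt_succ_iff.1 p.2)))
    have e : 𝓝 (0 : σ.Section) ×ˢ 𝓝 (r : UnitAddCircle) =
        map (fun y : σ.Section × ℝ => (y.1, (y.2 : UnitAddCircle))) (𝓝 0 ×ˢ 𝓝 r) := by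
      rw [← map_coe_nhds, ← map_id (f := 𝓝 (0 : σ.Section)), prod_map_map_eq, map_id]
      rfl
    rw [e, eventually_map]
    filter_upwards [h3] with y hy r' hr' p
    rw [circleDeriv_congr p _ hr', circleDeriv_congr p _ hr']
    exact hy p
  filter_upwards [A, B, E.isOpen_dom.mem_nhds E.zero_mem_dom] with s h3 h4 h5
  refine ⟨E.sys s (E.dom_sub h5), (E.proj_eq _).symm, hU, hKE, h3, fun i r hr p hp => ?_⟩
  exact h4 i r hr r rfl ⟨p, Nat.lt_succ_of_le hp⟩

/-- A basic neighbourhood containing the loop of `s₀` is witnessed by a system `υ` for that loop in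
the prescribed charts. Transferring to the chart centred at `υ` moves `s₀` to the zero section,
where smallness can be checked. -/
theorem continuousOn_proj : ContinuousOn E.proj E.dom := by
  intro s₀ hs₀
  refine ContinuousAt.continuousWithinAt ?_
  refine TopologicalSpace.tendsto_nhds_generateFrom_iff.2 ?_
  rintro _ ⟨l, τ, K, k, ε, hε, hK, hKI, hcov, rfl⟩ ⟨υ, h1, h2, h3, h4, h5⟩
  obtain ⟨F, hF⟩ := υ.exists_expData K hK h3
  obtain ⟨φ, -, -, f3, f4, -, -, f7, -⟩ := exists_diffeo hs₀ F.zero_mem_dom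
    (h1.symm.trans F.proj_zero.symm)
  have h6 := F.eventually_proj_mem_nhd hK hF hKI h2 h4 h5
  have hφ : Tendsto φ (𝓝 s₀) (𝓝 0) := by
    have := φ.continuousAt f3
    rwa [ContinuousAt, f4] at this
  filter_upwards [hφ.eventually h6, φ.open_source.mem_nhds f3] with s h7 h8
  rw [f7 s h8] at h7
  exact h7

/-- A system near `σ` over the compact sets `K`. -/
def IsNear (σ : LoopSystem 𝒪 m) (K : Fin m → Set UnitAddCircle) (k : ℕ) (υ : LoopSystem 𝒪 m) :
    Prop :=
  υ.U = σ.U ∧ (∀ i, K i ⊆ υ.I i) ∧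
    (∀ i j, ∀ t ∈ K i ∩ K j, υ.γ i t ∈ (σ.ξ i j t).source ∧
      ∀ᶠ x in 𝓝 (υ.γ i t), υ.ξ i j t x = σ.ξ i j t x) ∧
    ∀ i, ∀ r ∈ lift (K i), ∀ p ≤ k,
      ‖circleDeriv p (υ.γ i) r - circleDeriv p (σ.γ i) r‖ < 1 / ((k : ℝ) + 1)

/-- One index governs both the order of the derivatives and the tolerance, so the neighbourhoods are
nested and form a filter basis. -/
theorem IsNear.mono {K : Fin m → Set UnitAddCircle} {k l : ℕ} {υ : LoopSystem 𝒪 m}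
    (h : IsNear σ K k υ) (hl : l ≤ k) : IsNear σ K l υ :=
  ⟨h.1, h.2.1, h.2.2.1, fun i r hr p hp => (h.2.2.2 i r hr p (hp.trans hl)).trans_le
    (one_div_le_one_div_of_le (by positivity) (by simpa using hl))⟩

/-- The filter of systems near `σ`. -/
def nearFilter (σ : LoopSystem 𝒪 m) (K : Fin m → Set UnitAddCircle) : Filter (LoopSystem 𝒪 m) :=
  ⨅ k, 𝓟 {υ | IsNear σ K k υ}

theorem mem_nearFilter {K : Fin m → Set UnitAddCircle} {S : Set (LoopSystem 𝒪 m)} :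
    S ∈ nearFilter σ K ↔ ∃ k, {υ | IsNear σ K k υ} ⊆ S := by
  have := (hasBasis_iInf_principal (s := fun k => {υ | IsNear σ K k υ})
    (directed_of_isDirected_le fun k l hkl υ h => h.mono hkl)).mem_iff (t := S)
  simpa [nearFilter] using this

theorem eventually_isNear (σ : LoopSystem 𝒪 m) (K : Fin m → Set UnitAddCircle) (k : ℕ) :
    ∀ᶠ υ in nearFilter σ K, IsNear σ K k υ := mem_nearFilter.2 ⟨k, Subset.rfl⟩

theorem smoothTendsto_nearFilter {K : Fin m → Set UnitAddCircle} (hKI : ∀ i, K i ⊆ σ.I i)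
    {i : Fin m} {r : ℝ} (hr : (r : UnitAddCircle) ∈ interior (K i)) :
    SmoothTendsto (nearFilter σ K) (fun υ (r : ℝ) => υ.γ i r) (fun r : ℝ => σ.γ i r) r where
  smooth := by
    filter_upwards [(tendsto_fst (f := nearFilter σ K) (g := 𝓝 r)).eventually
        (eventually_isNear σ K 0), (tendsto_snd (f := nearFilter σ K) (g := 𝓝 r)).eventually
        ((isOpen_lift isOpen_interior).mem_nhds hr)] with y h1 h2
    exact y.1.γ_contDiffAt (h1.2.1 i (interior_subset h2))
  smooth₀ := (σ.eventually_mem_I (hKI i (interior_subset hr))).mono fun _ h => σ.γ_contDiffAt h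
  tendsto p := by
    have h1 := (σ.continuousAt_circleDeriv (hKI i (interior_subset hr)) p).tendsto.comp
      (tendsto_snd (f := nearFilter σ K))
    have h2 : Tendsto (fun y : LoopSystem 𝒪 m × ℝ =>
        circleDeriv p (y.1.γ i) y.2 - circleDeriv p (σ.γ i) y.2) (nearFilter σ K ×ˢ 𝓝 r) (𝓝 0) := by
      refine Metric.tendsto_nhds.2 fun ε hε => ?_
      obtain ⟨k, hk⟩ := exists_nat_one_div_lt hε
      filter_upwards [(tendsto_fst (f := nearFilter σ K) (g := 𝓝 r)).eventually
        (eventually_isNear σ K (max k p)),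
        (tendsto_snd (f := nearFilter σ K) (g := 𝓝 r)).eventually
        ((isOpen_lift isOpen_interior).mem_nhds hr)] with y h3 h4
      rw [dist_zero_right]
      have h5 : (y.2 : UnitAddCircle) ∈ K i := interior_subset h4
      refine ((h3.2.2.2 i y.2 h5 p (le_max_right _ _)).trans_le ?_).trans hk
      exact one_div_le_one_div_of_le (by positivity) (by simp)
    have h3 := h2.add h1
    rw [zero_add] at h3
    refine h3.congr fun y => ?_
    exact sub_add_cancel _ _

theorem eventually_tube_nearFilter {K : Fin m → Set UnitAddCircle} {δ : ℝ} (hδ : 0 < δ) :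
    ∀ᶠ υ in nearFilter σ K, ∀ i, ∀ t ∈ K i, dist (υ.γ i t) (σ.γ i t) < δ := by
  obtain ⟨k, hk⟩ := exists_nat_one_div_lt hδ
  filter_upwards [eventually_isNear σ K k] with υ hυ i t ht
  obtain ⟨r, rfl⟩ := exists_coe_eq t
  have := hυ.2.2.2 i r ht 0 (Nat.zero_le _)
  rw [circleDeriv, circleDeriv, iteratedDeriv_zero, iteratedDeriv_zero, ← dist_eq_norm] at this
  exact this.trans hk

/-- Loops near the loop of `σ` are obtained by exponentiating small sections. -/
theorem image_proj_mem_nhds {K : Fin m → Set UnitAddCircle} (hK : ∀ i, IsCompact (K i))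
    (hKE : ∀ i, K i ⊆ E.J i) (hcov : ∀ t, ∃ i, t ∈ interior (K i)) {A : Set σ.Section}
    (hA : A ∈ 𝓝 0) : E.proj '' A ∈ 𝓝 σ.loop := by
  classical
  have hKI : ∀ i, K i ⊆ σ.I i := fun i => (hKE i).trans (E.J_sub i)
  -- For systems in the tube with the cocycle of `σ`, the fibrewise logarithms of the curves glue to
  -- a section.
  let T : Set (LoopSystem 𝒪 m) :=
    {υ | IsNear σ K 0 υ ∧ ∀ i, ∀ t ∈ K i, dist (υ.γ i t) (σ.γ i t) < E.δ}
  have hT : ∀ᶠ υ in nearFilter σ K, υ ∈ T :=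
    (eventually_isNear σ K 0).and (eventually_tube_nearFilter E.δ_pos)
  have hex : ∀ υ : LoopSystem 𝒪 m, ∃ z : σ.Section, υ ∈ T → ∀ i j, ∀ t ∈ interior (K i),
      t ∈ σ.I j → z.comp j t = σ.coordChange i j t (σ.log i t (υ.γ i t)) := by
    intro υ
    by_cases hυ : υ ∈ T
    · have h1 : ∀ i, SmoothOnCircle (fun t => σ.log i t (υ.γ i t)) (interior (K i)) := by
        intro i r hr
        have hr' : (r : UnitAddCircle) ∈ K i := interior_subset hr
        refine ContDiffAt.contDiffWithinAt ?_
        exact ContDiffAt.comp (g := fun q : ℝ × Model n => σ.log i q.1 q.2)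
          (f := fun r : ℝ => (r, υ.γ i r)) r (E.log_smooth (hKE i hr') (hυ.2 i _ hr'))
          (contDiffAt_id.prodMk (υ.γ_contDiffAt (hυ.1.2.1 i hr')))
      have h2 : ∀ i j, ∀ t ∈ interior (K i), t ∈ interior (K j) →
          σ.log j t (υ.γ j t) = σ.coordChange i j t (σ.log i t (υ.γ i t)) := by
        intro i j t hi hj
        replace hi := interior_subset hi
        replace hj := interior_subset hj
        rw [← υ.ξ_apply i j t ⟨hυ.1.2.1 i hi, hυ.1.2.1 j hj⟩,
          (hυ.1.2.2.1 i j t ⟨hi, hj⟩).2.self_of_nhds,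
          E.log_ξ (hKE i hi) (hKE j hj) (hυ.2 i t hi)]
      obtain ⟨z, hz⟩ := σ.exists_section (fun i => interior (K i)) (fun i => isOpen_interior) hcov
        id (fun i t ht => hKI i (interior_subset ht)) (fun i t => σ.log i t (υ.γ i t)) h1 h2
      exact ⟨z, fun _ => hz⟩
    · exact ⟨0, fun h => absurd h hυ⟩
  choose z hz using hex
  -- Composition with the smooth logarithm is continuous for smooth convergence, and the logarithm
  -- vanishes on the central curve.
  have hz0 : Tendsto z (nearFilter σ K) (𝓝 0) := by
    refine Section.tendsto_iff.2 fun j r hr => ?_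
    obtain ⟨i, hi⟩ := hcov r
    have hi' := hKI i (interior_subset hi)
    have hf := continuous_fst.tendsto (r, σ.γ i r)
    refine ((smoothTendsto_nearFilter hKI hi).comp
      (Φ := fun q : ℝ × Model n => σ.coordChange i j q.1 (σ.log i q.1 q.2)) ?_).congr ?_ ?_
    · filter_upwards [σ.log_contDiffAt hi', hf.eventually (σ.eventually_mem_I hr),
        hf.eventually (σ.eventually_mem_I hi')] with q h1 h2 h3
      exact (ContDiffAt.comp (f := fun q : ℝ × Model n => q.1)
        (g := fun r : ℝ => σ.coordChange i j r) q
        (σ.coordChange_contDiffAt h3 h2) contDiffAt_fst).clm_apply h1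
    · filter_upwards [(tendsto_fst (f := nearFilter σ K) (g := 𝓝 r)).eventually hT,
        (tendsto_snd (f := nearFilter σ K) (g := 𝓝 r)).eventually (σ.eventually_mem_I hr),
        (tendsto_snd (f := nearFilter σ K) (g := 𝓝 r)).eventually
          ((isOpen_lift isOpen_interior).mem_nhds hi)] with y h1 h2 h3
      exact (hz y.1 h1 i j y.2 h3 h2).symm
    · filter_upwards [σ.eventually_mem_I hi'] with r' h1
      rw [σ.log_γ h1, map_zero, Section.comp_zero]
  obtain ⟨k, hk⟩ := mem_nearFilter.1 (hT.and (hz0.eventually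
    (Filter.inter_mem hA (E.isOpen_dom.mem_nhds E.zero_mem_dom))))
  have hnhd := σ.nhd_mem_nhds hK hKI (fun t => (hcov t).imp fun i hi => interior_subset hi) k
    (ε := 1 / ((k : ℝ) + 1)) (by positivity)
  refine mem_of_superset hnhd ?_
  rintro _ ⟨υ, rfl, h1, h2, h3, h4⟩
  obtain ⟨hυ, hzA, hzd⟩ := hk (show IsNear σ K k υ from ⟨h1, h2, h3, h4⟩)
  refine ⟨z υ, hzA, ?_⟩
  rw [E.proj_eq (E.dom_sub hzd)]
  refine loop_eq_iff.2 ⟨Patches.toHom (C := Fin m)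
    { N := fun i => interior (K i)
      isOpen_N := fun i => isOpen_interior
      cover := hcov
      i := id
      l := id
      sub_left := fun i t ht => hKE i (interior_subset ht)
      sub_right := fun i t ht => h2 i (interior_subset ht)
      β := fun i => OpenPartialHomeomorph.ofSet _ (𝒪.chart (σ.U i)).isOpen_V
      transition := fun i => by
        change IsTransition (𝒪.chart (σ.U i)) (𝒪.chart (υ.U i)) _
        rw [h1]
        exact IsTransition.ofSet _
      source := fun i t ht =>
        (E.sys (z υ) (E.dom_sub hzd)).γ_mem i t (hKE i (interior_subset ht))
      apply := fun i t ht => by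
        have h5 := hz υ hυ i i t ht (hKI i (interior_subset ht))
        rw [σ.coordChange_self (hKI i (interior_subset ht))] at h5
        change E.e i t ((z υ).comp i t) = υ.γ i t
        rw [h5, E.exp_log (hKE i (interior_subset ht)) (hυ.2 i t (interior_subset ht))]
      compat := fun i j t hi hj => by
        have h5 := hz υ hυ i i t hi (hKI i (interior_subset hi))
        rw [σ.coordChange_self (hKI i (interior_subset hi))] at h5
        have h6 : (E.sys (z υ) (E.dom_sub hzd)).γ i t = υ.γ i t := by
          rw [sys_γ, h5, E.exp_log (hKE i (interior_subset hi)) (hυ.2 i t (interior_subset hi))]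
        change ∀ᶠ x in 𝓝 ((E.sys (z υ) (E.dom_sub hzd)).γ i t), σ.ξ i j t x = υ.ξ i j t x
        rw [h6]
        exact (h3 i j t ⟨interior_subset hi, interior_subset hj⟩).2.mono fun x hx => hx.symm }⟩

/-- A chart centred at the system of `s` takes its zero section to `s` by a diffeomorphism over the
loop space, so only neighbourhoods of zero sections have to be treated. -/
theorem isOpen_image_proj {W : Set σ.Section} (hW : W ⊆ E.dom) (hWo : IsOpen W) :
    IsOpen (E.proj '' W) := by
  refine isOpen_iff_mem_nhds.2 ?_
  rintro _ ⟨s, hs, rfl⟩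
  have hs' := E.dom_sub (hW hs)
  obtain ⟨K, hK, hKI, hcov⟩ := exists_compact_cover (E.sys s hs').isOpen_I (E.sys s hs').cover
  obtain ⟨F, hF⟩ := (E.sys s hs').exists_expData K hK hKI
  have h0 : F.proj 0 = E.proj s := F.proj_zero.trans (E.proj_eq hs').symm
  obtain ⟨φ, -, -, f3, f4, -, -, f7, -⟩ := exists_diffeo F.zero_mem_dom (hW hs) h0
  have hA : φ.source ∩ φ ⁻¹' W ∈ 𝓝 (0 : (E.sys s hs').Section) := by
    refine Filter.inter_mem (φ.open_source.mem_nhds f3) ((φ.continuousAt f3) ?_)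
    rw [f4]
    exact hWo.mem_nhds hs
  rw [E.proj_eq hs']
  refine mem_of_superset (F.image_proj_mem_nhds hK hF hcov hA) ?_
  rintro _ ⟨z, hz, rfl⟩
  exact ⟨φ z, hz.2, f7 z hz.1⟩

end ExpData

end

section

variable {n : ℕ} {X : Type*} [TopologicalSpace X] {𝒪 : Orbifold n X} {m m' : ℕ}

open LoopSystem

/-! ### Separation -/

/-- The inverse of `ψ` followed by `φ` is a self-transition of `b`, hence locally a group element.
-/
theorem IsTransition.exists_germ_act_comp {a b : OrbifoldChart n X}
    {φ ψ : OpenPartialHomeomorph (Model n) (Model n)} (h : IsTransition a b φ)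
    (h' : IsTransition a b ψ) {x : Model n} (hx : x ∈ φ.source) (hx' : x ∈ ψ.source) :
    ∃ g, φ =ᶠ[𝓝 x] b.act g ∘ ψ := by
  obtain ⟨g, hg⟩ := (h'.symm.trans h).exists_germ_act (x := ψ x) ⟨ψ.map_source hx', by
    change ψ.symm (ψ x) ∈ φ.source
    rwa [ψ.left_inv hx']⟩
  refine ⟨g, ?_⟩
  filter_upwards [(ψ.continuousAt hx').eventually hg, ψ.open_source.mem_nhds hx'] with y h1 h2
  change φ (ψ.symm (ψ y)) = _ at h1
  rwa [ψ.left_inv h2] at h1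

/-- Along a connected set, an isomorphism of systems differs from a given transition map by one
group element. -/
theorem SysHom.exists_act_comp {σ : LoopSystem 𝒪 m} {τ : LoopSystem 𝒪 m'} (f : SysHom σ τ)
    {i : Fin m} {l : Fin m'} {N : Set UnitAddCircle} (hN : IsConnected N) (hi : N ⊆ σ.I i)
    (hl : N ⊆ τ.I l) {ψ : OpenPartialHomeomorph (Model n) (Model n)}
    (hψ : IsTransition (𝒪.chart (σ.U i)) (𝒪.chart (τ.U l)) ψ)
    (hs : ∀ t ∈ N, σ.γ i t ∈ ψ.source) :
    ∃ g, ∀ t ∈ N, f.b i l t =ᶠ[𝓝 (σ.γ i t)] (𝒪.chart (τ.U l)).act g ∘ ψ := by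
  have hinj : ∀ t ∈ N, ∀ g h, (𝒪.chart (τ.U l)).act g ∘ ψ =ᶠ[𝓝 (σ.γ i t)]
      (𝒪.chart (τ.U l)).act h ∘ ψ → g = h := by
    intro t ht g h hgh
    refine (𝒪.chart (τ.U l)).act_injective_germ (hψ.mem_target (hs t ht)) ?_
    have h1 : Tendsto ψ.symm (𝓝 (ψ (σ.γ i t))) (𝓝 (σ.γ i t)) := by
      have := ψ.symm.continuousAt (ψ.map_source (hs t ht))
      rwa [ContinuousAt, ψ.left_inv (hs t ht)] at this
    filter_upwards [h1.eventually hgh,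
      ψ.open_target.mem_nhds (ψ.map_source (hs t ht))] with y h2 h3
    simpa [ψ.right_inv h3] using h2
  refine hN.isPreconnected.exists_const_of_finite hN.nonempty (fun g t ht hfr => ?_)
    (fun t ht => (f.transition (hi ht) (hl ht)).exists_germ_act_comp hψ
      (f.source (hi ht) (hl ht)) (hs t ht))
    (fun t ht g h hg hh => hinj t ht g h (hg.symm.trans hh))
  obtain ⟨h, hh⟩ := (f.transition (hi ht) (hl ht)).exists_germ_act_comp hψ
      (f.source (hi ht) (hl ht)) (hs t ht)
  have h2 := (σ.γ_continuousAt (hi ht)).tendsto.eventually (Filter.Eventually.eventually_nhds hh)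
  obtain ⟨t', h3, ⟨h4, h5⟩, h6⟩ := (hfr.and_eventually
    ((((f.locConst (hi ht) (hl ht)).and h2).filter_mono nhdsWithin_le_nhds).and
      self_mem_nhdsWithin)).exists
  have : g = h := hinj t' h6 g h (h3.symm.trans (h4.trans h5))
  rw [this]
  exact hh

namespace ExpData

/-- A limit of pairs of isomorphic systems is a pair of isomorphic systems. -/
theorem sysHom_of_tendsto [T2Space X] {σ : LoopSystem 𝒪 m} {τ : LoopSystem 𝒪 m'}
    {K : Fin m → Set UnitAddCircle} {K' : Fin m' → Set UnitAddCircle}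
    (hKI : ∀ i, K i ⊆ σ.I i) (hKI' : ∀ l, K' l ⊆ τ.I l)
    (hcov : ∀ t, ∃ i, t ∈ interior (K i)) (hcov' : ∀ t, ∃ l, t ∈ interior (K' l))
    {α : Type*} {𝓕 : Filter α} [𝓕.NeBot] {u : α → LoopSystem 𝒪 m} {w : α → LoopSystem 𝒪 m'}
    (hu : Tendsto u 𝓕 (nearFilter σ K)) (hw : Tendsto w 𝓕 (nearFilter τ K'))
    (f : ∀ a, SysHom (u a) (w a)) : Nonempty (SysHom σ τ) := by
  classical
  choose i hi using hcov
  choose l hl using hcov'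
  have hKi : ∀ t, t ∈ K (i t) := fun t => interior_subset (hi t)
  have hKl : ∀ t, t ∈ K' (l t) := fun t => interior_subset (hl t)
  have hun := hu.eventually (eventually_isNear σ K 0)
  have hwn := hw.eventually (eventually_isNear τ K' 0)
  have hut : ∀ {i t}, t ∈ K i → Tendsto (fun a => (u a).γ i t) 𝓕 (𝓝 (σ.γ i t)) := by
    intro i t ht
    exact Metric.tendsto_nhds.2 fun ε hε =>
      (hu.eventually (eventually_tube_nearFilter hε)).mono fun a h => h i t ht
  have hwt : ∀ {l t}, t ∈ K' l → Tendsto (fun a => (w a).γ l t) 𝓕 (𝓝 (τ.γ l t)) := by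
    intro l t ht
    exact Metric.tendsto_nhds.2 fun ε hε =>
      (hw.eventually (eventually_tube_nearFilter hε)).mono fun a h => h l t ht
  have htr : ∀ {i l t a}, IsNear σ K 0 (u a) → IsNear τ K' 0 (w a) → t ∈ K i → t ∈ K' l →
      IsTransition (𝒪.chart (σ.U i)) (𝒪.chart (τ.U l)) ((f a).b i l t) := by
    intro i l t a h1 h2 h3 h4
    have := (f a).transition (h1.2.1 i h3) (h2.2.1 l h4)
    rwa [h1.1, h2.1] at this
  -- The approximating curves have equal projections to `X`; the limits agree because `X` is
  -- Hausdorff.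
  have hproj : ∀ {i l t}, t ∈ K i → t ∈ K' l →
      (𝒪.chart (σ.U i)).proj (σ.γ i t) = (𝒪.chart (τ.U l)).proj (τ.γ l t) := by
    intro i l t h1 h2
    have c1 := (((𝒪.chart (σ.U i)).proj_continuousOn.continuousAt
      ((𝒪.chart (σ.U i)).isOpen_V.mem_nhds (σ.γ_mem i t (hKI i h1)))).tendsto.comp (hut h1))
    have c2 := (((𝒪.chart (τ.U l)).proj_continuousOn.continuousAt
      ((𝒪.chart (τ.U l)).isOpen_V.mem_nhds (τ.γ_mem l t (hKI' l h2)))).tendsto.comp (hwt h2))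
    refine tendsto_nhds_unique (c1.congr' ?_) c2
    filter_upwards [hun, hwn] with a h3 h4
    have h5 := (htr h3 h4 h1 h2).proj_apply _ ((f a).source (h3.2.1 i h1) (h4.2.1 l h2))
    rw [(f a).apply (h3.2.1 i h1) (h4.2.1 l h2)] at h5
    exact h5.symm
  have hψ : ∀ t, ∃ ψ, IsTransition (𝒪.chart (σ.U (i t))) (𝒪.chart (τ.U (l t))) ψ ∧
      σ.γ (i t) t ∈ ψ.source := by
    intro t
    obtain ⟨ψ, h1, h2, -⟩ := 𝒪.compatible (σ.U (i t)) (τ.U (l t)) _ (σ.γ_mem _ t (hKI _ (hKi t)))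
      _ (τ.γ_mem _ t (hKI' _ (hKl t))) (hproj (hKi t) (hKl t))
    exact ⟨ψ, h1, h2⟩
  choose ψ hψt hψs using hψ
  -- One `η` is spent on the variation of the limit curve over the neighbourhood of `t`, the other
  -- on the distance of the approximating curves from it.
  have hη : ∀ t, ∃ η > 0, Metric.ball (σ.γ (i t) t) (η + η) ⊆ (ψ t).source := by
    intro t
    obtain ⟨η, h1, h2⟩ := Metric.isOpen_iff.1 (ψ t).open_source _ (hψs t)
    exact ⟨η / 2, half_pos h1, by rwa [add_halves]⟩
  choose η hη0 hηs using hη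
  have hN : ∀ t, ∃ N, IsOpen N ∧ IsConnected N ∧ t ∈ N ∧ N ⊆ K (i t) ∧ N ⊆ K' (l t) ∧
      ∀ t' ∈ N, dist (σ.γ (i t) t') (σ.γ (i t) t) < η t := by
    intro t
    have h1 : {t' | dist (σ.γ (i t) t') (σ.γ (i t) t) < η t} ∈ 𝓝 t :=
      (σ.γ_continuousAt (hKI _ (hKi t))).eventually (Metric.ball_mem_nhds _ (hη0 t))
    obtain ⟨N, n1, n2, n3, n4⟩ := exists_connected_nhd
      (I := interior (K (i t)) ∩ interior (K' (l t)) ∩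
        interior {t' | dist (σ.γ (i t) t') (σ.γ (i t) t) < η t})
      ((isOpen_interior.inter isOpen_interior).inter isOpen_interior)
      (t := t) ⟨⟨hi t, hl t⟩, mem_interior_iff_mem_nhds.2 h1⟩
    have n5 := subset_closure.trans n4
    refine ⟨N, n1, n2, n3, fun s hs => interior_subset (n5 hs).1.1,
      fun s hs => interior_subset (n5 hs).1.2, fun s hs => ?_⟩
    have n6 : s ∈ {t' | dist (σ.γ (i t) t') (σ.γ (i t) t) < η t} := interior_subset (n5 hs).2
    exact n6
  choose N n1 n2 n3 n4 n5 n6 using hN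
  obtain ⟨T, hT⟩ := isCompact_univ.elim_nhds_subcover N (fun t _ => (n1 t).mem_nhds (n3 t))
  have hTc : ∀ s, ∃ c : T, s ∈ N c := by
    intro s
    obtain ⟨t, ht, hs⟩ := mem_iUnion₂.1 (hT.2 (mem_univ s))
    exact ⟨⟨t, ht⟩, hs⟩
  have hsrc : ∀ c, ∀ᶠ a in 𝓕, ∀ t ∈ N c, (u a).γ (i c) t ∈ (ψ c).source := by
    intro c
    filter_upwards [hu.eventually (eventually_tube_nearFilter (hη0 c))] with a h1 t ht
    refine hηs c ((dist_triangle _ _ _).trans_lt (add_lt_add (h1 _ t (n4 c ht)) (n6 c t ht)))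
  -- On each of the finitely many connected patches the approximating isomorphism is the fixed
  -- transition map followed by one group element.
  have hex : ∀ᶠ a in 𝓕, ∃ g : ∀ c : T, (𝒪.chart (τ.U (l c))).G, ∀ c : T, ∀ t ∈ N c,
      (u a).γ (i c) t ∈ (ψ c).source ∧
      (f a).b (i c) (l c) t =ᶠ[𝓝 ((u a).γ (i c) t)] (𝒪.chart (τ.U (l c))).act (g c) ∘ ψ c := by
    have h0 : ∀ᶠ a in 𝓕, ∀ c : T, ∀ t ∈ N c, (u a).γ (i c) t ∈ (ψ c).source :=
      eventually_all.2 fun c => hsrc c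
    filter_upwards [hun, hwn, h0] with a h1 h2 h3
    have h4 : ∀ c : T, ∃ g : (𝒪.chart (τ.U (l c))).G, ∀ t ∈ N c,
        (f a).b (i c) (l c) t =ᶠ[𝓝 ((u a).γ (i c) t)] (𝒪.chart (τ.U (l c))).act g ∘ ψ c := by
      intro c
      have h5 := (f a).exists_act_comp (n2 c) ((n4 c).trans (h1.2.1 _)) ((n5 c).trans (h2.2.1 _))
        (ψ := ψ c) (by rw [h1.1, h2.1]; exact hψt c) (h3 c)
      rwa [h2.1] at h5
    choose g hg using h4
    exact ⟨g, fun c t ht => ⟨h3 c t ht, hg c t ht⟩⟩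
  -- There are finitely many families of group elements, so one of them occurs frequently; it
  -- defines the limit isomorphism.
  obtain ⟨g, hg⟩ : ∃ g : ∀ c : T, (𝒪.chart (τ.U (l c))).G, ∃ᶠ a in 𝓕, ∀ c : T, ∀ t ∈ N c,
      (u a).γ (i c) t ∈ (ψ c).source ∧
      (f a).b (i c) (l c) t =ᶠ[𝓝 ((u a).γ (i c) t)] (𝒪.chart (τ.U (l c))).act (g c) ∘ ψ c := by
    by_contra hne
    have h1 := eventually_all.2 fun g => not_frequently.1 (not_exists.1 hne g)
    obtain ⟨a, h2, g, h3⟩ := (h1.and hex).exists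
    exact h2 g h3
  have hσs : ∀ c, ∀ t ∈ N c, σ.γ (i c) t ∈ (ψ c).source := fun c t ht =>
    hηs c ((n6 c t ht).trans (lt_add_of_pos_left _ (hη0 c)))
  let β : T → OpenPartialHomeomorph (Model n) (Model n) := fun c =>
    (ψ c).trans ((𝒪.chart (τ.U (l c))).actHomeo (g c))
  have hβt : ∀ c : T, IsTransition (𝒪.chart (σ.U (i c))) (𝒪.chart (τ.U (l c))) (β c) := fun c =>
    (hψt c).trans ((𝒪.chart (τ.U (l c))).isTransition_actHomeo _)
  have hβm : ∀ c : T, ∀ x ∈ (ψ c).source, x ∈ (β c).source := fun c x hx =>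
    ⟨hx, (hψt c).mem_target hx⟩
  -- Both sides are limits along the filter of quantities that agree frequently.
  have hβa : ∀ c : T, ∀ t ∈ N c, β c (σ.γ (i c) t) = τ.γ (l c) t := by
    intro c t ht
    have h1 := ((β c).continuousAt (hβm c _ (hσs c t ht))).tendsto.comp (hut (n4 c ht))
    refine tendsto_nhds_unique_of_frequently_eq h1 (hwt (n5 c ht)) ?_
    refine (hg.and_eventually (hun.and hwn)).mono fun a ha => ?_
    have h2 := (ha.1 c t ht).2.self_of_nhds
    rw [(f a).apply (ha.2.1.2.1 _ (n4 c ht)) (ha.2.2.2.1 _ (n5 c ht))] at h2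
    exact h2.symm
  refine ⟨Patches.toHom (C := T)
    { N := fun c => N c
      isOpen_N := fun c => n1 c
      cover := hTc
      i := fun c => i c
      l := fun c => l c
      sub_left := fun c => (n4 c).trans (hKI _)
      sub_right := fun c => (n5 c).trans (hKI' _)
      β := β
      transition := hβt
      source := fun c t ht => hβm c _ (hσs c t ht)
      apply := hβa
      compat := fun c d t hc hd => ?_ }⟩
  have c1 := n4 c hc
  have c2 := n5 c hc
  have d1 := n4 d hd
  have d2 := n5 d hd
  have hσξ := σ.ξ_transition (i c) (i d) t ⟨hKI _ c1, hKI _ d1⟩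
  have hτξ := τ.ξ_transition (l c) (l d) t ⟨hKI' _ c2, hKI' _ d2⟩
  have s1 : σ.γ (i c) t ∈ ((σ.ξ (i c) (i d) t).trans (β d)).source := by
    refine ⟨σ.ξ_source _ _ t ⟨hKI _ c1, hKI _ d1⟩, ?_⟩
    change σ.ξ (i c) (i d) t (σ.γ (i c) t) ∈ (β d).source
    rw [σ.ξ_apply _ _ t ⟨hKI _ c1, hKI _ d1⟩]
    exact hβm d _ (hσs d t hd)
  have s2 : σ.γ (i c) t ∈ ((β c).trans (τ.ξ (l c) (l d) t)).source := by
    refine ⟨hβm c _ (hσs c t hc), ?_⟩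
    change β c (σ.γ (i c) t) ∈ (τ.ξ (l c) (l d) t).source
    rw [hβa c t hc]
    exact τ.ξ_source _ _ t ⟨hKI' _ c2, hKI' _ d2⟩
  -- Both sides of the compatibility condition are transition maps on a ball about the limit point.
  -- They agree near the point of a sufficiently close approximating curve inside that ball, hence
  -- also near the centre.
  obtain ⟨ε, hε, hball⟩ := Metric.isOpen_iff.1
    (((σ.ξ (i c) (i d) t).trans (β d)).open_source.inter
      ((β c).trans (τ.ξ (l c) (l d) t)).open_source) _ ⟨s1, s2⟩
  obtain ⟨a, ha, h1, h2, h3, h4⟩ := (hg.and_eventually (hun.and (hwn.and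
    (((hut c1).eventually (Metric.ball_mem_nhds _ hε)).and
      ((hwt c2).eventually (Metric.ball_mem_nhds _ one_pos)))))).exists
  refine IsTransition.germ_of_preconnected (hσξ.trans (hβt d)) ((hβt c).trans hτξ)
    (convex_ball (σ.γ (i c) t) ε).isPreconnected (hball.trans inter_subset_left)
    (hball.trans inter_subset_right) h3 (Metric.mem_ball_self hε) ?_
  have e1 := (f a).compat (i := i c) (i' := i d) (l := l c) (l' := l d) (h1.2.1 _ c1) (h1.2.1 _ d1)
    (h2.2.1 _ c2) (h2.2.1 _ d2)
  have e2 := (h1.2.2.1 (i c) (i d) t ⟨c1, d1⟩).2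
  have e3 := ((f a).b_tendsto (h1.2.1 _ c1) (h2.2.1 _ c2)).eventually
    (h2.2.2.1 (l c) (l d) t ⟨c2, d2⟩).2
  have e4 := (ha c t hc).2
  have e5 := ((u a).ξ_tendsto (h1.2.1 _ c1) (h1.2.1 _ d1)).eventually (ha d t hd).2
  filter_upwards [e1, e2, e3, e4, e5] with x k1 k2 k3 k4 k5
  change (𝒪.chart (τ.U (l d))).act (g d) (ψ d (σ.ξ (i c) (i d) t x)) =
    τ.ξ (l c) (l d) t ((𝒪.chart (τ.U (l c))).act (g c) (ψ c x))
  rw [k2] at k5 k1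
  rw [← k2]
  simp only [Function.comp_apply] at k4 k5
  rw [k2, ← k5, k1, k3, k4]

end ExpData

/-- If two loops could not be separated, sequences of systems converging to their representatives
would represent the same loops term by term, and the limits would be isomorphic. -/
theorem t2Space_smoothLoop [T2Space X] (𝒪 : Orbifold n X) : T2Space (SmoothLoop 𝒪) := by
  refine t2_iff_nhds.2 fun {a b} hab => ?_
  obtain ⟨m, σ, rfl⟩ := exists_loop_eq a
  obtain ⟨m', τ, rfl⟩ := exists_loop_eq b
  obtain ⟨K, hK, hKI, hcov⟩ := exists_compact_cover σ.isOpen_I σ.cover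
  obtain ⟨K', hK', hKI', hcov'⟩ := exists_compact_cover τ.isOpen_I τ.cover
  have key : ∀ k : ℕ, ∃ (u : LoopSystem 𝒪 m) (w : LoopSystem 𝒪 m'), ExpData.IsNear σ K k u ∧
      ExpData.IsNear τ K' k w ∧ Nonempty (SysHom u w) := by
    intro k
    have h1 := σ.nhd_mem_nhds hK hKI (fun t => (hcov t).imp fun i hi => interior_subset hi) k
      (ε := 1 / ((k : ℝ) + 1)) (by positivity)
    have h2 := τ.nhd_mem_nhds hK' hKI' (fun t => (hcov' t).imp fun i hi => interior_subset hi) k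
      (ε := 1 / ((k : ℝ) + 1)) (by positivity)
    obtain ⟨l, ⟨u, u1, u2⟩, ⟨w, w1, w2⟩⟩ := hab.nonempty_of_mem (Filter.inter_mem
      (mem_inf_of_left h1) (mem_inf_of_right h2))
    exact ⟨u, w, u2, w2, loop_eq_iff.1 (u1.trans w1.symm)⟩
  choose u w hu hw f using key
  have hu' : Tendsto u atTop (ExpData.nearFilter σ K) := fun S hS => by
    obtain ⟨k, hk⟩ := ExpData.mem_nearFilter.1 hS
    exact (eventually_ge_atTop k).mono fun l hl => hk ((hu l).mono hl)
  have hw' : Tendsto w atTop (ExpData.nearFilter τ K') := fun S hS => by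
    obtain ⟨k, hk⟩ := ExpData.mem_nearFilter.1 hS
    exact (eventually_ge_atTop k).mono fun l hl => hk ((hw l).mono hl)
  exact loop_eq_iff.2 (ExpData.sysHom_of_tendsto hKI hKI' hcov hcov' hu' hw'
    fun k => (f k).some)

end

/-! ### Assembly of the charts into the orbifold structure. -/

section

variable {n : ℕ} {X : Type*} [TopologicalSpace X] {𝒪 : Orbifold n X} {m m' : ℕ}

open LoopSystem

namespace ExpData

variable {σ : LoopSystem 𝒪 m} {τ : LoopSystem 𝒪 m'} (E : ExpData σ) (F : ExpData τ)

/-- The uniformizing system of a neighbourhood of the loop of `σ` given by the exponential map. -/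
def chart : PreHilbertChart σ.Section σ.isotropy (SmoothLoop 𝒪) where
  isTopologicalAddGroup := inferInstance
  continuousSMul := inferInstance
  locallyConvex := inferInstance
  core := σ.metric.core
  inner_continuous := σ.metric.continuous_l2
  O := E.dom
  isOpen_O := E.isOpen_dom
  isConnected_O := E.isConnected_dom
  finite := inferInstance
  act := σ.actSection
  act_mem θ _ hs := E.act_mem_dom θ hs
  act_one s _ := σ.actSection_one s
  act_mul θ η s _ := σ.actSection_mul θ η s
  act_smooth θ := σ.actSection_smoothOn θ E.isOpen_dom
  act_effective := E.act_effective
  proj := E.proj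
  proj_continuousOn := E.continuousOn_proj
  proj_isOpen _ hW hWo := E.isOpen_image_proj hW hWo
  proj_eq_iff s hs s' hs' := by
    rw [E.proj_eq (E.dom_sub hs), E.proj_eq (E.dom_sub hs'), E.loop_eq_iff_act hs hs']

theorem chart_compatible : E.chart.Compatible F.chart := fun _ hx _ hy h =>
  exists_equivariant_diffeo hx hy h _ _ (fun _ => Iff.rfl) fun _ => Iff.rfl

theorem isFibrewiseExp : σ.IsFibrewiseExp E.dom E.proj := by
  refine ⟨E.J, E.r, E.e, E.r_pos, E.J_sub, fun i p hp => ?_,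
    fun i t ht => ⟨E.exp_zero ht, E.hasFDerivAt_exp ht⟩, fun s hs => ?_⟩
  · exact (E.exp_smooth hp.1 (mem_ball_zero_iff.1 hp.2)).contDiffWithinAt
  · have hs' := E.dom_sub hs
    exact ⟨E.sys s hs', (E.proj_eq hs').symm, rfl, rfl, fun i t ht => ⟨hs' i t ht, rfl⟩,
      fun i j t ht => ⟨(E.sys s hs').ξ_source i j t ht, Eventually.of_forall fun _ => rfl⟩⟩

end ExpData

/-- Exponential data along a representing system. -/
def LoopSystem.expData (σ : LoopSystem 𝒪 m) : ExpData σ :=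
  (σ.exists_expData (fun _ => ∅) (fun _ => isCompact_empty) fun _ => empty_subset _).choose

/-- The pre-Hilbert orbifold structure of the loop space. -/
def loopOrbifold [T2Space X] (𝒪 : Orbifold n X) : PreHilbertOrbifold (SmoothLoop 𝒪) where
  t2 := t2Space_smoothLoop 𝒪
  charts := {c | ∃ (m : ℕ) (σ : LoopSystem 𝒪 m),
    c = PreHilbertUniformizer.mk σ.Section σ.isotropy σ.expData.chart}
  cover l := by
    obtain ⟨m, σ, rfl⟩ := exists_loop_eq l
    exact ⟨_, ⟨m, σ, rfl⟩, (0 : σ.Section), σ.expData.zero_mem_dom, σ.expData.proj_zero⟩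
  compatible := by
    rintro _ ⟨m, σ, rfl⟩ _ ⟨m', τ, rfl⟩
    exact σ.expData.chart_compatible τ.expData

end

end OrbifoldLoops

end

theorem theorem3p5p5 {n : ℕ} {X : Type*} [TopologicalSpace X] [T2Space X] (𝒪 : Orbifold n X) :
    ∃ 𝒮 : PreHilbertOrbifold (SmoothLoop 𝒪),
      ∀ (m : ℕ) (σ : LoopSystem 𝒪 m),
        ∃ c : PreHilbertChart σ.Section σ.isotropy (SmoothLoop 𝒪),
          -- the uniformizing system `(O(Γ(E_σ)), G_σ, π_σ)` belongs to the orbifold structure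
          PreHilbertUniformizer.mk σ.Section σ.isotropy c ∈ 𝒮.charts ∧
          -- `O(Γ(E_σ))` is a neighbourhood of the zero section, which is sent to the loop of `σ`
          0 ∈ c.O ∧ c.proj 0 = σ.loop ∧
          -- `G_σ` acts on sections as a group of automorphisms of `E_σ`
          (∀ (θ : σ.isotropy) (s : σ.Section), ∀ i t, (c.act θ s).comp i t = θ.1 i t (s.comp i t)) ∧
          -- the inner product is the `L²` product of an invariant metric on `E_σ`
          (∃ h : σ.InvariantMetric, ∀ s s', c.core.inner s s' = h.l2 s s') ∧
          -- `π_σ(s)` is the loop obtained by exponentiating the section `s` fibrewise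
          σ.IsFibrewiseExp c.O c.proj := by
  exact ⟨loopOrbifold 𝒪, fun m σ => ⟨σ.expData.chart, ⟨m, σ, rfl⟩, σ.expData.zero_mem_dom,
    σ.expData.proj_zero, fun _ _ _ _ => rfl, ⟨σ.metric, fun _ _ => rfl⟩, σ.expData.isFibrewiseExp⟩⟩
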